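/- Let $n\ge 4$ and let $W=W(D_n)$ act on $E=\mathbb R^n$ (orthonormal basis $e_1,\dots,e_n$) as the group generated by the reflections in the roots $\pm e_i\pm e_j$, $i\ne j$; it has index $2$ in the group $W(B_n)$ of all signed permutations of $e_1,\dots,e_n$. A reflection subgroup of $W$ is a subgroup generated by elements that act on $E$ as reflections; its parabolic closure is the pointwise stabilizer in $W$ of its space of fixed vectors; a Coxeter element of it is the product, in any order, of the members of a Coxeter generating set (the reflections in the simple roots of some simple system). Let $\mathcal R$ be the set of $W$-conjugacy classes of reflection subgroups and $\mathcal C$ the set of conjugacy classes of elements of $W$. The cycle type of a signed permutation is the double partition $(\mu^1,\mu^2)$ of $n$ recording the lengths of its positive and of its negative cycles, a cycle being positive if it involves an even number of sign changes. A partition is even if all its parts are even; for an even partition $\mu$ of $n$, the elements of cycle type $(\mu,\emptyset)$ are said to have cycle type $(\mu,+)$ if they are conjugate under $W$, and $(\mu,-)$ if they are conjugate under an element of $W(B_n)\setminus W$, to a permutation of $e_1,\dots,e_n$. For a double partition $\lambda=(\lambda^1,\lambda^2)$ of $n$ with $\lambda^2>1$ (all parts of $\lambda^2$ exceed $1$;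 $\lambda^2=\emptyset$ is allowed), divide $\{1,\dots,n\}$ into consecutive blocks whose lengths are the parts of $\lambda^1$ followed by those of $\lambda^2$, and let $$W_\lambda=\prod_i W(A_{\lambda^1_i-1})\times\prod_i W(D_{\lambda^2_i}),$$ where $W(A_{k-1})$ on a block is generated by the reflections in the $e_i-e_j$, and $W(D_k)$ on a block by those in the $e_i\pm e_j$, with $i\neq j$ in the block. For an even partition $\lambda$ of $n$ let $W_\lambda^{+}=\prod_i W(A_{\lambda_i-1})$ be formed in this way, and let $W_\lambda^-$ be formed in the same way with $e_1$ replaced by $-e_1$. Then: 1. The conjugacy classes of reflection subgroups of $W$ are represented, each exactly once, by $\{W_\lambda \mid \lambda^2>1\}$ if $n$ is odd, and by $\{W_\lambda \mid \lambda^2>1,\ \lambda^1 \text{ not even in case } \lambda^2=\emptyset\}\cup\{W_\lambda^{\pm}\mid \lambda\vdash n \text{ even}\}$ if $n$ is even. 2. If $\lambda^1\vdash m$, the parabolic closure of $W_\lambda$ is the subgroup $W(D_{n-m})\times\prod_i W(A_{\lambda^1_i-1})$, that is, $W_{(\lambda^1,(n-m))}$, or $W_{(\lambda^1,\emptyset)}$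 if $m=n$. The parabolic closure of $W_\lambda^{\epsilon}$, $\epsilon=\pm$, is $W_\lambda^\epsilon$ itself. 3. The Coxeter elements of $W_\lambda$ have cycle type $(\lambda^1,(\lambda^2-1)\cup 1^{\ell(\lambda^2)})$, where $\lambda^2-1$ is obtained by subtracting $1$ from every part of $\lambda^2$ and $\ell(\lambda^2)$ is the number of its parts. The Coxeter elements of $W_\lambda^\epsilon$ have cycle type $(\lambda,\epsilon)$. 4. Every reflection subgroup $R$ of $W$ has Coxeter elements, and there is a well-defined map $\gamma:\mathcal R\to\mathcal C$ sending the class of $R$ to the class of any Coxeter element of $R$. It is injective but not surjective. -/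

import Mathlib

noncomputable section

namespace TypeD

/-- The Euclidean space `ℝⁿ` on which the groups of types `D_n` and `B_n` act. -/
abbrev E (n : ℕ) : Type := EuclideanSpace ℝ (Fin n)

/-- The standard basis vector `e_i`. -/
abbrev e {n : ℕ} (i : Fin n) : E n := EuclideanSpace.single i (1 : ℝ)

/-- The orthogonal reflection in the hyperplane `v^⊥`. -/
def refl {n : ℕ} (v : E n) : E n ≃ₗᵢ[ℝ] E n := (Submodule.span ℝ {v})ᗮ.reflection

/-- The root system of type `D_n`: all vectors `± e_i ± e_j` with `i ≠ j`. -/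
def roots (n : ℕ) : Set (E n) :=
  {v | ∃ i j : Fin n, i ≠ j ∧ ∃ a b : ℤˣ, v = ((a : ℤ) : ℝ) • e i + ((b : ℤ) : ℝ) • e j}

/-- The reflection group `W(D_n)`. -/
def WD (n : ℕ) : Subgroup (E n ≃ₗᵢ[ℝ] E n) :=
  Subgroup.closure (refl '' roots n)

/-- The reflection group `W(B_n)`; its roots are those of `W(D_n)` and the vectors `± e_i`. -/
def WB (n : ℕ) : Subgroup (E n ≃ₗᵢ[ℝ] E n) :=
  Subgroup.closure (refl '' (roots n ∪ Set.range e))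

/-- The elements of `W(D_n)` that act on `ℝⁿ` as reflections. -/
def IsReflection {n : ℕ} (t : WD n) : Prop :=
  ∃ v : E n, v ≠ 0 ∧ (t : E n ≃ₗᵢ[ℝ] E n) = refl v

/-- A reflection subgroup is a subgroup generated by a set of reflections. -/
def IsReflectionSubgroup {n : ℕ} (R : Subgroup (WD n)) : Prop :=
  ∃ Y : Set (WD n), (∀ t ∈ Y, IsReflection t) ∧ R = Subgroup.closure Y

/-- Conjugacy of subgroups under `W(D_n)`. -/
def SubgroupConj {n : ℕ} (R R' : Subgroup (WD n)) : Prop :=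
  ∃ w : WD n, R' = R.map (MulAut.conj w).toMonoidHom

/-- Conjugacy on the set of reflection subgroups. -/
def conjSetoid (n : ℕ) : Setoid {R : Subgroup (WD n) // IsReflectionSubgroup R} where
  r R R' := SubgroupConj R.1 R'.1
  iseqv :=
    { refl := fun R => ⟨1, by
        have h : (MulAut.conj (1 : WD n)).toMonoidHom = MonoidHom.id _ := by ext x; simp
        rw [h, Subgroup.map_id]⟩
      symm := by
        rintro ⟨R, _⟩ ⟨R', _⟩ ⟨w, hw⟩
        refine ⟨w⁻¹, ?_⟩
        have h : (MulAut.conj w⁻¹).toMonoidHom.comp (MulAut.conj w).toMonoidHom =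
            MonoidHom.id _ := by ext x; simp [mul_assoc]
        simp only at hw ⊢
        rw [hw, Subgroup.map_map, h, Subgroup.map_id]
      trans := by
        rintro ⟨R, _⟩ ⟨R', _⟩ ⟨R'', _⟩ ⟨w, hw⟩ ⟨w', hw'⟩
        refine ⟨w' * w, ?_⟩
        have h : (MulAut.conj w').toMonoidHom.comp (MulAut.conj w).toMonoidHom =
            (MulAut.conj (w' * w)).toMonoidHom := by ext x; simp [mul_assoc]
        simp only at hw hw' ⊢
        rw [hw', hw, Subgroup.map_map, h] }

/-- The set of conjugacy classes of reflection subgroups of `W(D_n)`. -/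
def ReflClasses (n : ℕ) : Type := Quotient (conjSetoid n)

/-- The conjugacy class of a reflection subgroup. -/
def ReflClasses.mk {n : ℕ} (R : Subgroup (WD n)) (hR : IsReflectionSubgroup R) :
    ReflClasses n :=
  Quotient.mk (conjSetoid n) ⟨R, hR⟩

/-- The family `F` consists of reflection subgroups and contains, for every reflection subgroup,
exactly one conjugate of it. -/
def RepresentsReflClasses {n : ℕ} {ι : Type} (F : ι → Subgroup (WD n)) : Prop :=
  (∀ i, IsReflectionSubgroup (F i)) ∧
    ∀ R : Subgroup (WD n), IsReflectionSubgroup R → ∃! i, SubgroupConj R (F i)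

/-- The parabolic closure of `X`: the pointwise stabilizer in `W(D_n)` of the space of vectors
fixed by all elements of `X`. -/
def parabolicClosure {n : ℕ} (X : Set (WD n)) : Subgroup (WD n) where
  carrier := {w | ∀ v : E n, (∀ x ∈ X, x.1 v = v) → w.1 v = v}
  one_mem' := by intro v _; rfl
  mul_mem' := by
    intro a b ha hb v hv
    change a.1 (b.1 v) = v
    rw [hb v hv, ha v hv]
  inv_mem' := by
    intro a ha v hv
    change a.1.symm v = v
    rw [LinearIsometryEquiv.symm_apply_eq, ha v hv]

/-- The roots of the subgroup `R`: the roots whose reflection lies in `R`. -/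
def rootsOf {n : ℕ} (R : Subgroup (WD n)) : Set (E n) :=
  {v | v ∈ roots n ∧ ∃ t ∈ R, (t : E n ≃ₗᵢ[ℝ] E n) = refl v}

/-- `α 0, …, α (r-1)` are the simple roots of `R` for some choice of a chamber (so that the
`refl (α i)` form a Coxeter generating set of `R`): they are linearly independent roots of `R`,
every root of `R` is a linear combination of them with coefficients all `≥ 0` or all `≤ 0`, and
their reflections generate `R`. -/
def IsSimpleSystem {n r : ℕ} (R : Subgroup (WD n)) (α : Fin r → E n) : Prop :=
  LinearIndependent ℝ α ∧ (∀ i, α i ∈ rootsOf R) ∧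
    (∀ v ∈ rootsOf R, ∃ c : Fin r → ℝ, (∀ i, 0 ≤ c i) ∧
      (v = ∑ i, c i • α i ∨ v = -∑ i, c i • α i)) ∧
    R.map (WD n).subtype = Subgroup.closure (Set.range fun i => refl (α i))

/-- A Coxeter element of `R`: the product, in some order, of the members of a Coxeter generating
set of `R`. -/
def IsCoxeterElement {n : ℕ} (R : Subgroup (WD n)) (c : WD n) : Prop :=
  ∃ (r : ℕ) (α : Fin r → E n), IsSimpleSystem R α ∧
    (c : E n ≃ₗᵢ[ℝ] E n) = (List.ofFn fun i => refl (α i)).prod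

/-- The cycles of a permutation as subsets of `Fin n`; a fixed point is a cycle of length one. -/
def cycles {n : ℕ} (σ : Equiv.Perm (Fin n)) : Finset (Finset (Fin n)) :=
  open Classical in
  Finset.univ.image fun i => Finset.univ.filter fun j => σ.SameCycle i j

/-- `w` is a signed permutation of `e_1, …, e_n` whose positive cycles have lengths `μ₁` and whose
negative cycles have lengths `μ₂`. Here `N` is the set of all `i` for which `e_i` is sent to the
negative of a basis vector, and a cycle is positive if it meets `N` in an even number of points. -/
def HasCycleType {n : ℕ} (w : E n ≃ₗᵢ[ℝ] E n) (μ₁ μ₂ : Multiset ℕ) : Prop :=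
  ∃ (σ : Equiv.Perm (Fin n)) (N : Finset (Fin n)),
    (∀ i, w (e i) = if i ∈ N then -e (σ i) else e (σ i)) ∧
    μ₁ = ((cycles σ).filter fun C => Even (C ∩ N).card).val.map Finset.card ∧
    μ₂ = ((cycles σ).filter fun C => ¬ Even (C ∩ N).card).val.map Finset.card

/-- `w` has cycle type `(μ, ε)`, for `μ` an even partition of `n`. The elements of cycle type
`(μ, ∅)` form one class of `W(B_n)`. The part labelled `+` consists of those that are conjugate
under `W(D_n)` to a permutation of the basis vectors, the part labelled `-` of those that are
conjugate to one under an element of `W(B_n)` outside `W(D_n)`. -/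
def HasSplitCycleType {n : ℕ} (w : E n ≃ₗᵢ[ℝ] E n) (μ : Multiset ℕ) (ε : ℤˣ) : Prop :=
  HasCycleType w μ 0 ∧
    ∃ g ∈ WB n, (g ∈ WD n ↔ ε = 1) ∧ ∀ i, ∃ j, (g⁻¹ * w * g) (e i) = e j

/-- A double partition of `n`. A partition is given by the multiset of its parts. -/
@[ext]
structure DoublePartition (n : ℕ) where
  fst : Multiset ℕ
  snd : Multiset ℕ
  fst_pos : ∀ k ∈ fst, 0 < k
  snd_pos : ∀ k ∈ snd, 0 < k
  sum_eq : fst.sum + snd.sum = n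

/-- The index of the block that contains the position `p`, when the positions `0, 1, 2, …` are
divided into consecutive blocks whose lengths are the entries of the list. -/
def blockIndex : List ℕ → ℕ → ℕ
  | [], _ => 0
  | a :: L, p => if p < a then 0 else blockIndex L (p - a) + 1

/-- The `k`-th block of coordinates for the given block lengths. -/
def block (n : ℕ) (L : List ℕ) (k : ℕ) : Set (Fin n) :=
  {i | blockIndex L i = k}

/-- The factor of type `A` on the coordinates in `I`, where `I = {i₁, …, i_k}` gives `A_{k-1}`:
it is generated by the reflections in `d i e_i - d j e_j`. For `d = 1` it is the symmetric group
on `I`. -/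
def factorA {n : ℕ} (d : Fin n → ℤˣ) (I : Set (Fin n)) : Subgroup (WD n) :=
  Subgroup.closure {t | ∃ i ∈ I, ∃ j ∈ I, i ≠ j ∧
    (t : E n ≃ₗᵢ[ℝ] E n) = refl (((d i : ℤ) : ℝ) • e i - ((d j : ℤ) : ℝ) • e j)}

/-- The factor of type `D` on the coordinates in `I`: it is generated by the reflections in
`e_i - e_j` and `e_i + e_j`. -/
def factorD {n : ℕ} (I : Set (Fin n)) : Subgroup (WD n) :=
  Subgroup.closure {t | ∃ i ∈ I, ∃ j ∈ I, i ≠ j ∧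
    ((t : E n ≃ₗᵢ[ℝ] E n) = refl (e i - e j) ∨ (t : E n ≃ₗᵢ[ℝ] E n) = refl (e i + e j))}

/-- The parts of a partition in non-increasing order. -/
def sortedParts (s : Multiset ℕ) : List ℕ := s.sort (· ≥ ·)

/-- The subgroup `W_λ = ∏ W(A_{λ¹_i - 1}) × ∏ W(D_{λ²_i})`, whose factors act on consecutive
blocks of coordinates. -/
def Wlam {n : ℕ} (l : DoublePartition n) : Subgroup (WD n) :=
  let L₁ := sortedParts l.fst
  let L₂ := sortedParts l.snd
  (⨆ k : Fin L₁.length, factorA 1 (block n (L₁ ++ L₂) k)) ⊔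
    ⨆ k : Fin L₂.length, factorD (block n (L₁ ++ L₂) (L₁.length + k))

/-- The subgroup `W_λ^ε = ∏ W(A_{λ_i - 1})`. For `ε = 1` the factors are the symmetric groups on
consecutive blocks of the coordinates with respect to `e_1, e_2, …, e_n`, for `ε = -1` with respect
to `-e_1, e_2, …, e_n`. -/
def WlamSplit {n : ℕ} (l : n.Partition) (ε : ℤˣ) : Subgroup (WD n) :=
  let L := sortedParts l.parts
  ⨆ k : Fin L.length, factorA (fun i => if (i : ℕ) = 0 then ε else 1) (block n L k)

/-- The double partition `(λ¹, (n - m))`, where `λ¹ ⊢ m`, with second component empty if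
`m = n`. It labels the parabolic subgroup `W(D_{n-m}) × ∏ W(A_{λ¹_i - 1})`. -/
def DoublePartition.merge {n : ℕ} (l : DoublePartition n) : DoublePartition n where
  fst := l.fst
  snd := if l.fst.sum = n then 0 else {n - l.fst.sum}
  fst_pos := l.fst_pos
  snd_pos := by
    have h := l.sum_eq
    intro k hk
    split_ifs at hk with h0
    · simp at hk
    · simp only [Multiset.mem_singleton] at hk
      omega
  sum_eq := by
    have h := l.sum_eq
    split_ifs with h0
    · simpa using h0
    · simp only [Multiset.sum_singleton]
      omega

/-- The double partitions `λ` of `n` with `λ² > 1`. -/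
abbrev Labels (n : ℕ) : Type :=
  {l : DoublePartition n // ∀ k ∈ l.snd, 1 < k}

/-- The double partitions `λ` of `n` with `λ² > 1`, and with `λ¹` not even in case `λ² = ∅`. -/
abbrev NonsplitLabels (n : ℕ) : Type :=
  {l : DoublePartition n // (∀ k ∈ l.snd, 1 < k) ∧ (l.snd = 0 → ¬ ∀ k ∈ l.fst, Even k)}

/-- The even partitions of `n`. -/
abbrev EvenPartitions (n : ℕ) : Type :=
  {l : n.Partition // ∀ k ∈ l.parts, Even k}

end TypeD

end

/-! The reflection in a root a e_i - b e_j exchanges the signed basis vectors a e_i and b e_j, so a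
reflection subgroup is governed by its orbits on the vectors ±e_i. Indices form a block if their
basis vectors are in one orbit up to sign. A block is unbalanced if e_i and -e_i share an orbit;
otherwise there are signs d_i such that the d_i e_i of the block form one orbit. The roots of the
subgroup are stable under its reflections, hence two vectors of one orbit on different axes are
joined by a root (`linked_of_mem`), and the subgroup is the group `GA q U d` of its block structure
(`exists_eq_GA`), with a factor of type A for every balanced and of type D for every unbalanced
block. Membership in `GA q U d` is a condition on coordinates (`sp_mem_GA_iff`). Conjugation adjusts
the signs d at will up to parity, and parity is harmless as soon as some block is unbalanced or of
odd size (`subgroupConj_of_sizes_eq`).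

A product c of reflections in independent vectors fixes only what each factor fixes
(`inner_eq_zero_of_prod_fixed`). On a balanced block a Coxeter element is a single positive cycle,
since otherwise the vector d cut down to one cycle would be fixed by c but not by the group. On an
unbalanced block of size k a count of entries produces two simple roots a e_i - b e_j and a e_i + b
e_j, as at the fork of a D_k diagram (`exists_digon`). After conjugation their reflections are
adjacent (`exists_conj`); together they change the signs at i and j, while the other factors fix e_j
and permute the rest of the block transitively up to sign. This leaves negative cycles of lengths 1
and k - 1.

Signed permutations with equal cycle types are conjugate under W(B_n), and under W(D_n) if some
cycle is odd. Thus all Coxeter elements of a standard subgroup are conjugate, and conversely the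
class of one of them determines the label (`label_eq_of_isConj`). This yields the map γ and its
injectivity, and also the uniqueness of the representatives. An element with two negative 2-cycles
but no negative 1-cycle is not a Coxeter element.

For parabolic closures, one fixed vector suffices: zero on the unbalanced blocks, with nonzero
entries of distinct absolute values on distinct balanced blocks. -/

noncomputable section

namespace TypeD

variable {n : ℕ}

/-! ### Signed basis vectors and signed permutations -/

/-- The signed basis vector `a e_i`. -/
def sv (a : ℤˣ) (i : Fin n) : E n := ((a : ℤ) : ℝ) • e i

theorem sv_apply (a : ℤˣ) (i k : Fin n) : sv a i k = if k = i then ((a : ℤ) : ℝ) else 0 := by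
  simp [sv, e]

@[simp] theorem sv_one (i : Fin n) : sv 1 i = e i := by simp [sv]

theorem sv_neg (a : ℤˣ) (i : Fin n) : sv (-a) i = -sv a i := by simp [sv]

theorem units_cast_ne_zero (a : ℤˣ) : ((a : ℤ) : ℝ) ≠ 0 := by
  rcases Int.units_eq_one_or a with rfl | rfl <;> simp

theorem units_cast_mul_self (a : ℤˣ) : ((a : ℤ) : ℝ) * ((a : ℤ) : ℝ) = 1 := by
  rcases Int.units_eq_one_or a with rfl | rfl <;> simp

theorem units_cast_injective {a b : ℤˣ} (h : ((a : ℤ) : ℝ) = ((b : ℤ) : ℝ)) : a = b := by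
  exact Units.ext (by exact_mod_cast h)

theorem units_eq_or_eq_neg (a b : ℤˣ) : a = b ∨ a = -b := by
  rcases Int.units_eq_one_or a with rfl | rfl <;>
    rcases Int.units_eq_one_or b with rfl | rfl <;> simp

theorem sv_inj {a b : ℤˣ} {i j : Fin n} : sv a i = sv b j ↔ a = b ∧ i = j := by
  constructor
  · intro h
    have h1 : (sv a i : E n) i = sv b j i := by rw [h]
    rw [sv_apply, sv_apply, if_pos rfl] at h1
    split_ifs at h1 with hij
    · exact ⟨units_cast_injective h1, hij⟩
    · exact absurd h1 (units_cast_ne_zero a)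
  · rintro ⟨rfl, rfl⟩; rfl

theorem inner_sv (a : ℤˣ) (i : Fin n) (v : E n) : inner ℝ (sv a i) v = ((a : ℤ) : ℝ) * v i := by
  rw [sv, e, real_inner_smul_left]
  simp [EuclideanSpace.inner_single_left]

theorem linearIsometryEquiv_ext_e {g h : E n ≃ₗᵢ[ℝ] E n} (H : ∀ i, g (e i) = h (e i)) : g = h := by
  apply LinearIsometryEquiv.toLinearEquiv_injective
  apply LinearEquiv.toLinearMap_injective
  refine (EuclideanSpace.basisFun (Fin n) ℝ).toBasis.ext fun i => ?_
  simpa [e] using H i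

theorem mul_apply (g h : E n ≃ₗᵢ[ℝ] E n) (x : E n) : (g * h) x = g (h x) := rfl

theorem apply_inv_apply (g : E n ≃ₗᵢ[ℝ] E n) (x : E n) : g (g⁻¹ x) = x := by
  rw [← mul_apply, mul_inv_cancel]; rfl

theorem inv_apply_apply (g : E n ≃ₗᵢ[ℝ] E n) (x : E n) : g⁻¹ (g x) = x := by
  rw [← mul_apply, inv_mul_cancel]; rfl

/-- The signed permutation `e_i ↦ s_i e_{σ i}`. -/
def sp (σ : Equiv.Perm (Fin n)) (s : Fin n → ℤˣ) : E n ≃ₗᵢ[ℝ] E n :=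
  (LinearIsometryEquiv.piLpCongrRight 2 (fun i =>
    if s i = 1 then LinearIsometryEquiv.refl ℝ ℝ else LinearIsometryEquiv.neg ℝ)).trans
    (LinearIsometryEquiv.piLpCongrLeft 2 ℝ ℝ σ)

theorem sp_coord (σ : Equiv.Perm (Fin n)) (s : Fin n → ℤˣ) (v : E n) (k : Fin n) :
    sp σ s v (σ k) = ((s k : ℤ) : ℝ) * v k := by
  have : sp σ s v (σ k) =
      (if s k = 1 then LinearIsometryEquiv.refl ℝ ℝ else LinearIsometryEquiv.neg ℝ) (v k) := by
    simp [sp, LinearIsometryEquiv.piLpCongrLeft_apply, Equiv.piCongrLeft']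
  rw [this]
  rcases Int.units_eq_one_or (s k) with h | h
  · simp [h]
  · have : (-1 : ℤˣ) ≠ 1 := by decide
    simp [h, this]

theorem sp_sv (σ : Equiv.Perm (Fin n)) (s : Fin n → ℤˣ) (a : ℤˣ) (i : Fin n) :
    sp σ s (sv a i) = sv (a * s i) (σ i) := by
  ext k
  obtain ⟨k, rfl⟩ := σ.surjective k
  rw [sp_coord, sv_apply, sv_apply]
  simp only [EmbeddingLike.apply_eq_iff_eq]
  split_ifs with h
  · subst h; push_cast; ring
  · simp

theorem sp_e (σ : Equiv.Perm (Fin n)) (s : Fin n → ℤˣ) (i : Fin n) :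
    sp σ s (e i) = sv (s i) (σ i) := by
  rw [← sv_one, sp_sv, one_mul]

theorem eq_sp_iff {g : E n ≃ₗᵢ[ℝ] E n} {σ : Equiv.Perm (Fin n)} {s : Fin n → ℤˣ} :
    g = sp σ s ↔ ∀ i, g (e i) = sv (s i) (σ i) := by
  constructor
  · rintro rfl i; exact sp_e σ s i
  · intro h; exact linearIsometryEquiv_ext_e fun i => by rw [h, sp_e]

theorem sp_mul (σ τ : Equiv.Perm (Fin n)) (s t : Fin n → ℤˣ) :
    sp σ s * sp τ t = sp (σ * τ) (fun i => t i * s (τ i)) := by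
  rw [eq_sp_iff]
  intro i
  rw [mul_apply, sp_e, sp_sv]; rfl

theorem sp_one : sp (1 : Equiv.Perm (Fin n)) (fun _ => 1) = 1 := by
  symm; rw [eq_sp_iff]; intro i; simp

theorem sp_inj {σ τ : Equiv.Perm (Fin n)} {s t : Fin n → ℤˣ} (h : sp σ s = sp τ t) :
    σ = τ ∧ s = t := by
  have h1 : ∀ i, s i = t i ∧ σ i = τ i := fun i => by
    have := sp_e σ s i
    rw [h, sp_e] at this
    have := sv_inj.1 this
    exact ⟨this.1.symm, this.2.symm⟩
  exact ⟨Equiv.ext fun i => (h1 i).2, funext fun i => (h1 i).1⟩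

theorem units_int_inv (a : ℤˣ) : a⁻¹ = a := Int.units_inv_eq_self a

theorem sp_inv (σ : Equiv.Perm (Fin n)) (s : Fin n → ℤˣ) :
    (sp σ s)⁻¹ = sp σ⁻¹ (fun i => s (σ⁻¹ i)) := by
  rw [inv_eq_iff_mul_eq_one, sp_mul, ← sp_one]
  congr 1
  · simp
  · funext i
    simp [Int.units_mul_self]

theorem refl_apply (v x : E n) :
    refl v x = x - (2 * (inner ℝ v x / ‖v‖ ^ 2)) • v := by
  rw [refl, Submodule.reflection_orthogonal_apply, Submodule.reflection_singleton_apply]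
  simp only [RCLike.ofReal_real_eq_id, id, neg_sub, mul_smul, two_smul]

theorem refl_smul {c : ℝ} (hc : c ≠ 0) (v : E n) : refl (c • v) = refl v := by
  have : Submodule.span ℝ {c • v} = Submodule.span ℝ {v} :=
    Submodule.span_singleton_smul_eq (IsUnit.mk0 c hc) v
  simp only [refl, this]

theorem refl_neg (v : E n) : refl (-v) = refl v := by
  have := refl_smul (n := n) (c := -1) (by norm_num) v
  simpa using this

theorem refl_mul_self (v : E n) : refl v * refl v = 1 :=
  Submodule.reflection_mul_reflection _

theorem refl_inv (v : E n) : (refl v)⁻¹ = refl v :=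
  inv_eq_of_mul_eq_one_left (refl_mul_self v)

theorem refl_map (g : E n ≃ₗᵢ[ℝ] E n) (v : E n) : refl (g v) = g * refl v * g⁻¹ := by
  ext1 x
  simp only [mul_apply, refl_apply, map_sub, map_smul,
    LinearIsometryEquiv.norm_map]
  have h1 := apply_inv_apply g x
  have h2 : inner ℝ v (g⁻¹ x) = inner ℝ (g v) x := by
    rw [← g.inner_map_map v, h1]
  rw [h1, h2]

theorem refl_apply_eq_self_iff {v : E n} (hv : v ≠ 0) (x : E n) :
    refl v x = x ↔ inner ℝ v x = 0 := by
  have : ‖v‖ ≠ 0 := norm_ne_zero_iff.2 hv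
  rw [refl_apply, sub_eq_self, smul_eq_zero]
  simp [hv, this]

theorem root_ne_zero {a b : ℤˣ} {i j : Fin n} (h : i ≠ j) : sv a i - sv b j ≠ 0 := by
  intro h0
  exact h (sv_inj.1 (sub_eq_zero.1 h0)).2

theorem inner_root (a b : ℤˣ) (i j : Fin n) (x : E n) :
    inner ℝ (sv a i - sv b j) x = ((a : ℤ) : ℝ) * x i - ((b : ℤ) : ℝ) * x j := by
  rw [inner_sub_left, inner_sv, inner_sv]

theorem norm_sq_root {a b : ℤˣ} {i j : Fin n} (h : i ≠ j) : ‖sv a i - sv b j‖ ^ 2 = 2 := by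
  rw [← real_inner_self_eq_norm_sq, inner_root]
  simp only [PiLp.sub_apply, sv_apply, if_true, if_neg h, if_neg h.symm]
  have := units_cast_mul_self a
  have := units_cast_mul_self b
  linarith

theorem refl_root_apply {a b : ℤˣ} {i j : Fin n} (h : i ≠ j) (x : E n) :
    refl (sv a i - sv b j) x =
      x - (((a : ℤ) : ℝ) * x i - ((b : ℤ) : ℝ) * x j) • (sv a i - sv b j) := by
  rw [refl_apply, norm_sq_root h, inner_root]
  congr 2; ring

/-- The signs of the reflection in the root `a e_i - b e_j`. -/
def rootSign (a : ℤˣ) (i : Fin n) (b : ℤˣ) (j : Fin n) (k : Fin n) : ℤˣ :=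
  if k = i ∨ k = j then a * b else 1

theorem sub_units_smul_sv (a c : ℤˣ) (i : Fin n) : ((c : ℤ) : ℝ) • sv a i = sv (c * a) i := by
  simp [sv, smul_smul]

theorem refl_root {a b : ℤˣ} {i j : Fin n} (h : i ≠ j) :
    refl (sv a i - sv b j) = sp (Equiv.swap i j) (rootSign a i b j) := by
  rw [eq_sp_iff]
  intro k
  rw [refl_root_apply h, rootSign, ← sv_one]
  simp only [sv_apply]
  by_cases hi : k = i
  · subst hi
    rw [if_pos rfl, if_neg h.symm, if_pos (Or.inl rfl), Equiv.swap_apply_left]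
    simp only [Units.val_one, Int.cast_one, mul_one, mul_zero, sub_zero]
    rw [smul_sub, sub_units_smul_sv, sub_units_smul_sv, Int.units_mul_self]
    abel
  · by_cases hj : k = j
    · subst hj
      rw [if_pos rfl, if_neg h, if_pos (Or.inr rfl), Equiv.swap_apply_right]
      simp only [Units.val_one, Int.cast_one, mul_one, mul_zero, zero_sub]
      rw [smul_sub, neg_smul, neg_smul, sub_units_smul_sv, sub_units_smul_sv, Int.units_mul_self,
        mul_comm a b]
      abel
    · rw [if_neg (Ne.symm hi), if_neg (Ne.symm hj), if_neg (by tauto),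
        Equiv.swap_apply_of_ne_of_ne hi hj]
      simp

theorem refl_root_left {a b : ℤˣ} {i j : Fin n} (h : i ≠ j) :
    refl (sv a i - sv b j) (sv a i) = sv b j := by
  rw [refl_root h, sp_sv, rootSign, if_pos (Or.inl rfl), Equiv.swap_apply_left, ← mul_assoc,
    Int.units_mul_self, one_mul]

theorem refl_root_right {a b : ℤˣ} {i j : Fin n} (h : i ≠ j) :
    refl (sv a i - sv b j) (sv b j) = sv a i := by
  rw [refl_root h, sp_sv, rootSign, if_pos (Or.inr rfl), Equiv.swap_apply_right, mul_comm a,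
    ← mul_assoc, Int.units_mul_self, one_mul]

theorem refl_root_of_ne {a b : ℤˣ} {i j k : Fin n} (h : i ≠ j) (c : ℤˣ) (hi : k ≠ i) (hj : k ≠ j) :
    refl (sv a i - sv b j) (sv c k) = sv c k := by
  rw [refl_root h, sp_sv, rootSign, if_neg (by tauto), Equiv.swap_apply_of_ne_of_ne hi hj, mul_one]

/-- The difference form is preferred because the reflection in a e_i - b e_j exchanges a e_i and b
e_j; sums are absorbed into the sign of b. -/
theorem mem_roots_iff {v : E n} :
    v ∈ roots n ↔ ∃ i j : Fin n, i ≠ j ∧ ∃ a b : ℤˣ, v = sv a i - sv b j := by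
  constructor
  · rintro ⟨i, j, h, a, b, rfl⟩
    exact ⟨i, j, h, a, -b, by rw [sv_neg, sub_neg_eq_add]; rfl⟩
  · rintro ⟨i, j, h, a, b, rfl⟩
    refine ⟨i, j, h, a, -b, ?_⟩
    change _ = sv a i + sv (-b) j
    rw [sv_neg, sub_eq_add_neg]

theorem root_mem_roots {a b : ℤˣ} {i j : Fin n} (h : i ≠ j) : sv a i - sv b j ∈ roots n :=
  mem_roots_iff.2 ⟨i, j, h, a, b, rfl⟩

/-! ### Signed block structures -/

/-- Two signed basis vectors are admissible if they lie in the same block, and have the same sign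
relative to `d` if that block is balanced, i.e. has its label outside `U`. -/
def Adm (q : Fin n → ℕ) (U : Set ℕ) (d : Fin n → ℤˣ) (a : ℤˣ) (i : Fin n) (b : ℤˣ) (j : Fin n) :
    Prop :=
  q i = q j ∧ (q i ∈ U ∨ a * d i = b * d j)

section Adm

variable {q : Fin n → ℕ} {U : Set ℕ} {d : Fin n → ℤˣ} {a b c : ℤˣ} {i j k : Fin n}

theorem Adm.refl (a : ℤˣ) (i : Fin n) : Adm q U d a i a i := ⟨rfl, Or.inr rfl⟩

theorem Adm.symm (h : Adm q U d a i b j) : Adm q U d b j a i :=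
  ⟨h.1.symm, h.2.imp (fun h' => h.1 ▸ h') Eq.symm⟩

theorem Adm.trans (h : Adm q U d a i b j) (h' : Adm q U d b j c k) : Adm q U d a i c k :=
  ⟨h.1.trans h'.1, by
    rcases h.2 with h2 | h2
    · exact Or.inl h2
    · rcases h'.2 with h3 | h3
      · exact Or.inl (h.1 ▸ h3)
      · exact Or.inr (h2.trans h3)⟩

theorem Adm.mul (h : Adm q U d a i b j) (c : ℤˣ) : Adm q U d (c * a) i (c * b) j :=
  ⟨h.1, h.2.imp id fun h' => by rw [mul_assoc, h', mul_assoc]⟩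

end Adm

/-- The reflection group with the given signed block structure. -/
def GA (q : Fin n → ℕ) (U : Set ℕ) (d : Fin n → ℤˣ) : Subgroup (E n ≃ₗᵢ[ℝ] E n) :=
  Subgroup.closure {t | ∃ a i b j, i ≠ j ∧ Adm q U d a i b j ∧ t = TypeD.refl (sv a i - sv b j)}

/-- The signed permutation with data `σ`, `s` preserves the signed block structure and has an even
number of sign changes on every block. -/
def Good (q : Fin n → ℕ) (U : Set ℕ) (d : Fin n → ℤˣ) (σ : Equiv.Perm (Fin n)) (s : Fin n → ℤˣ) :
    Prop :=
  (∀ i, Adm q U d 1 i (s i) (σ i)) ∧ ∀ k, ∏ i with q i = k, s i = 1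

section Good

variable {q : Fin n → ℕ} {U : Set ℕ} {d : Fin n → ℤˣ} {σ τ : Equiv.Perm (Fin n)}
  {s t : Fin n → ℤˣ}

theorem Good.mul (h : Good q U d σ s) (h' : Good q U d τ t) :
    Good q U d (σ * τ) (fun i => t i * s (τ i)) := by
  refine ⟨fun i => ?_, fun k => ?_⟩
  · have := (h.1 (τ i)).mul (t i)
    rw [mul_one] at this
    exact (h'.1 i).trans this
  · rw [Finset.prod_mul_distrib, h'.2, one_mul, ← h.2 k]
    refine Finset.prod_equiv τ (fun i => ?_) (fun i _ => rfl)
    simp [(h'.1 i).1]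

theorem good_one : Good q U d 1 (fun _ => 1) :=
  ⟨fun i => Adm.refl 1 i, fun k => by simp⟩

theorem Good.inv (h : Good q U d σ s) : Good q U d σ⁻¹ (fun i => s (σ⁻¹ i)) := by
  refine ⟨fun i => ?_, fun k => ?_⟩
  · have := (h.1 (σ⁻¹ i)).symm.mul (s (σ⁻¹ i))
    simpa [Int.units_mul_self] using this
  · rw [← h.2 k]
    refine Finset.prod_equiv σ⁻¹ (fun i => ?_) (fun i _ => rfl)
    have := (h.1 (σ⁻¹ i)).1
    rw [show σ (σ⁻¹ i) = i from σ.apply_symm_apply i] at this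
    simp only [Finset.mem_filter, Finset.mem_univ, true_and, this]

/-- The sign a b occurs at both `i` and `j`, which lie in one block, so it cancels in the product
over that block. -/
theorem good_root {a b : ℤˣ} {i j : Fin n} (hij : i ≠ j) (h : Adm q U d a i b j) :
    Good q U d (Equiv.swap i j) (rootSign a i b j) := by
  refine ⟨fun k => ?_, fun k => ?_⟩
  · have h' : Adm q U d 1 i (a * b) j := by
      have := h.mul a
      rwa [Int.units_mul_self] at this
    rw [rootSign]
    by_cases hi : k = i
    · subst hi
      rwa [if_pos (Or.inl rfl), Equiv.swap_apply_left]
    · by_cases hj : k = j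
      · subst hj
        rw [if_pos (Or.inr rfl), Equiv.swap_apply_right]
        have := h.symm.mul b
        rwa [Int.units_mul_self, mul_comm b a] at this
      · rw [if_neg (by tauto), Equiv.swap_apply_of_ne_of_ne hi hj]
        exact Adm.refl 1 k
  · by_cases hk : q i = k
    · rw [Finset.prod_eq_mul (a := i) (b := j) hij]
      · simp [rootSign, Int.units_mul_self]
      · intro l _ hl
        simp [rootSign, hl.1, hl.2]
      · intro hl; simp [hk] at hl
      · intro hl; simp [← h.1, hk] at hl
    · apply Finset.prod_eq_one
      intro l hl
      have hl' : q l = k := by simpa using hl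
      rw [rootSign, if_neg]
      rintro (rfl | rfl)
      · exact hk hl'
      · exact hk (h.1.trans hl')

theorem exists_good_of_mem {g : E n ≃ₗᵢ[ℝ] E n} (hg : g ∈ GA q U d) :
    ∃ σ s, g = sp σ s ∧ Good q U d σ s := by
  induction hg using Subgroup.closure_induction with
  | mem t ht =>
    obtain ⟨a, i, b, j, hij, h, rfl⟩ := ht
    exact ⟨_, _, refl_root hij, good_root hij h⟩
  | one => exact ⟨1, fun _ => 1, sp_one.symm, good_one⟩
  | mul g h _ _ hg hh =>
    obtain ⟨σ, s, rfl, hs⟩ := hg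
    obtain ⟨τ, t, rfl, ht⟩ := hh
    exact ⟨_, _, sp_mul _ _ _ _, hs.mul ht⟩
  | inv g _ hg =>
    obtain ⟨σ, s, rfl, hs⟩ := hg
    exact ⟨_, _, sp_inv _ _, hs.inv⟩

theorem root_mem_GA {a b : ℤˣ} {i j : Fin n} (hij : i ≠ j) (h : Adm q U d a i b j) :
    TypeD.refl (sv a i - sv b j) ∈ GA q U d :=
  Subgroup.subset_closure ⟨a, i, b, j, hij, h, rfl⟩

/-- The number of basis vectors moved by a signed permutation. -/
def moved (σ : Equiv.Perm (Fin n)) (s : Fin n → ℤˣ) : Finset (Fin n) :=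
  {i | ¬(σ i = i ∧ s i = 1)}

/-- Induction on the number of basis vectors not fixed. If σ moves i, the reflection exchanging e_i
and its image s_i e_{σ i} is multiplied on the left; this makes e_i fixed and spoils no fixed
vector. If σ is trivial, the sign changes in a block come in pairs, and the product of the
reflections in e_i - e_j and e_i + e_j removes a pair. -/
theorem mem_GA_of_good : ∀ (m : ℕ) {σ : Equiv.Perm (Fin n)} {s : Fin n → ℤˣ},
    (moved σ s).card = m → Good q U d σ s → sp σ s ∈ GA q U d := by
  intro m
  induction m using Nat.strong_induction_on with
  | _ m ih =>
  intro σ s hm h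
  by_cases hσ : ∃ i, σ i ≠ i
  · obtain ⟨i, hi⟩ := hσ
    have hr : TypeD.refl (sv 1 i - sv (s i) (σ i)) ∈ GA q U d :=
      root_mem_GA hi.symm (h.1 i)
    rw [← Subgroup.mul_mem_cancel_left _ hr, refl_root hi.symm, sp_mul]
    refine ih _ ?_ rfl ((good_root hi.symm (h.1 i)).mul h)
    rw [← hm]
    apply Finset.card_lt_card
    rw [Finset.ssubset_iff_of_subset]
    · refine ⟨i, by simp [moved, hi], ?_⟩
      simp [moved, rootSign, Int.units_mul_self]
    · intro k hk
      by_contra hk'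
      simp only [moved, Finset.mem_filter, Finset.mem_univ, true_and, not_not] at hk hk'
      have h1 : k ≠ i := by rintro rfl; exact hi hk'.1
      have h2 : k ≠ σ i := by
        rintro rfl
        exact hi (σ.injective hk'.1)
      apply hk
      simp [rootSign, hk'.1, hk'.2, h1, h2, Equiv.swap_apply_of_ne_of_ne]
  · push Not at hσ
    have hσ1 : σ = 1 := Equiv.ext hσ
    subst hσ1
    by_cases hs : ∃ i, s i ≠ 1
    · obtain ⟨i, hi⟩ := hs
      have hi' : s i = -1 := (Int.units_eq_one_or _).resolve_left hi
      -- In a balanced block a signed permutation with trivial σ has no sign change.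
      have hU : q i ∈ U := by
        rcases (h.1 i).2 with h1 | h1
        · exact h1
        · exact absurd (mul_right_cancel h1).symm hi
      obtain ⟨j, hji, hqj, hj⟩ : ∃ j, j ≠ i ∧ q j = q i ∧ s j = -1 := by
        by_contra hcon
        push Not at hcon
        have := h.2 (q i)
        rw [Finset.prod_eq_single i, hi'] at this
        · exact absurd this (by decide)
        · intro j hj hji
          exact (Int.units_eq_one_or _).resolve_right (hcon j hji (by simpa using hj))
        · intro h; simp at h
      have ha : ∀ b, Adm q U d 1 i b j := fun b => ⟨hqj.symm, Or.inl hU⟩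
      have g1 := good_root hji.symm (ha 1)
      have g2 := good_root hji.symm (ha (-1))
      have m1 := root_mem_GA hji.symm (ha 1)
      have m2 := root_mem_GA hji.symm (ha (-1))
      rw [← Subgroup.mul_mem_cancel_left _ (mul_mem m1 m2), refl_root hji.symm,
        refl_root hji.symm, sp_mul, sp_mul]
      refine ih _ ?_ rfl ((g1.mul g2).mul h)
      rw [← hm]
      apply Finset.card_lt_card
      rw [Finset.ssubset_iff_of_subset]
      · refine ⟨i, by simp [moved, hi], ?_⟩
        simp [moved, rootSign, hi']
      · intro k hk
        by_contra hk'
        simp only [moved, Finset.mem_filter, Finset.mem_univ, true_and, not_not] at hk hk'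
        have h1 : k ≠ i := by rintro rfl; exact hi hk'.2
        have h2 : k ≠ j := by
          rintro rfl
          rw [hj] at hk'
          exact absurd hk'.2 (by decide)
        apply hk
        simp [rootSign, hk'.2, h1, h2, Equiv.swap_apply_of_ne_of_ne]
    · push Not at hs
      have : s = fun _ => 1 := funext hs
      rw [this, sp_one]
      exact one_mem _

theorem sp_mem_GA_iff : sp σ s ∈ GA q U d ↔ Good q U d σ s := by
  constructor
  · intro h
    obtain ⟨σ', s', h1, h2⟩ := exists_good_of_mem h
    obtain ⟨rfl, rfl⟩ := sp_inj h1
    exact h2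
  · exact mem_GA_of_good _ rfl

end Good

/-! ### The groups W(D_n) and W(B_n) in terms of signed permutations -/

theorem WD_eq_GA : WD n = GA (fun _ => 0) Set.univ 1 := by
  rw [WD, GA]
  congr 1
  ext t
  constructor
  · rintro ⟨v, hv, rfl⟩
    obtain ⟨i, j, hij, a, b, rfl⟩ := mem_roots_iff.1 hv
    exact ⟨a, i, b, j, hij, ⟨rfl, Or.inl trivial⟩, rfl⟩
  · rintro ⟨a, i, b, j, hij, _, rfl⟩
    exact ⟨_, root_mem_roots hij, rfl⟩

theorem sp_mem_WD_iff {σ : Equiv.Perm (Fin n)} {s : Fin n → ℤˣ} :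
    sp σ s ∈ WD n ↔ ∏ i, s i = 1 := by
  rw [WD_eq_GA, sp_mem_GA_iff, Good]
  constructor
  · rintro ⟨_, h⟩
    simpa using h 0
  · intro h
    refine ⟨fun i => ⟨rfl, Or.inl trivial⟩, fun k => ?_⟩
    by_cases hk : 0 = k
    · simpa [hk] using h
    · simp [hk]

theorem exists_sp_of_mem_WD {w : E n ≃ₗᵢ[ℝ] E n} (h : w ∈ WD n) :
    ∃ σ s, w = sp σ s ∧ ∏ i, s i = 1 := by
  rw [WD_eq_GA] at h
  obtain ⟨σ, s, rfl, hs⟩ := exists_good_of_mem h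
  refine ⟨σ, s, rfl, ?_⟩
  rwa [← sp_mem_GA_iff, ← WD_eq_GA, sp_mem_WD_iff] at hs

theorem GA_le_WD (q : Fin n → ℕ) (U : Set ℕ) (d : Fin n → ℤˣ) : GA q U d ≤ WD n := by
  rw [GA, Subgroup.closure_le]
  rintro t ⟨a, i, b, j, hij, _, rfl⟩
  exact Subgroup.subset_closure ⟨_, root_mem_roots hij, rfl⟩

theorem refl_e (i : Fin n) : refl (e i) = sp 1 (fun k => if k = i then -1 else 1) := by
  rw [eq_sp_iff]
  intro k
  rw [refl_apply]
  have h1 : ‖(e i : E n)‖ = 1 := by simp [e]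
  have h2 : inner ℝ (e i) (e k) = if k = i then (1 : ℝ) else 0 := by
    rw [← sv_one i, inner_sv, ← sv_one k, sv_apply]
    simp [eq_comm]
  rw [h1, h2]
  split_ifs with h
  · subst h
    rw [sv_neg, sv_one]
    simp [two_smul]
  · simp

theorem sp_mem_WB (σ : Equiv.Perm (Fin n)) (s : Fin n → ℤˣ) : sp σ s ∈ WB n := by
  have hle : WD n ≤ WB n := Subgroup.closure_mono (Set.image_mono Set.subset_union_left)
  rcases Int.units_eq_one_or (∏ i, s i) with h | h
  · exact hle (sp_mem_WD_iff.2 h)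
  -- Any index serves: the reflection in e_i corrects the parity of the number of sign changes.
  · obtain ⟨i, -, -⟩ : ∃ i ∈ Finset.univ, s i ≠ 1 := by
      by_contra hcon
      push Not at hcon
      rw [Finset.prod_eq_one hcon] at h
      exact absurd h (by decide)
    have h1 : refl (e i) ∈ WB n :=
      Subgroup.subset_closure ⟨_, Or.inr ⟨i, rfl⟩, rfl⟩
    rw [← Subgroup.mul_mem_cancel_right _ h1, refl_e, sp_mul]
    apply hle
    rw [sp_mem_WD_iff, Finset.prod_mul_distrib]
    simp [h]

theorem exists_sp_of_mem_WB {w : E n ≃ₗᵢ[ℝ] E n} (h : w ∈ WB n) : ∃ σ s, w = sp σ s := by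
  induction h using Subgroup.closure_induction with
  | mem t ht =>
    obtain ⟨v, hv | ⟨i, rfl⟩, rfl⟩ := ht
    · obtain ⟨i, j, hij, a, b, rfl⟩ := mem_roots_iff.1 hv
      exact ⟨_, _, refl_root hij⟩
    · exact ⟨_, _, refl_e i⟩
  | one => exact ⟨1, fun _ => 1, sp_one.symm⟩
  | mul g h _ _ hg hh =>
    obtain ⟨σ, s, rfl⟩ := hg
    obtain ⟨τ, t, rfl⟩ := hh
    exact ⟨_, _, sp_mul _ _ _ _⟩
  | inv g _ hg =>
    obtain ⟨σ, s, rfl⟩ := hg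
    exact ⟨_, _, sp_inv _ _⟩

theorem refl_root_mul (c a b : ℤˣ) (i j : Fin n) :
    refl (sv (c * a) i - sv (c * b) j) = refl (sv a i - sv b j) := by
  rw [← sub_units_smul_sv, ← sub_units_smul_sv, ← smul_sub, refl_smul (units_cast_ne_zero c)]

theorem refl_mem_map_iff {R : Subgroup (WD n)} {v : E n} :
    refl v ∈ R.map (WD n).subtype ↔ ∃ t ∈ R, (t : E n ≃ₗᵢ[ℝ] E n) = refl v := by
  simp [Subgroup.mem_map]

theorem mem_rootsOf_iff {R : Subgroup (WD n)} {v : E n} :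
    v ∈ rootsOf R ↔ v ∈ roots n ∧ refl v ∈ R.map (WD n).subtype := by
  rw [refl_mem_map_iff]; rfl

theorem refl_mem_WD {v : E n} (hv : v ∈ roots n) : refl v ∈ WD n :=
  Subgroup.subset_closure ⟨v, hv, rfl⟩

/-- If v_i ≠ 0, then e_i - t e_i is a nonzero multiple of v, and t e_i is a signed basis vector. So
v is proportional to a root, unless t e_i = -e_i; in that case t would be the reflection in e_i,
which has a single sign change and lies outside W(D_n). -/
theorem IsReflection.exists_root {t : WD n} (h : IsReflection t) :
    ∃ v ∈ roots n, (t : E n ≃ₗᵢ[ℝ] E n) = refl v := by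
  obtain ⟨v, hv, ht⟩ := h
  obtain ⟨σ, s, hs, hprod⟩ := exists_sp_of_mem_WD t.2
  have hnorm : ‖v‖ ^ 2 ≠ 0 := pow_ne_zero 2 (norm_ne_zero_iff.2 hv)
  obtain ⟨i, hi⟩ : ∃ i, v i ≠ 0 := by
    by_contra hcon
    push Not at hcon
    exact hv (by ext i; simp [hcon i])
  have key : ∃ c : ℝ, c ≠ 0 ∧ e i - sv (s i) (σ i) = c • v := by
    refine ⟨2 * (v i / ‖v‖ ^ 2), by positivity, ?_⟩
    have h1 : refl v (e i) = sv (s i) (σ i) := by rw [← ht, hs, sp_e]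
    have h2 : inner ℝ v (e i) = v i := by
      rw [real_inner_comm, ← sv_one, inner_sv]; simp
    rw [← h1, refl_apply, h2]
    abel
  obtain ⟨c, hc, hcv⟩ := key
  have hr : refl v = refl (e i - sv (s i) (σ i)) := by rw [hcv, refl_smul hc]
  by_cases hσ : σ i = i
  · exfalso
    have hsi : s i = -1 := by
      refine (Int.units_eq_one_or _).resolve_left fun h1 => ?_
      rw [hσ, h1, sv_one, sub_self] at hcv
      exact (smul_ne_zero hc hv) hcv.symm
    rw [hσ, hsi, sv_neg, sv_one, sub_neg_eq_add, ← two_smul ℝ, refl_smul two_ne_zero, refl_e] at hr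
    have := t.2
    rw [ht, hr, sp_mem_WD_iff] at this
    simp at this
  · refine ⟨_, ?_, ht.trans hr⟩
    rw [← sv_one]
    exact root_mem_roots (Ne.symm hσ)

theorem IsReflectionSubgroup.map_eq {R : Subgroup (WD n)} (h : IsReflectionSubgroup R) :
    R.map (WD n).subtype = Subgroup.closure (refl '' rootsOf R) := by
  obtain ⟨Y, hY, rfl⟩ := h
  apply le_antisymm
  · rw [MonoidHom.map_closure, Subgroup.closure_le]
    rintro _ ⟨t, ht, rfl⟩
    obtain ⟨v, hv, hv'⟩ := (hY t ht).exists_root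
    exact Subgroup.subset_closure ⟨v, ⟨hv, t, Subgroup.subset_closure ht, hv'⟩, hv'.symm⟩
  · rw [Subgroup.closure_le]
    rintro _ ⟨v, hv, rfl⟩
    exact (mem_rootsOf_iff.1 hv).2

/-! ### Orbits of signed basis vectors -/

section Orbit

variable {H : Subgroup (E n ≃ₗᵢ[ℝ] E n)} {a b c : ℤˣ} {i j k : Fin n}

/-- Two signed basis vectors are equal, or connected by a root of `H`, or opposite and both
connected to a third one. -/
def Linked (H : Subgroup (E n ≃ₗᵢ[ℝ] E n)) (a : ℤˣ) (i : Fin n) (b : ℤˣ) (j : Fin n) : Prop :=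
  (a = b ∧ i = j) ∨ (i ≠ j ∧ refl (sv a i - sv b j) ∈ H) ∨
    (i = j ∧ b = -a ∧ ∃ c k, i ≠ k ∧ refl (sv a i - sv c k) ∈ H ∧ refl (sv a i - sv (-c) k) ∈ H)

theorem refl_sub_comm (x y : E n) : refl (x - y) = refl (y - x) := by
  rw [← refl_neg, neg_sub]

/-- The first reflection carries the second root to a e_i - c e_k. -/
theorem refl_mem_trans (hij : i ≠ j) (hjk : j ≠ k) (hik : i ≠ k)
    (h1 : refl (sv a i - sv b j) ∈ H) (h2 : refl (sv b j - sv c k) ∈ H) :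
    refl (sv a i - sv c k) ∈ H := by
  have := refl_map (refl (sv a i - sv b j)) (sv b j - sv c k)
  rw [map_sub, refl_root_right hij, refl_root_of_ne hij c hik.symm hjk.symm] at this
  rw [this]
  exact mul_mem (mul_mem h1 h2) (inv_mem h1)

theorem Linked.step (h : Linked H a i b j) (hjk : j ≠ k) (hr : refl (sv b j - sv c k) ∈ H) :
    Linked H a i c k := by
  rcases h with ⟨rfl, rfl⟩ | ⟨hij, h⟩ | ⟨rfl, rfl, c', l, hil, h1, h2⟩
  · exact Or.inr (Or.inl ⟨hjk, hr⟩)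
  · by_cases hik : i = k
    · subst hik
      -- A path that returns to the axis of e_i ends at a e_i itself or at its negative; in the
      -- second case both roots joining a e_i to ±b e_j are in `H`.
      rcases units_eq_or_eq_neg c a with rfl | rfl
      · exact Or.inl ⟨rfl, rfl⟩
      · refine Or.inr (Or.inr ⟨rfl, rfl, b, j, hij, h, ?_⟩)
        rw [← refl_root_mul (-1), refl_sub_comm] at hr
        simpa using hr
    · exact Or.inr (Or.inl ⟨hik, refl_mem_trans hij hjk hik h hr⟩)
  · refine Or.inr (Or.inl ⟨hjk, ?_⟩)
    by_cases hlk : l = k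
    · subst hlk
      rcases units_eq_or_eq_neg c c' with rfl | rfl
      · exact h1
      · exact h2
    -- The product of the reflections in a e_i - c' e_l and a e_i + c' e_l changes the signs at i
    -- and l only. Conjugation by it turns the root that leaves -a e_i into one that leaves a e_i.
    · have e1 : sv (-a) i - sv c k =
          (refl (sv a i - sv c' l) * refl (sv a i - sv (-c') l)) (sv a i - sv c k) := by
        rw [mul_apply, map_sub, refl_root_left hil, refl_root_of_ne hil c hjk.symm (Ne.symm hlk),
          map_sub, refl_root_of_ne hil c hjk.symm (Ne.symm hlk), sv_neg c', map_neg,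
          refl_root_right hil, sv_neg]
      rw [e1, refl_map] at hr
      have hm := mul_mem h1 h2
      have := mul_mem (mul_mem (inv_mem hm) hr) hm
      simpa [mul_assoc] using this

theorem refl_root_sv_cases {p p' : ℤˣ} {k l : Fin n} (hkl : k ≠ l)
    (h : refl (sv p k - sv p' l) ∈ H) (b : ℤˣ) (j : Fin n) :
    (∃ c m, refl (sv p k - sv p' l) (sv b j) = sv c m ∧
      ((c = b ∧ m = j) ∨ (j ≠ m ∧ refl (sv b j - sv c m) ∈ H))) := by
  by_cases hk : j = k
  · subst hk
    refine ⟨b * (p * p'), l, ?_, Or.inr ⟨hkl, ?_⟩⟩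
    · rw [refl_root hkl, sp_sv, rootSign, if_pos (Or.inl rfl), Equiv.swap_apply_left]
    · rw [← refl_root_mul (b * p)] at h
      simpa [mul_assoc, Int.units_mul_self] using h
  · by_cases hl : j = l
    · subst hl
      refine ⟨b * (p * p'), k, ?_, Or.inr ⟨hk, ?_⟩⟩
      · rw [refl_root hkl, sp_sv, rootSign, if_pos (Or.inr rfl), Equiv.swap_apply_right]
      · rw [← refl_root_mul (b * p'), refl_sub_comm] at h
        simpa [mul_assoc, Int.units_mul_self, mul_comm p'] using h
    · exact ⟨b, j, refl_root_of_ne hkl b hk hl, Or.inl ⟨rfl, rfl⟩⟩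

/-- An element of `H` is a word in reflections of `H`. Each further letter on the left either fixes
the current image of a e_i or moves it along a root of `H`, and `Linked` survives such a step. -/
theorem linked_of_mem (hH : H = Subgroup.closure {t | t ∈ H ∧ ∃ v ∈ roots n, t = refl v})
    {g : E n ≃ₗᵢ[ℝ] E n} (hg : g ∈ H) :
    ∀ a i, ∃ b j, g (sv a i) = sv b j ∧ Linked H a i b j := by
  have step : ∀ v ∈ roots n, refl v ∈ H → ∀ g : E n ≃ₗᵢ[ℝ] E n,
      (∀ a i, ∃ b j, g (sv a i) = sv b j ∧ Linked H a i b j) →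
      ∀ a i, ∃ b j, (refl v * g) (sv a i) = sv b j ∧ Linked H a i b j := by
    intro v hv hvH g ih a i
    obtain ⟨k, l, hkl, p, p', rfl⟩ := mem_roots_iff.1 hv
    obtain ⟨b, j, h1, h2⟩ := ih a i
    obtain ⟨c, m, h3, h4⟩ := refl_root_sv_cases hkl hvH b j
    refine ⟨c, m, by rw [mul_apply, h1, h3], ?_⟩
    rcases h4 with ⟨rfl, rfl⟩ | ⟨h4, h5⟩
    · exact h2
    · exact h2.step h4 h5
  rw [hH] at hg
  induction hg using Subgroup.closure_induction_left with
  | one => exact fun a i => ⟨a, i, rfl, Or.inl ⟨rfl, rfl⟩⟩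
  | mul_left t ht g _ ih =>
    obtain ⟨htH, v, hv, rfl⟩ := ht
    exact step v hv htH g ih
  | inv_mul_cancel t ht g _ ih =>
    obtain ⟨htH, v, hv, rfl⟩ := ht
    rw [refl_inv]
    exact step v hv htH g ih

/-- The blocks are the orbits up to sign, labelled by chosen representatives; d_i is the sign for
which e_i and d_i e_rep share an orbit. With these data `Adm` is exactly the orbit relation, and
`linked_of_mem` turns two orbit mates on different axes into a root of `H`. -/
theorem exists_eq_GA (hH : H = Subgroup.closure {t | t ∈ H ∧ ∃ v ∈ roots n, t = refl v}) :
    ∃ (q : Fin n → ℕ) (U : Set ℕ) (d : Fin n → ℤˣ), H = GA q U d ∧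
      ∀ i, q i ∈ U → ∃ j, j ≠ i ∧ q j = q i := by
  classical
  let O : ℤˣ → Fin n → ℤˣ → Fin n → Prop := fun a i b j => ∃ g ∈ H, g (sv a i) = sv b j
  have Orefl : ∀ a i, O a i a i := fun a i => ⟨1, one_mem _, rfl⟩
  have Osymm : ∀ {a i b j}, O a i b j → O b j a i := by
    rintro a i b j ⟨g, hg, h⟩
    exact ⟨g⁻¹, inv_mem hg, by rw [← h, inv_apply_apply]⟩
  have Otrans : ∀ {a i b j c k}, O a i b j → O b j c k → O a i c k := by
    rintro a i b j c k ⟨g, hg, h⟩ ⟨g', hg', h'⟩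
    exact ⟨g' * g, mul_mem hg' hg, by rw [mul_apply, h, h']⟩
  have Oneg : ∀ {a i b j}, O a i b j → O (-a) i (-b) j := by
    rintro a i b j ⟨g, hg, h⟩
    exact ⟨g, hg, by rw [sv_neg, sv_neg, map_neg, h]⟩
  have Omul : ∀ {a i b j} c, O a i b j → O (c * a) i (c * b) j := by
    intro a i b j c h
    rcases Int.units_eq_one_or c with rfl | rfl
    · simpa using h
    · simpa using Oneg h
  let S : Setoid (Fin n) :=
    { r := fun i j => ∃ b, O 1 i b j
      iseqv := ⟨fun i => ⟨1, Orefl 1 i⟩, fun {i j} ⟨b, h⟩ => ⟨b, by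
          have := Omul b (Osymm h)
          rwa [Int.units_mul_self, mul_one] at this⟩,
        fun {i j k} ⟨b, h⟩ ⟨c, h'⟩ => ⟨b * c, by
          have := Omul b h'
          rw [mul_one] at this
          exact Otrans h this⟩⟩ }
  let rep : Fin n → Fin n := fun i => (Quotient.mk S i).out
  have hrep : ∀ i, ∃ b, O 1 i b (rep i) := fun i => S.iseqv.symm (Quotient.mk_out (s := S) i)
  have hrep_eq : ∀ {i j}, (∃ b, O 1 i b j) → rep i = rep j := fun {i j} h => by
    have : Quotient.mk S i = Quotient.mk S j := Quotient.sound h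
    simp only [rep, this]
  choose d hd using hrep
  let U : Set ℕ := {k | ∃ i, (rep i : ℕ) = k ∧ O 1 i (-1) i}
  have hO : ∀ {a i b j}, O a i b j ↔ Adm (fun i => (rep i : ℕ)) U d a i b j := by
    intro a i b j
    constructor
    · intro h
      have h1 : O 1 i (a * b) j := by simpa [Int.units_mul_self] using Omul a h
      have hij : rep i = rep j := hrep_eq ⟨_, h1⟩
      refine ⟨congrArg Fin.val hij, ?_⟩
      rcases units_eq_or_eq_neg (a * d i) (b * d j) with h2 | h2
      · exact Or.inr h2
      -- If the relative signs disagree, the representative is in the orbit of its negative, so the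
      -- block is unbalanced.
      · refine Or.inl ⟨rep i, congrArg Fin.val (hrep_eq ?_).symm, ?_⟩
        · exact ⟨_, hd i⟩
        · have h3 := Omul a (hd i)
          have h4 := Omul b (hd j)
          rw [mul_one] at h3 h4
          rw [← hij] at h4
          have h5 := Otrans (Otrans (Osymm h3) h) h4
          rw [h2] at h5
          have h6 := Omul (-(b * d j)) h5
          simpa [Int.units_mul_self] using h6
    · rintro ⟨h1, h2⟩
      have hij : rep i = rep j := Fin.ext h1
      have h3 := Omul a (hd i)
      have h4 := Omul b (hd j)
      rw [mul_one] at h3 h4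
      rw [← hij] at h4
      rcases units_eq_or_eq_neg (a * d i) (b * d j) with h5 | h5
      · rw [h5] at h3
        exact Otrans h3 (Osymm h4)
      · rcases h2 with ⟨k, hk, hk'⟩ | h2
        · have hki : rep k = rep i := Fin.ext hk
          have h6 := hd k
          rw [hki] at h6
          have h7 := Oneg h6
          have h8 : O (d k) (rep i) (-d k) (rep i) :=
            Otrans (Osymm h6) (Otrans hk' h7)
          have h9 : O (a * d i) (rep i) (b * d j) (rep i) := by
            have := Omul (a * d i * d k) h8
            rw [mul_neg, mul_assoc, Int.units_mul_self, mul_one, h5, neg_neg] at this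
            rwa [h5]
          exact Otrans h3 (Otrans h9 (Osymm h4))
        · rw [h2] at h3
          exact Otrans h3 (Osymm h4)
  refine ⟨fun i => (rep i : ℕ), U, d, le_antisymm ?_ ?_, ?_⟩
  · rw [hH, Subgroup.closure_le]
    rintro t ⟨ht, v, hv, rfl⟩
    obtain ⟨i, j, hij, a, b, rfl⟩ := mem_roots_iff.1 hv
    exact root_mem_GA hij (hO.1 ⟨_, ht, refl_root_left hij⟩)
  · rw [GA, Subgroup.closure_le]
    rintro t ⟨a, i, b, j, hij, h, rfl⟩
    obtain ⟨g, hg, hgab⟩ := hO.2 h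
    obtain ⟨b', j', h1, h2⟩ := linked_of_mem hH hg a i
    rw [hgab, sv_inj] at h1
    obtain ⟨rfl, rfl⟩ := h1
    rcases h2 with ⟨_, h2⟩ | ⟨_, h2⟩ | ⟨h2, _⟩
    · exact absurd h2 hij
    · exact h2
    · exact absurd h2 hij
  -- By `Linked`, e_k and -e_k share an orbit only through a vector on a third axis, so an
  -- unbalanced block has at least two elements.
  · rintro i ⟨k, hki, g, hg, hgk⟩
    obtain ⟨b', j', h1, h2⟩ := linked_of_mem hH hg 1 k
    rw [hgk, sv_inj] at h1
    obtain ⟨rfl, rfl⟩ := h1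
    rcases h2 with ⟨h2, _⟩ | ⟨h2, _⟩ | ⟨_, _, c, l, hkl, h2, _⟩
    · exact absurd h2 (by decide)
    · exact absurd rfl h2
    · have hl : rep k = rep l := hrep_eq ⟨_, _, h2, refl_root_left hkl⟩
      by_cases hi : k = i
      · subst hi
        exact ⟨l, hkl.symm, congrArg Fin.val hl.symm⟩
      · exact ⟨k, hi, hki⟩

end Orbit

/-- The reflection subgroup of `W(D_n)` with the given signed block structure. -/
def G (q : Fin n → ℕ) (U : Set ℕ) (d : Fin n → ℤˣ) : Subgroup (WD n) :=
  (GA q U d).subgroupOf (WD n)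

theorem map_G (q : Fin n → ℕ) (U : Set ℕ) (d : Fin n → ℤˣ) :
    (G q U d).map (WD n).subtype = GA q U d := by
  rw [G, Subgroup.map_subgroupOf_eq_of_le (GA_le_WD q U d)]

theorem eq_of_map_eq {R R' : Subgroup (WD n)}
    (h : R.map (WD n).subtype = R'.map (WD n).subtype) : R = R' :=
  Subgroup.map_injective (WD n).subtype_injective h

theorem map_closure_preimage {S : Set (E n ≃ₗᵢ[ℝ] E n)} (hS : S ⊆ WD n) :
    (Subgroup.closure {t : WD n | (t : E n ≃ₗᵢ[ℝ] E n) ∈ S}).map (WD n).subtype =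
      Subgroup.closure S := by
  rw [MonoidHom.map_closure]
  congr 1
  ext t
  constructor
  · rintro ⟨t, ht, rfl⟩; exact ht
  · intro ht; exact ⟨⟨t, hS ht⟩, ht, rfl⟩

theorem isReflectionSubgroup_G (q : Fin n → ℕ) (U : Set ℕ) (d : Fin n → ℤˣ) :
    IsReflectionSubgroup (G q U d) := by
  refine ⟨{t | (t : E n ≃ₗᵢ[ℝ] E n) ∈ {t | ∃ a i b j, i ≠ j ∧ Adm q U d a i b j ∧
    t = refl (sv a i - sv b j)}}, ?_, ?_⟩
  · rintro t ⟨a, i, b, j, hij, _, ht⟩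
    exact ⟨_, root_ne_zero hij, ht⟩
  · apply eq_of_map_eq
    rw [map_G, map_closure_preimage, GA]
    rintro t ⟨a, i, b, j, hij, _, rfl⟩
    exact refl_mem_WD (root_mem_roots hij)

theorem IsReflectionSubgroup.exists_eq_G {R : Subgroup (WD n)} (h : IsReflectionSubgroup R) :
    ∃ (q : Fin n → ℕ) (U : Set ℕ) (d : Fin n → ℤˣ), R = G q U d ∧
      ∀ i, q i ∈ U → ∃ j, j ≠ i ∧ q j = q i := by
  obtain ⟨q, U, d, h1, h2⟩ := exists_eq_GA (H := R.map (WD n).subtype) (by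
    conv_lhs => rw [h.map_eq]
    congr 1
    ext t
    constructor
    · rintro ⟨v, hv, rfl⟩
      exact ⟨(mem_rootsOf_iff.1 hv).2, v, hv.1, rfl⟩
    · rintro ⟨ht, v, hv, rfl⟩
      exact ⟨v, mem_rootsOf_iff.2 ⟨hv, ht⟩, rfl⟩)
  exact ⟨q, U, d, eq_of_map_eq (by rw [h1, map_G]), h2⟩

/-- The closure acquires no roots beyond the admissible ones: the reflection sends a e_i to b e_j,
and elements of the group keep signed basis vectors admissible to their images. -/
theorem refl_mem_GA_iff {q : Fin n → ℕ} {U : Set ℕ} {d : Fin n → ℤˣ} {a b : ℤˣ} {i j : Fin n}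
    (hij : i ≠ j) : refl (sv a i - sv b j) ∈ GA q U d ↔ Adm q U d a i b j := by
  refine ⟨fun h => ?_, root_mem_GA hij⟩
  rw [refl_root hij, sp_mem_GA_iff] at h
  have := (h.1 i).mul a
  rwa [rootSign, if_pos (Or.inl rfl), Equiv.swap_apply_left, mul_one, ← mul_assoc,
    Int.units_mul_self, one_mul] at this

/-! ### Inner products of roots and the roots of a reflection subgroup -/

theorem inner_root_int {v w : E n} (hv : v ∈ roots n) (hw : w ∈ roots n) :
    ∃ m : ℤ, inner ℝ v w = (m : ℝ) := by
  obtain ⟨i, j, hij, a, b, rfl⟩ := mem_roots_iff.1 hv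
  obtain ⟨k, l, hkl, c, d, rfl⟩ := mem_roots_iff.1 hw
  refine ⟨(a : ℤ) * ((if i = k then (c : ℤ) else 0) - if i = l then (d : ℤ) else 0) -
    (b : ℤ) * ((if j = k then (c : ℤ) else 0) - if j = l then (d : ℤ) else 0), ?_⟩
  rw [inner_root]
  simp only [PiLp.sub_apply, sv_apply]
  push_cast
  rfl

theorem inner_self_root {v : E n} (hv : v ∈ roots n) : inner ℝ v v = (2 : ℝ) := by
  obtain ⟨i, j, hij, a, b, rfl⟩ := mem_roots_iff.1 hv
  rw [real_inner_self_eq_norm_sq, norm_sq_root hij]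

/-- The inner product is an integer, and it is less than 2 because ‖v - w‖² = 4 - 2⟨v, w⟩ is
positive. -/
theorem inner_eq_one_of_pos {v w : E n} (hv : v ∈ roots n) (hw : w ∈ roots n) (hne : v ≠ w)
    (h : 0 < inner ℝ v w) : inner ℝ v w = (1 : ℝ) := by
  obtain ⟨m, hm⟩ := inner_root_int hv hw
  have h1 : 0 < inner ℝ (v - w) (v - w) := real_inner_self_pos.2 (sub_ne_zero.2 hne)
  rw [inner_sub_left, inner_sub_right, inner_sub_right, inner_self_root hv, inner_self_root hw,
    real_inner_comm v w, hm] at h1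
  rw [hm] at h ⊢
  have h2 : 0 < m := by exact_mod_cast h
  have h3 : (m : ℝ) < 2 := by linarith
  have h4 : m < 2 := by exact_mod_cast h3
  have : m = 1 := by omega
  simp [this]

theorem neg_mem_roots {v : E n} (hv : v ∈ roots n) : -v ∈ roots n := by
  obtain ⟨i, j, hij, a, b, rfl⟩ := mem_roots_iff.1 hv
  rw [neg_sub]
  exact root_mem_roots hij.symm

theorem sp_mem_roots (σ : Equiv.Perm (Fin n)) (s : Fin n → ℤˣ) {v : E n} (hv : v ∈ roots n) :
    sp σ s v ∈ roots n := by
  obtain ⟨i, j, hij, a, b, rfl⟩ := mem_roots_iff.1 hv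
  rw [map_sub, sp_sv, sp_sv]
  exact root_mem_roots (σ.injective.ne hij)

theorem apply_mem_roots {w : E n ≃ₗᵢ[ℝ] E n} (hw : w ∈ WD n) {v : E n} (hv : v ∈ roots n) :
    w v ∈ roots n := by
  obtain ⟨σ, s, rfl, -⟩ := exists_sp_of_mem_WD hw
  exact sp_mem_roots σ s hv

theorem refl_root_vector {v : E n} (hv : v ∈ roots n) (x : E n) :
    refl v x = x - (inner ℝ v x : ℝ) • v := by
  have h : ‖v‖ ^ 2 = 2 := by rw [← real_inner_self_eq_norm_sq, inner_self_root hv]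
  rw [refl_apply, h]
  congr 2; ring

variable {R : Subgroup (WD n)}

theorem neg_mem_rootsOf {v : E n} (hv : v ∈ rootsOf R) : -v ∈ rootsOf R := by
  rw [mem_rootsOf_iff] at hv ⊢
  rw [refl_neg]
  exact ⟨neg_mem_roots hv.1, hv.2⟩

theorem refl_mem_rootsOf {v w : E n} (hv : v ∈ rootsOf R) (hw : w ∈ rootsOf R) :
    refl v w ∈ rootsOf R := by
  rw [mem_rootsOf_iff] at hv hw ⊢
  refine ⟨apply_mem_roots (refl_mem_WD hv.1) hw.1, ?_⟩
  rw [refl_map]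
  exact mul_mem (mul_mem hv.2 hw.2) (inv_mem hv.2)

theorem sub_mem_rootsOf {v w : E n} (hv : v ∈ rootsOf R) (hw : w ∈ rootsOf R) (hne : v ≠ w)
    (h : 0 < inner ℝ v w) : v - w ∈ rootsOf R := by
  have := refl_mem_rootsOf hw hv
  rwa [refl_root_vector hw.1, real_inner_comm, inner_eq_one_of_pos hv.1 hw.1 hne h, one_smul]
    at this

/-- At a positive inner product the difference of the two simple roots would be a root, with one
coefficient 1 and one coefficient -1, against the sign condition and independence. -/
theorem IsSimpleSystem.inner_nonpos {r : ℕ} {α : Fin r → E n} (h : IsSimpleSystem R α)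
    {i j : Fin r} (hij : i ≠ j) : inner ℝ (α i) (α j) ≤ (0 : ℝ) := by
  obtain ⟨hli, hroot, hpos, -⟩ := h
  by_contra! hcon
  have hne : α i ≠ α j := hli.injective.ne hij
  obtain ⟨c, hc, hv⟩ := hpos _ (sub_mem_rootsOf (hroot i) (hroot j) hne hcon)
  rw [Fintype.linearIndependent_iff] at hli
  rcases hv with hv | hv
  · have := hli (fun k => c k - (if k = i then 1 else 0) + if k = j then 1 else 0) (by
      simp only [add_smul, sub_smul, Finset.sum_add_distrib, Finset.sum_sub_distrib, ite_smul,
        one_smul, zero_smul, Finset.sum_ite_eq', Finset.mem_univ, if_true]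
      rw [← hv]; abel) j
    have h2 := hc j
    simp only [if_neg hij.symm, if_true] at this
    linarith
  · have := hli (fun k => c k + (if k = i then 1 else 0) - if k = j then 1 else 0) (by
      simp only [add_smul, sub_smul, Finset.sum_add_distrib, Finset.sum_sub_distrib, ite_smul,
        one_smul, zero_smul, Finset.sum_ite_eq', Finset.mem_univ, if_true]
      rw [← neg_eq_iff_eq_neg.2 hv]; abel) i
    have h2 := hc i
    simp only [if_neg hij, if_true] at this
    linarith

/-! ### Existence of simple systems -/

/-- A linear functional that vanishes on no root. -/
def height (n : ℕ) : Module.Dual ℝ (E n) :=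
  innerₗ (E n) (WithLp.toLp 2 fun i => ((i : ℕ) : ℝ) + 1)

theorem height_sv (a : ℤˣ) (i : Fin n) : height n (sv a i) = ((a : ℤ) : ℝ) * ((i : ℕ) + 1) := by
  rw [height, innerₗ_apply_apply, real_inner_comm, inner_sv]

/-- The weights 1, …, n are distinct and positive, so ±(i + 1) ± (j + 1) never vanishes for i ≠ j.
Integrality gives the lower bound 1 for positive heights, on which the induction over decompositions
rests. -/
theorem height_root {v : E n} (hv : v ∈ roots n) : ∃ m : ℤ, m ≠ 0 ∧ height n v = m := by
  obtain ⟨i, j, hij, a, b, rfl⟩ := mem_roots_iff.1 hv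
  refine ⟨(a : ℤ) * ((i : ℕ) + 1) - (b : ℤ) * ((j : ℕ) + 1), ?_, ?_⟩
  · have : (i : ℕ) ≠ j := fun h => hij (Fin.ext h)
    rcases Int.units_eq_one_or a with rfl | rfl <;> rcases Int.units_eq_one_or b with rfl | rfl <;>
      simp <;> omega
  · rw [map_sub, height_sv, height_sv]
    push_cast
    ring

theorem height_ne_zero {v : E n} (hv : v ∈ roots n) : height n v ≠ 0 := by
  obtain ⟨m, hm, h⟩ := height_root hv
  rw [h]; exact_mod_cast hm

theorem one_le_height {v : E n} (hv : v ∈ roots n) (h : 0 < height n v) : 1 ≤ height n v := by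
  obtain ⟨m, hm, h'⟩ := height_root hv
  rw [h'] at h ⊢
  have : 0 < m := by exact_mod_cast h
  exact_mod_cast this

/-- The roots of `R` of positive height. -/
def posRoots (R : Subgroup (WD n)) : Set (E n) := {v | v ∈ rootsOf R ∧ 0 < height n v}

/-- The indecomposable roots of positive height. -/
def baseRoots (R : Subgroup (WD n)) : Set (E n) :=
  {v | v ∈ posRoots R ∧ ∀ x ∈ posRoots R, ∀ y ∈ posRoots R, v ≠ x + y}

theorem finite_roots : (roots n).Finite := by
  refine (Set.finite_range fun p : (Fin n × Fin n) × (ℤˣ × ℤˣ) =>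
    sv p.2.1 p.1.1 - sv p.2.2 p.1.2).subset ?_
  intro v hv
  obtain ⟨i, j, hij, a, b, rfl⟩ := mem_roots_iff.1 hv
  exact ⟨((i, j), (a, b)), rfl⟩

theorem finite_baseRoots : (baseRoots R).Finite :=
  finite_roots.subset fun _ hv => hv.1.1.1

/-- If the inner product were positive, v - w or w - v would be a root of positive height, and v or
w would decompose. -/
theorem baseRoots_inner_nonpos {v w : E n} (hv : v ∈ baseRoots R) (hw : w ∈ baseRoots R)
    (hne : v ≠ w) : inner ℝ v w ≤ (0 : ℝ) := by
  by_contra! hcon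
  have h1 := sub_mem_rootsOf hv.1.1 hw.1.1 hne hcon
  rcases lt_or_gt_of_ne (height_ne_zero h1.1) with h2 | h2
  · have h3 : w - v ∈ posRoots R := by
      refine ⟨?_, ?_⟩
      · have := neg_mem_rootsOf h1
        rwa [neg_sub] at this
      · rw [← neg_sub, map_neg]; linarith
    exact hw.2 _ h3 _ hv.1 (by abel)
  · exact hv.2 _ ⟨h1, h2⟩ _ hw.1 (by abel)

/-- In a decomposition both summands have height at least 1, so each is lower than the sum by at
least 1. -/
theorem posRoots_induction {P : E n → Prop} (base : ∀ v ∈ baseRoots R, P v)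
    (add : ∀ x ∈ posRoots R, ∀ y ∈ posRoots R, x + y ∈ posRoots R → P x → P y → P (x + y))
    {v : E n} (hv : v ∈ posRoots R) : P v := by
  have key : ∀ (m : ℕ) (v : E n), v ∈ posRoots R → height n v < m → P v := by
    intro m
    induction m with
    | zero => intro v hv hm; exact absurd hm (by simpa using hv.2.le)
    | succ m ih =>
      intro v hv hm
      by_cases hb : v ∈ baseRoots R
      · exact base v hb
      · have : ∃ x ∈ posRoots R, ∃ y ∈ posRoots R, v = x + y := by
          by_contra! hcon
          exact hb ⟨hv, hcon⟩
        obtain ⟨x, hx, y, hy, rfl⟩ := this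
        have h1 := one_le_height hx.1.1 hx.2
        have h2 := one_le_height hy.1.1 hy.2
        rw [map_add] at hm
        push_cast at hm
        exact add x hx y hy hv (ih x hx (by linarith)) (ih y hy (by linarith))
  obtain ⟨m, hm⟩ := exists_nat_gt (height n v)
  exact key m v hv hm

/-- Comparing norms forces ⟨x, y⟩ = -1, hence x + y is the image of y under the reflection in x. -/
theorem refl_add_of_roots {x y : E n} (hx : x ∈ roots n) (hy : y ∈ roots n)
    (hxy : x + y ∈ roots n) : refl (x + y) = refl x * refl y * refl x := by
  have h1 := inner_self_root hxy
  rw [inner_add_left, inner_add_right, inner_add_right, inner_self_root hx, inner_self_root hy,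
    real_inner_comm x y] at h1
  have h2 : inner ℝ x y = (-1 : ℝ) := by linarith
  have h3 : refl x y = x + y := by
    rw [refl_root_vector hx, h2]; simp [add_comm]
  rw [← h3, refl_map, refl_inv]

/-- Vectors at pairwise non-acute angles in an open half-space are linearly independent; the
half-space is that of positive height. -/
theorem linearIndependent_baseRoots (R : Subgroup (WD n)) :
    LinearIndependent ℝ (fun v : baseRoots R => (v : E n)) := by
  refine LinearMap.BilinForm.linearIndependent_of_pairwise_le_zero (innerₗ (E n)) ?_ (height n) _
    (fun v => v.2.1.2) ?_
  · intro x hx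
    have : 0 < ‖x‖ ^ 2 := pow_pos (norm_pos_iff.2 hx) 2
    simpa using this
  · intro v w hvw
    exact baseRoots_inner_nonpos v.2 w.2 fun h => hvw (Subtype.ext h)

theorem exists_isSimpleSystem (hR : IsReflectionSubgroup R) :
    ∃ (r : ℕ) (α : Fin r → E n), IsSimpleSystem R α := by
  classical
  have : Fintype (baseRoots R) := finite_baseRoots.fintype
  let eq := Fintype.equivFin (baseRoots R)
  refine ⟨Fintype.card (baseRoots R), fun i => (eq.symm i : E n), ?_, fun i => (eq.symm i).2.1.1,
    ?_, ?_⟩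
  · exact (linearIndependent_baseRoots R).comp _ eq.symm.injective
  · have key : ∀ v ∈ posRoots R, ∃ c : Fin (Fintype.card (baseRoots R)) → ℝ, (∀ i, 0 ≤ c i) ∧
        v = ∑ i, c i • (eq.symm i : E n) := by
      intro v hv
      refine posRoots_induction (P := fun v => ∃ c : Fin (Fintype.card (baseRoots R)) → ℝ,
        (∀ i, 0 ≤ c i) ∧ v = ∑ i, c i • (eq.symm i : E n)) ?_ ?_ hv
      · intro v hv
        refine ⟨fun i => if i = eq ⟨v, hv⟩ then 1 else 0, fun i => by positivity, ?_⟩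
        simp
      · rintro x - y - - ⟨c, hc, hx⟩ ⟨c', hc', hy⟩
        exact ⟨c + c', fun i => add_nonneg (hc i) (hc' i), by
          simp only [Pi.add_apply, add_smul, Finset.sum_add_distrib, ← hx, ← hy]⟩
    intro v hv
    rcases lt_or_gt_of_ne (height_ne_zero hv.1) with h | h
    · obtain ⟨c, hc, h'⟩ := key (-v) ⟨neg_mem_rootsOf hv, by rw [map_neg]; linarith⟩
      exact ⟨c, hc, Or.inr (by rw [← h', neg_neg])⟩
    · obtain ⟨c, hc, h'⟩ := key v ⟨hv, h⟩
      exact ⟨c, hc, Or.inl h'⟩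
  · have hrange : (Set.range fun i => refl (eq.symm i : E n)) = refl '' baseRoots R := by
      ext t
      constructor
      · rintro ⟨i, rfl⟩; exact ⟨_, (eq.symm i).2, rfl⟩
      · rintro ⟨v, hv, rfl⟩; exact ⟨eq ⟨v, hv⟩, by simp⟩
    rw [hrange, hR.map_eq]
    apply le_antisymm
    · rw [Subgroup.closure_le]
      have key : ∀ v ∈ posRoots R, refl v ∈ Subgroup.closure (refl '' baseRoots R) := by
        intro v hv
        refine posRoots_induction (P := fun v => refl v ∈ Subgroup.closure (refl '' baseRoots R))
          (fun v hv => Subgroup.subset_closure ⟨v, hv, rfl⟩) ?_ hv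
        intro x hx y hy hxy h1 h2
        rw [refl_add_of_roots hx.1.1 hy.1.1 hxy.1.1]
        exact mul_mem (mul_mem h1 h2) h1
      rintro _ ⟨v, hv, rfl⟩
      rcases lt_or_gt_of_ne (height_ne_zero hv.1) with h | h
      · have := key (-v) ⟨neg_mem_rootsOf hv, by rw [map_neg]; linarith⟩
        rwa [refl_neg] at this
      · exact key v ⟨hv, h⟩
    · exact Subgroup.closure_mono (Set.image_mono fun v hv => hv.1.1)

theorem exists_isCoxeterElement (hR : IsReflectionSubgroup R) : ∃ c, IsCoxeterElement R c := by
  obtain ⟨r, α, hα⟩ := exists_isSimpleSystem hR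
  refine ⟨⟨(List.ofFn fun i => refl (α i)).prod, ?_⟩, r, α, hα, rfl⟩
  apply list_prod_mem
  intro t ht
  rw [List.mem_ofFn] at ht
  obtain ⟨i, rfl⟩ := ht
  exact refl_mem_WD (hα.2.1 i).1

/-! ### Conjugation -/

theorem map_map_conj (R : Subgroup (WD n)) (w : WD n) :
    (R.map (MulAut.conj w).toMonoidHom).map (WD n).subtype =
      (R.map (WD n).subtype).map (MulAut.conj (w : E n ≃ₗᵢ[ℝ] E n)).toMonoidHom := by
  rw [Subgroup.map_map, Subgroup.map_map]
  congr 1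

theorem mem_map_conj_iff {K : Type*} [Group K] {H : Subgroup K} {g x : K} :
    x ∈ H.map (MulAut.conj g).toMonoidHom ↔ g⁻¹ * x * g ∈ H := by
  constructor
  · rintro ⟨y, hy, rfl⟩
    simpa [mul_assoc] using hy
  · intro h
    exact ⟨_, h, by simp [mul_assoc]⟩

theorem mem_rootsOf_map_conj {w : WD n} {v : E n} :
    v ∈ rootsOf (R.map (MulAut.conj w).toMonoidHom) ↔
      (w⁻¹ : E n ≃ₗᵢ[ℝ] E n) v ∈ rootsOf R := by
  have h := refl_map (w⁻¹ : E n ≃ₗᵢ[ℝ] E n) v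
  rw [inv_inv] at h
  rw [mem_rootsOf_iff, mem_rootsOf_iff, map_map_conj, mem_map_conj_iff, h]
  refine and_congr_left fun _ => ⟨fun hv => apply_mem_roots (inv_mem w.2) hv, fun hv => ?_⟩
  have := apply_mem_roots w.2 hv
  rwa [apply_inv_apply] at this

theorem IsSimpleSystem.conj {r : ℕ} {α : Fin r → E n} (h : IsSimpleSystem R α) (w : WD n) :
    IsSimpleSystem (R.map (MulAut.conj w).toMonoidHom)
      (fun i => (w : E n ≃ₗᵢ[ℝ] E n) (α i)) := by
  obtain ⟨h1, h2, h3, h4⟩ := h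
  refine ⟨?_, fun i => ?_, fun v hv => ?_, ?_⟩
  · exact h1.map' (w : E n ≃ₗᵢ[ℝ] E n).toLinearEquiv.toLinearMap
      (LinearEquiv.ker (w : E n ≃ₗᵢ[ℝ] E n).toLinearEquiv)
  · rw [mem_rootsOf_map_conj, inv_apply_apply]
    exact h2 i
  · obtain ⟨c, hc, h⟩ := h3 _ (mem_rootsOf_map_conj.1 hv)
    refine ⟨c, hc, h.imp (fun h => ?_) (fun h => ?_)⟩
    · have := congrArg (w : E n ≃ₗᵢ[ℝ] E n) h
      rw [apply_inv_apply] at this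
      simpa using this
    · have := congrArg (w : E n ≃ₗᵢ[ℝ] E n) h
      rw [apply_inv_apply] at this
      simpa using this
  · rw [map_map_conj, h4, MonoidHom.map_closure]
    congr 1
    ext t
    constructor
    · rintro ⟨_, ⟨i, rfl⟩, rfl⟩
      exact ⟨i, by simp [refl_map]⟩
    · rintro ⟨i, rfl⟩
      exact ⟨_, ⟨i, rfl⟩, by simp [refl_map]⟩

theorem IsCoxeterElement.conj {c : WD n} (h : IsCoxeterElement R c) (w : WD n) :
    IsCoxeterElement (R.map (MulAut.conj w).toMonoidHom) (w * c * w⁻¹) := by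
  obtain ⟨r, α, hα, hc⟩ := h
  refine ⟨r, _, hα.conj w, ?_⟩
  have h1 : (fun i => refl ((w : E n ≃ₗᵢ[ℝ] E n) (α i))) =
      (MulAut.conj (w : E n ≃ₗᵢ[ℝ] E n)) ∘ fun i => refl (α i) := by
    funext i
    simp [refl_map]
  rw [h1, ← List.map_ofFn, List.prod_hom, ← hc]
  simp

/-! ### Coordinates of roots and digons -/

theorem inner_eq_sum (v w : E n) : inner ℝ v w = ∑ i, v i * w i := by
  simp [PiLp.inner_apply, mul_comm]

theorem root_coord {v : E n} (hv : v ∈ roots n) (i : Fin n) :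
    v i = 0 ∨ ∃ a : ℤˣ, v i = ((a : ℤ) : ℝ) := by
  obtain ⟨k, l, hkl, a, b, rfl⟩ := mem_roots_iff.1 hv
  simp only [PiLp.sub_apply, sv_apply]
  by_cases h1 : i = k
  · subst h1
    exact Or.inr ⟨a, by simp [hkl]⟩
  · by_cases h2 : i = l
    · subst h2
      exact Or.inr ⟨-b, by simp [h1]⟩
    · exact Or.inl (by simp [h1, h2])

theorem root_form {v : E n} (hv : v ∈ roots n) {i : Fin n} {a : ℤˣ}
    (h : v i = ((a : ℤ) : ℝ)) : ∃ b j, i ≠ j ∧ v = sv a i - sv b j := by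
  obtain ⟨k, l, hkl, c, b, rfl⟩ := mem_roots_iff.1 hv
  simp only [PiLp.sub_apply, sv_apply] at h
  by_cases h1 : i = k
  · subst h1
    rw [if_pos rfl, if_neg hkl, sub_zero] at h
    obtain rfl := units_cast_injective h
    exact ⟨b, l, hkl, rfl⟩
  · by_cases h2 : i = l
    · subst h2
      rw [if_neg h1, if_pos rfl, zero_sub] at h
      have h' : -b = a := units_cast_injective (by push_cast; exact h)
      subst h'
      exact ⟨-c, k, h1, by rw [sv_neg, sv_neg]; abel⟩
    · rw [if_neg h1, if_neg h2, sub_zero] at h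
      exact absurd h.symm (units_cast_ne_zero a)

theorem root_form' {v : E n} (hv : v ∈ roots n) {i : Fin n} (h : v i ≠ 0) :
    ∃ a b j, i ≠ j ∧ v = sv a i - sv b j := by
  obtain ⟨a, ha⟩ := (root_coord hv i).resolve_left h
  obtain ⟨b, j, h1, h2⟩ := root_form hv ha
  exact ⟨a, b, j, h1, h2⟩

theorem root_apply_left {a b : ℤˣ} {i j : Fin n} (h : i ≠ j) :
    (sv a i - sv b j) i = ((a : ℤ) : ℝ) := by
  simp [sv_apply, h]

theorem root_apply_right {a b : ℤˣ} {i j : Fin n} (h : i ≠ j) :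
    (sv a i - sv b j) j = -((b : ℤ) : ℝ) := by
  simp [sv_apply, h.symm]

theorem root_apply_of_ne {a b : ℤˣ} {i j k : Fin n} (hi : k ≠ i) (hj : k ≠ j) :
    (sv a i - sv b j) k = 0 := by
  simp [sv_apply, hi, hj]

/-- The common entry at i contributes 1 to the inner product. Only a common second coordinate j with
opposite signs can compensate for it. Such a pair is called a digon below. -/
theorem digon_of_inner_nonpos {v w : E n} (hv : v ∈ roots n) (hw : w ∈ roots n) {i : Fin n}
    {a : ℤˣ} (hvi : v i = ((a : ℤ) : ℝ)) (hwi : w i = ((a : ℤ) : ℝ))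
    (h : inner ℝ v w ≤ (0 : ℝ)) :
    ∃ b j, i ≠ j ∧ v = sv a i - sv b j ∧ w = sv a i - sv (-b) j := by
  obtain ⟨b, j, hij, rfl⟩ := root_form hv hvi
  obtain ⟨c, k, hik, rfl⟩ := root_form hw hwi
  rw [inner_root, root_apply_left hik, units_cast_mul_self] at h
  by_cases hjk : j = k
  · subst hjk
    rcases units_eq_or_eq_neg c b with rfl | rfl
    · rw [root_apply_right hij, mul_neg, units_cast_mul_self] at h
      norm_num at h
    · exact ⟨b, j, hij, rfl, rfl⟩
  · rw [root_apply_of_ne hij.symm hjk] at h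
    norm_num at h

theorem refl_commute {v w : E n} (hv : v ≠ 0) (h : inner ℝ v w = (0 : ℝ)) :
    refl v * refl w = refl w * refl v := by
  have h1 := refl_map (refl v) w
  rw [(refl_apply_eq_self_iff hv w).2 h] at h1
  conv_rhs => rw [h1]
  rw [refl_inv, mul_assoc, refl_mul_self, mul_one]

/-! ### Obtuse generating families -/

/-- A vector fixed by the product of the reflections in linearly independent vectors is orthogonal
to each of them. -/
theorem inner_eq_zero_of_prod_fixed {r : ℕ} {α : Fin r → E n} (hli : LinearIndependent ℝ α)
    {v : E n} : ∀ P : List (Fin r), P.Nodup → (P.map fun t => refl (α t)).prod v = v →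
      ∀ t ∈ P, inner ℝ (α t) v = (0 : ℝ) := by
  -- Each reflection changes a vector by a multiple of its own root only.
  have hsub : ∀ P : List (Fin r), v - (P.map fun t => refl (α t)).prod v ∈
      Submodule.span ℝ (α '' {t | t ∈ P}) := by
    intro P
    induction P with
    | nil => simp
    | cons t P ih =>
      rw [List.map_cons, List.prod_cons, mul_apply, refl_apply, ← sub_add]
      apply Submodule.add_mem
      · exact Submodule.span_mono (Set.image_mono fun x hx => List.mem_cons_of_mem _ hx) ih
      · exact Submodule.smul_mem _ _ (Submodule.subset_span ⟨t, by simp, rfl⟩)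
  intro P
  induction P with
  | nil => simp
  | cons t P ih =>
    intro hnd hfix
    rw [List.nodup_cons] at hnd
    rw [List.map_cons, List.prod_cons, mul_apply] at hfix
    have h1 : (P.map fun t => refl (α t)).prod v = refl (α t) v := by
      have := congrArg (refl (α t)) hfix
      rwa [← mul_apply, refl_mul_self] at this
    have h2 := hsub P
    rw [h1, refl_apply, sub_sub_cancel] at h2
    -- This coefficient multiplies α t to a vector in the span of the remaining roots, so
    -- independence makes it vanish; the head then fixes v, and so does the tail.
    have h3 : 2 * (inner ℝ (α t) v / ‖α t‖ ^ 2) = 0 := by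
      by_contra hne
      have h4 := (Submodule.smul_mem_iff _ hne).1 h2
      exact hli.notMem_span_image (s := {t | t ∈ P}) hnd.1 h4
    have h5 : refl (α t) v = v := by rw [refl_apply, h3, zero_smul, sub_zero]
    have h6 := (refl_apply_eq_self_iff (hli.ne_zero t) v).1 h5
    intro t' ht'
    rcases List.mem_cons.1 ht' with rfl | ht'
    · exact h6
    · exact ih hnd.2 (h1.trans h5) t' ht'

/-- Linearly independent roots that form pairwise obtuse angles and whose reflections generate the
reflection group with the given signed block structure. -/
structure ObtuseGenerators (q : Fin n → ℕ) (U : Set ℕ) (d : Fin n → ℤˣ) {r : ℕ}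
    (α : Fin r → E n) : Prop where
  linInd : LinearIndependent ℝ α
  root : ∀ t, α t ∈ roots n
  obtuse : ∀ s t, s ≠ t → inner ℝ (α s) (α t) ≤ (0 : ℝ)
  gen : GA q U d = Subgroup.closure (Set.range fun t => refl (α t))
  two_le : ∀ i, q i ∈ U → ∃ j, j ≠ i ∧ q j = q i

theorem fixed_balanced {q : Fin n → ℕ} {U : Set ℕ} {d : Fin n → ℤˣ} {v : E n}
    (hv : ∀ g ∈ GA q U d, g v = v) {i j : Fin n} (h : q i = q j) :
    ((d i : ℤ) : ℝ) * v i = ((d j : ℤ) : ℝ) * v j := by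
  by_cases hij : i = j
  · rw [hij]
  · have h1 := hv _ (root_mem_GA (a := d i) (b := d j) hij
      ⟨h, Or.inr (by rw [Int.units_mul_self, Int.units_mul_self])⟩)
    rw [refl_apply_eq_self_iff (root_ne_zero hij), inner_root] at h1
    linarith

theorem fixed_unbalanced {q : Fin n → ℕ} {U : Set ℕ} {d : Fin n → ℤˣ} {v : E n}
    (hv : ∀ g ∈ GA q U d, g v = v) {i j : Fin n} (h : q i = q j) (hij : i ≠ j) (hU : q i ∈ U) :
    v i = 0 := by
  have h1 := hv _ (root_mem_GA (a := 1) (b := 1) hij ⟨h, Or.inl hU⟩)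
  have h2 := hv _ (root_mem_GA (a := 1) (b := -1) hij ⟨h, Or.inl hU⟩)
  rw [refl_apply_eq_self_iff (root_ne_zero hij), inner_root] at h1 h2
  push_cast at h1 h2
  linarith

open Classical in
/-- Extension by zero of a family of coordinates. -/
def extendZero (p : Fin n → Prop) : ({i // p i} → ℝ) →ₗ[ℝ] E n where
  toFun v := WithLp.toLp 2 fun i => if hi : p i then v ⟨i, hi⟩ else 0
  map_add' v w := by
    ext i
    by_cases hi : p i <;> simp [hi]
  map_smul' c v := by
    ext i
    by_cases hi : p i <;> simp [hi]

theorem extendZero_of_pos (p : Fin n → Prop) (v : {i // p i} → ℝ) {i : Fin n} (hi : p i) :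
    extendZero p v i = v ⟨i, hi⟩ := by
  simp [extendZero, hi]

theorem extendZero_of_neg (p : Fin n → Prop) (v : {i // p i} → ℝ) {i : Fin n} (hi : ¬p i) :
    extendZero p v i = 0 := by
  simp [extendZero, hi]

/-- There are fewer linear conditions than free coordinates. -/
theorem exists_orthogonal {r : ℕ} {α : Fin r → E n} {p : Fin n → Prop} {Q : Fin r → Prop}
    (h : Nat.card {t // Q t} < Nat.card {i // p i}) :
    ∃ v : E n, v ≠ 0 ∧ (∀ i, ¬p i → v i = 0) ∧ ∀ t, Q t → inner ℝ (α t) v = (0 : ℝ) := by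
  classical
  let f : ({i // p i} → ℝ) →ₗ[ℝ] ({t // Q t} → ℝ) :=
    LinearMap.pi fun t => innerₗ (E n) (α t.1) ∘ₗ extendZero p
  have hker : LinearMap.ker f ≠ ⊥ :=
    LinearMap.ker_ne_bot_of_finrank_lt (by simpa [Nat.card_eq_fintype_card] using h)
  obtain ⟨v, hv, hv0⟩ := Submodule.exists_mem_ne_zero_of_ne_bot hker
  refine ⟨extendZero p v, fun h0 => hv0 ?_, fun i hi => extendZero_of_neg p v hi, fun t ht => ?_⟩
  · funext ⟨i, hi⟩
    rw [← extendZero_of_pos p v hi, h0]; rfl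
  · exact congrFun (LinearMap.mem_ker.1 hv) ⟨t, ht⟩

namespace ObtuseGenerators

variable {q : Fin n → ℕ} {U : Set ℕ} {d : Fin n → ℤˣ} {r : ℕ} {α : Fin r → E n}
  (h : ObtuseGenerators q U d α)

include h

theorem refl_mem (t : Fin r) : refl (α t) ∈ GA q U d := by
  rw [h.gen]; exact Subgroup.subset_closure ⟨t, rfl⟩

theorem prod_mem (P : List (Fin r)) : (P.map fun t => refl (α t)).prod ∈ GA q U d := by
  apply list_prod_mem
  intro g hg
  obtain ⟨t, _, rfl⟩ := List.mem_map.1 hg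
  exact h.refl_mem t

theorem block_eq (t : Fin r) {i j : Fin n} (hi : α t i ≠ 0) (hj : α t j ≠ 0) : q i = q j := by
  obtain ⟨a, b, k, hik, hv⟩ := root_form' (h.root t) hi
  have h1 := h.refl_mem t
  rw [hv, refl_mem_GA_iff hik] at h1
  by_cases hji : j = i
  · rw [hji]
  · by_cases hjk : j = k
    · rw [hjk]; exact h1.1
    · rw [hv, root_apply_of_ne hji hjk] at hj
      exact absurd rfl hj

theorem fixed_of_inner_eq_zero {v : E n} (hv : ∀ t, inner ℝ (α t) v = (0 : ℝ)) :
    ∀ g ∈ GA q U d, g v = v := by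
  intro g hg
  rw [h.gen] at hg
  induction hg using Subgroup.closure_induction with
  | mem x hx =>
    obtain ⟨t, rfl⟩ := hx
    exact (refl_apply_eq_self_iff (h.linInd.ne_zero t) v).2 (hv t)
  | one => rfl
  | mul x y _ _ hx hy => rw [mul_apply, hy, hx]
  | inv x _ hx => rw [← hx, inv_apply_apply, hx]

/-- The permutations underlying the generators preserve p, hence so do those of all group elements,
and one of these takes i to j. -/
theorem iff_of_block_eq {p : Fin n → Prop}
    (hp : ∀ t i j, α t i ≠ 0 → α t j ≠ 0 → (p i ↔ p j)) {i j : Fin n} (hij : q i = q j) :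
    p i ↔ p j := by
  have key : ∀ g ∈ GA q U d, ∃ σ s, g = sp σ s ∧ ∀ i, p i ↔ p (σ i) := by
    intro g hg
    rw [h.gen] at hg
    induction hg using Subgroup.closure_induction with
    | mem x hx =>
      obtain ⟨t, rfl⟩ := hx
      obtain ⟨k, l, hkl, a, b, hv⟩ := mem_roots_iff.1 (h.root t)
      have hkl' : p k ↔ p l := by
        apply hp t
        · rw [hv, root_apply_left hkl]; exact units_cast_ne_zero a
        · rw [hv, root_apply_right hkl]; exact neg_ne_zero.2 (units_cast_ne_zero b)
      refine ⟨_, _, (congrArg refl hv).trans (refl_root hkl), fun i => ?_⟩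
      by_cases hik : i = k
      · subst hik; rw [Equiv.swap_apply_left]; exact hkl'
      · by_cases hil : i = l
        · subst hil; rw [Equiv.swap_apply_right]; exact hkl'.symm
        · rw [Equiv.swap_apply_of_ne_of_ne hik hil]
    | one => exact ⟨1, fun _ => 1, sp_one.symm, fun i => Iff.rfl⟩
    | mul x y _ _ hx hy =>
      obtain ⟨σ, s, rfl, hs⟩ := hx
      obtain ⟨τ, t, rfl, ht⟩ := hy
      exact ⟨_, _, sp_mul _ _ _ _, fun i => (ht i).trans (hs _)⟩
    | inv x _ hx =>
      obtain ⟨σ, s, rfl, hs⟩ := hx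
      refine ⟨_, _, sp_inv _ _, fun i => ?_⟩
      rw [hs (σ⁻¹ i), show σ (σ⁻¹ i) = i from σ.apply_symm_apply i]
  by_cases hne : i = j
  · rw [hne]
  · obtain ⟨σ, s, h1, h2⟩ := key _ (root_mem_GA (a := d i) (b := d j) hne
      ⟨hij, Or.inr (by rw [Int.units_mul_self, Int.units_mul_self])⟩)
    have h3 := refl_root_left (a := d i) (b := d j) hne
    rw [h1, sp_sv, sv_inj] at h3
    rw [h2 i, h3.2]

theorem ne_neg {s t : Fin r} (hst : s ≠ t) : α s ≠ -α t := by
  intro heq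
  have h1 := h.linInd.notMem_span_image (s := {t}) (x := s) (by simpa using hst)
  apply h1
  rw [heq, Set.image_singleton]
  exact Submodule.neg_mem _ (Submodule.mem_span_singleton_self _)

theorem apply_eq_zero_of_block_ne {t : Fin r} {k : ℕ} (ht : ∃ i, q i = k ∧ α t i ≠ 0) {j : Fin n}
    (hj : q j ≠ k) : α t j = 0 := by
  obtain ⟨i, hi, hti⟩ := ht
  by_contra hne
  exact hj ((h.block_eq t hne hti).trans hi)

/-- Otherwise some nonzero vector supported on the block is orthogonal to all generators, hence
fixed by the group; but fixed vectors vanish on unbalanced blocks. -/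
theorem card_block_le {k : ℕ} (hk : k ∈ U) :
    Nat.card {i // q i = k} ≤ Nat.card {t // ∃ i, q i = k ∧ α t i ≠ 0} := by
  by_contra! hcon
  obtain ⟨v, hv0, hv1, hv2⟩ := exists_orthogonal (α := α) hcon
  have h1 : ∀ t, inner ℝ (α t) v = (0 : ℝ) := by
    intro t
    by_cases ht : ∃ i, q i = k ∧ α t i ≠ 0
    · exact hv2 t ht
    · push Not at ht
      rw [inner_eq_sum]
      apply Finset.sum_eq_zero
      intro i _
      by_cases hi : q i = k
      · rw [ht i hi, zero_mul]
      · rw [hv1 i hi, mul_zero]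
  apply hv0
  ext i
  by_cases hi : q i = k
  · obtain ⟨j, hj, hji⟩ := h.two_le i (hi ▸ hk)
    exact fixed_unbalanced (h.fixed_of_inner_eq_zero h1) hji.symm hj.symm (hi ▸ hk)
  · exact hv1 i hi

theorem card_le_block (k : ℕ) :
    Nat.card {t // ∃ i, q i = k ∧ α t i ≠ 0} ≤ Nat.card {i // q i = k} := by
  classical
  have h1 : LinearIndependent ℝ (fun t : {t // ∃ i, q i = k ∧ α t i ≠ 0} => α t) :=
    h.linInd.comp _ Subtype.val_injective
  have h2 : Submodule.span ℝ (Set.range fun t : {t // ∃ i, q i = k ∧ α t i ≠ 0} => α t) ≤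
      LinearMap.range (extendZero fun i : Fin n => q i = k) := by
    rw [Submodule.span_le]
    rintro _ ⟨⟨t, ht⟩, rfl⟩
    refine ⟨fun i => α t i, ?_⟩
    ext i
    by_cases hi : q i = k
    · rw [extendZero_of_pos _ _ hi]
    · rw [extendZero_of_neg _ _ hi, h.apply_eq_zero_of_block_ne ht hi]
  have h3 := (Submodule.finrank_mono h2).trans (LinearMap.finrank_range_le _)
  rwa [finrank_span_eq_card h1, Module.finrank_fintype_fun_eq_card, ← Nat.card_eq_fintype_card,
    ← Nat.card_eq_fintype_card] at h3

/-- Double counting of the nonzero entries on the block. Without a digon each of the values 1 and -1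
occurs at most once in each coordinate, which bounds the number of entries by twice the block size.
Each generator has two entries and there are at least as many generators as coordinates, so both
values occur exactly once everywhere. Then the generators of the block add up to zero, against
independence. -/
theorem exists_digon {i₀ : Fin n} (hU : q i₀ ∈ U) :
    ∃ t t' a b i j, t ≠ t' ∧ i ≠ j ∧ q i = q i₀ ∧ α t = sv a i - sv b j ∧
      α t' = sv a i - sv (-b) j := by
  classical
  by_contra hno
  have huniq : ∀ i, q i = q i₀ → ∀ (a : ℤˣ) t t', α t i = ((a : ℤ) : ℝ) →
      α t' i = ((a : ℤ) : ℝ) → t = t' := by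
    intro i hi a t t' ht ht'
    by_contra hne
    obtain ⟨b, j, hij, h1, h2⟩ :=
      digon_of_inner_nonpos (h.root t) (h.root t') ht ht' (h.obtuse t t' hne)
    exact hno ⟨t, t', a, b, i, j, hne, hij, hi, h1, h2⟩
  let I : Finset (Fin r) := {t | ∃ i, q i = q i₀ ∧ α t i ≠ 0}
  let B : Finset (Fin n) := {i | q i = q i₀}
  have hBI : B.card ≤ I.card := by
    have := h.card_block_le hU
    rwa [Nat.card_eq_fintype_card, Nat.card_eq_fintype_card, Fintype.card_subtype,
      Fintype.card_subtype] at this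
  let p : Fin n → ℕ := fun i => (I.filter fun t => α t i = 1).card
  let m : Fin n → ℕ := fun i => (I.filter fun t => α t i = -1).card
  have hsq : ∀ t i, α t i * α t i =
      (if α t i = 1 then (1 : ℝ) else 0) + (if α t i = -1 then (1 : ℝ) else 0) := by
    intro t i
    rcases root_coord (h.root t) i with h0 | ⟨a, ha⟩
    · rw [h0]; norm_num
    · rw [ha]
      rcases Int.units_eq_one_or a with rfl | rfl <;> norm_num
  have hlin : ∀ t i, α t i =
      (if α t i = 1 then (1 : ℝ) else 0) - (if α t i = -1 then (1 : ℝ) else 0) := by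
    intro t i
    rcases root_coord (h.root t) i with h0 | ⟨a, ha⟩
    · rw [h0]; norm_num
    · rw [ha]
      rcases Int.units_eq_one_or a with rfl | rfl <;> norm_num
  have hp : ∀ i ∈ B, p i ≤ 1 := fun i hi => by
    refine Finset.card_le_one.2 fun t ht t' ht' => ?_
    rw [Finset.mem_filter] at ht ht' hi
    exact huniq i hi.2 1 t t' (by simpa using ht.2) (by simpa using ht'.2)
  have hm : ∀ i ∈ B, m i ≤ 1 := fun i hi => by
    refine Finset.card_le_one.2 fun t ht t' ht' => ?_
    rw [Finset.mem_filter] at ht ht' hi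
    exact huniq i hi.2 (-1) t t' (by simpa using ht.2) (by simpa using ht'.2)
  have hcount : ∑ i ∈ B, (p i + m i) = 2 * I.card := by
    have h1 : ∑ i ∈ B, ∑ t ∈ I, α t i * α t i = 2 * (I.card : ℝ) := by
      rw [Finset.sum_comm, mul_comm, ← nsmul_eq_mul, ← Finset.sum_const]
      refine Finset.sum_congr rfl fun t ht => ?_
      rw [← inner_self_root (h.root t), inner_eq_sum]
      refine Finset.sum_subset (Finset.subset_univ _) fun i _ hi => ?_
      rw [h.apply_eq_zero_of_block_ne (k := q i₀) (by simpa [I] using ht) (by simpa [B] using hi),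
        mul_zero]
    have h2 : ∑ i ∈ B, ∑ t ∈ I, α t i * α t i = ((∑ i ∈ B, (p i + m i) : ℕ) : ℝ) := by
      push_cast
      refine Finset.sum_congr rfl fun i _ => ?_
      simp only [hsq, Finset.sum_add_distrib, Finset.sum_boole, p, m]
    rw [h2] at h1
    exact_mod_cast h1
  have hone : ∀ i ∈ B, p i = m i := by
    intro i hi
    by_contra hne
    have h1 : ∑ i ∈ B, (p i + m i) < ∑ i ∈ B, 2 := by
      refine Finset.sum_lt_sum (fun i hi => ?_) ⟨i, hi, ?_⟩
      · have := hp i hi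
        have := hm i hi
        omega
      · have := hp i hi
        have := hm i hi
        omega
    rw [hcount, Finset.sum_const, smul_eq_mul] at h1
    omega
  have hsum : ∑ t ∈ I, (1 : ℝ) • α t = 0 := by
    ext i
    simp only [one_smul, WithLp.ofLp_sum, Finset.sum_apply, PiLp.zero_apply]
    by_cases hi : i ∈ B
    · rw [Finset.sum_congr rfl fun t _ => hlin t i]
      simp only [Finset.sum_sub_distrib, Finset.sum_boole]
      have := hone i hi
      simp only [p, m] at this
      rw [this, sub_self]
    · refine Finset.sum_eq_zero fun t ht => ?_
      exact h.apply_eq_zero_of_block_ne (k := q i₀) (by simpa [I] using ht) (by simpa [B] using hi)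
  have hIne : I.Nonempty := by
    rw [← Finset.card_pos]
    refine lt_of_lt_of_le ?_ hBI
    exact Finset.card_pos.2 ⟨i₀, by simp [B]⟩
  obtain ⟨t, ht⟩ := hIne
  have := linearIndependent_iff'.1 h.linInd I (fun _ => 1) hsum t ht
  norm_num at this

variable {t t' : Fin r} {a b : ℤˣ} {i j : Fin n} (htt' : t ≠ t') (hij : i ≠ j)
  (ht : α t = sv a i - sv b j) (ht' : α t' = sv a i - sv (-b) j)

include htt' hij ht ht'

omit htt' in
-- The two obtuseness conditions read a s_i ≤ b s_j and a s_i ≤ -b s_j for the coordinates of α s.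
-- If s_j ≠ 0, they force a s_i = -1, so α s is the negative of a member of the digon, against
-- independence.
theorem digon_right {s : Fin r} (hs : s ≠ t) (hs' : s ≠ t') : α s j = 0 := by
  by_contra hne
  have h1 := h.obtuse t s hs.symm
  have h2 := h.obtuse t' s hs'.symm
  rw [ht, inner_root] at h1
  rw [ht', inner_root] at h2
  obtain ⟨c, hc⟩ := (root_coord (h.root s) j).resolve_left hne
  obtain ⟨c', k, hjk, hs3⟩ := root_form (h.root s) hc
  by_cases hki : k = i
  · subst hki
    have hsk : α s k = -((c' : ℤ) : ℝ) := by rw [hs3, root_apply_right hjk]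
    rw [hsk, hc] at h1 h2
    have hca : c' = a := by
      rcases units_eq_or_eq_neg c' a with h3 | h3
      · exact h3
      · rw [h3] at h1 h2
        push_cast at h1 h2
        rw [neg_neg, units_cast_mul_self] at h1 h2
        linarith
    subst hca
    rcases units_eq_or_eq_neg c b with h4 | h4
    · apply h.ne_neg hs
      rw [hs3, ht, h4]; abel
    · apply h.ne_neg hs'
      rw [hs3, ht', h4]; abel
  · have : α s i = 0 := by rw [hs3, root_apply_of_ne hij (Ne.symm hki)]
    rw [this, hc] at h1 h2
    push_cast at h1 h2
    have h3 : ((b : ℤ) : ℝ) * ((c : ℤ) : ℝ) = 0 := by linarith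
    rcases mul_eq_zero.1 h3 with h3 | h3
    · exact units_cast_ne_zero b h3
    · exact units_cast_ne_zero c h3

/-- Another generator that involves i has entry -a there. Two of them would form a second digon at
i, and the four roots would add up to zero. -/
theorem digon_left_unique {s s' : Fin r} (hs : s ≠ t) (hs1 : s ≠ t') (hs' : s' ≠ t) (hs1' : s' ≠ t')
    (hsi : α s i ≠ 0) (hsi' : α s' i ≠ 0) : s = s' := by
  by_contra hne
  have key : ∀ s : Fin r, s ≠ t → s ≠ t' → α s i ≠ 0 → α s i = (((-a : ℤˣ) : ℤ) : ℝ) := by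
    intro s hs hs1 hsi
    have h1 := h.obtuse t s hs.symm
    rw [ht, inner_root, h.digon_right hij ht ht' hs hs1, mul_zero, sub_zero] at h1
    obtain ⟨c, hc⟩ := (root_coord (h.root s) i).resolve_left hsi
    rw [hc] at h1 ⊢
    rcases units_eq_or_eq_neg c a with h2 | h2
    · rw [h2, units_cast_mul_self] at h1
      norm_num at h1
    · rw [h2]
  obtain ⟨c, k, hik, h1, h2⟩ := digon_of_inner_nonpos (h.root s) (h.root s') (key s hs hs1 hsi)
    (key s' hs' hs1' hsi') (h.obtuse s s' hne)
  have hsum : ∑ x ∈ ({t, t', s, s'} : Finset (Fin r)), (1 : ℝ) • α x = 0 := by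
    rw [Finset.sum_insert (by simp [htt', hs.symm, hs'.symm]),
      Finset.sum_insert (by simp [hs1.symm, hs1'.symm]), Finset.sum_insert (by simpa using hne),
      Finset.sum_singleton, ht, ht', h1, h2]
    simp only [one_smul, sv_neg]
    abel
  have := linearIndependent_iff'.1 h.linInd _ (fun _ => 1) hsum t (by simp)
  norm_num at this

omit htt' in
theorem commute_digon {s : Fin r} (hs : s ≠ t) (hs1 : s ≠ t') (hsi : α s i = 0) :
    Commute (refl (α s)) (refl (α t)) ∧ Commute (refl (α s)) (refl (α t')) := by
  have hj := h.digon_right hij ht ht' hs hs1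
  constructor
  · refine refl_commute (h.linInd.ne_zero s) ?_
    rw [real_inner_comm, ht, inner_root, hsi, hj]; simp
  · refine refl_commute (h.linInd.ne_zero s) ?_
    rw [real_inner_comm, ht', inner_root, hsi, hj]; simp

omit hij ht ht' htt' in
-- At most one further generator fails to commute with the digon reflections. If it is not between
-- them in the word, t moves up to t', and conjugation by the tail P₃ carries the tail to the front.
-- If it is between them, P₁ and P₃ commute with both, and conjugation by the reflection t cancels
-- the t after P₁ and creates one at the end.
theorem exists_conj_of_split (P₁ P₂ P₃ : List (Fin r)) (hnd : (P₁ ++ t :: (P₂ ++ t' :: P₃)).Nodup)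
    (huniq : ∀ s s', s ≠ t → s ≠ t' → s' ≠ t → s' ≠ t' → α s i ≠ 0 → α s' i ≠ 0 → s = s')
    (hcomm : ∀ s, s ≠ t → s ≠ t' → α s i = 0 →
      Commute (refl (α s)) (refl (α t)) ∧ Commute (refl (α s)) (refl (α t')))
    (htcomm : Commute (refl (α t)) (refl (α t'))) :
    ∃ g ∈ GA q U d, ∃ P : List (Fin r), P.Perm (P₁ ++ (P₂ ++ P₃)) ∧
      g * ((P₁ ++ t :: (P₂ ++ t' :: P₃)).map fun s => refl (α s)).prod * g⁻¹ =
        (P.map fun s => refl (α s)).prod * (refl (α t) * refl (α t')) := by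
  have hnd' : (t :: t' :: (P₁ ++ (P₂ ++ P₃))).Nodup := by
    refine List.Perm.nodup ?_ hnd
    refine List.perm_middle.trans (List.Perm.cons t ?_)
    rw [← List.append_assoc]
    refine List.perm_middle.trans ?_
    rw [List.append_assoc]
  simp only [List.nodup_cons, List.mem_cons, List.mem_append, not_or] at hnd'
  obtain ⟨⟨-, ht1, ht2, ht3⟩, ⟨ht1', ht2', ht3'⟩, hnd2⟩ := hnd'
  have hc : ∀ P : List (Fin r), t ∉ P → t' ∉ P → (∀ s ∈ P, α s i = 0) →
      Commute (P.map fun s => refl (α s)).prod (refl (α t)) ∧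
      Commute (P.map fun s => refl (α s)).prod (refl (α t')) := by
    intro P htP htP' hP
    have h1 : ∀ s ∈ P, Commute (refl (α s)) (refl (α t)) ∧ Commute (refl (α s)) (refl (α t')) :=
      fun s hs => hcomm s (fun h => htP (h ▸ hs)) (fun h => htP' (h ▸ hs)) (hP s hs)
    constructor
    · apply Commute.list_prod_left
      intro g hg
      obtain ⟨s, hs, rfl⟩ := List.mem_map.1 hg
      exact (h1 s hs).1
    · apply Commute.list_prod_left
      intro g hg
      obtain ⟨s, hs, rfl⟩ := List.mem_map.1 hg
      exact (h1 s hs).2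
  by_cases hP2 : ∀ s ∈ P₂, α s i = 0
  · refine ⟨_, h.prod_mem P₃, P₃ ++ (P₁ ++ P₂), ?_, ?_⟩
    · rw [← List.append_assoc P₁]
      exact List.perm_append_comm
    · have h1 := (hc P₂ ht2 ht2' hP2).1
      simp only [List.map_append, List.map_cons, List.prod_append, List.prod_cons]
      have h2 := h1.eq
      simp only [mul_assoc, mul_inv_cancel, mul_one]
      congr 2
      rw [← mul_assoc, ← h2, mul_assoc]
  · push Not at hP2
    obtain ⟨s, hs, hsi⟩ := hP2
    have hother : ∀ P : List (Fin r), t ∉ P → t' ∉ P → s ∉ P → ∀ s' ∈ P, α s' i = 0 := by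
      intro P htP htP' hsP s' hs'
      by_contra hne
      have := huniq s s' (fun h => ht2 (h ▸ hs)) (fun h => ht2' (h ▸ hs))
        (fun h => htP (h ▸ hs')) (fun h => htP' (h ▸ hs')) hsi hne
      exact hsP (this ▸ hs')
    rw [List.nodup_append, List.nodup_append] at hnd2
    have hs1 : s ∉ P₁ := fun hs1 => hnd2.2.2 s hs1 s (List.mem_append_left _ hs) rfl
    have hs3 : s ∉ P₃ := fun hs3 => hnd2.2.1.2.2 s hs s hs3 rfl
    have c1 := (hc P₁ ht1 ht1' (hother P₁ ht1 ht1' hs1)).1.eq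
    have c3 := (hc P₃ ht3 ht3' (hother P₃ ht3 ht3' hs3))
    refine ⟨_, h.refl_mem t, P₁ ++ (P₂ ++ P₃), List.Perm.refl _, ?_⟩
    simp only [List.map_append, List.map_cons, List.prod_append, List.prod_cons]
    rw [refl_inv]
    set X := (P₁.map fun s => refl (α s)).prod
    set Y := (P₂.map fun s => refl (α s)).prod
    set Z := (P₃.map fun s => refl (α s)).prod
    calc refl (α t) * (X * (refl (α t) * (Y * (refl (α t') * Z)))) * refl (α t)
        = refl (α t) * (X * refl (α t)) * Y * (refl (α t') * Z) * refl (α t) := by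
          simp only [mul_assoc]
      _ = refl (α t) * (refl (α t) * X) * Y * (Z * refl (α t')) * refl (α t) := by
          rw [c1, c3.2.eq]
      _ = (refl (α t) * refl (α t)) * X * Y * Z * (refl (α t') * refl (α t)) := by
          simp only [mul_assoc]
      _ = X * (Y * Z) * (refl (α t) * refl (α t')) := by
          rw [refl_mul_self, one_mul, htcomm.eq]
          simp only [mul_assoc]

theorem exists_conj :
    ∃ g ∈ GA q U d, ∃ P : List (Fin r), P.Nodup ∧ (∀ s, s ∈ P ↔ s ≠ t ∧ s ≠ t') ∧
      g * (List.ofFn fun s => refl (α s)).prod * g⁻¹ =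
        (P.map fun s => refl (α s)).prod * (refl (α t) * refl (α t')) := by
  have htcomm : Commute (refl (α t)) (refl (α t')) := by
    refine refl_commute (h.linInd.ne_zero t) ?_
    rw [ht, ht', inner_root, root_apply_left hij, root_apply_right hij]
    push_cast
    rw [neg_neg, units_cast_mul_self, units_cast_mul_self, sub_self]
  have hfin : ∀ s, s ∈ List.finRange r := List.mem_finRange
  have hnd := List.nodup_finRange r
  have heq : (List.ofFn fun s => refl (α s)) = (List.finRange r).map fun s => refl (α s) :=
    List.ofFn_eq_map
  rw [heq]
  generalize List.finRange r = L at hfin hnd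
  have perm_mem : ∀ {P P₁ P₂ P₃ : List (Fin r)} {t t' : Fin r},
      L = P₁ ++ t :: (P₂ ++ t' :: P₃) → P.Perm (P₁ ++ (P₂ ++ P₃)) →
      P.Nodup ∧ (∀ s, s ∈ P ↔ s ≠ t ∧ s ≠ t') := by
    intro P P₁ P₂ P₃ t t' hL hP
    have hperm : L.Perm (t :: t' :: P) := by
      rw [hL]
      refine List.perm_middle.trans (List.Perm.cons t ?_)
      rw [← List.append_assoc]
      refine List.perm_middle.trans (List.Perm.cons t' ?_)
      rw [List.append_assoc]
      exact hP.symm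
    have h1 := hperm.nodup hnd
    simp only [List.nodup_cons, List.mem_cons, not_or] at h1
    refine ⟨h1.2.2, fun s => ⟨fun hs => ⟨?_, ?_⟩, fun hs => ?_⟩⟩
    · rintro rfl; exact h1.1.2 hs
    · rintro rfl; exact h1.2.1 hs
    · have := hperm.subset (hfin s)
      simp only [List.mem_cons] at this
      tauto
  obtain ⟨P₁, L', hL⟩ := List.append_of_mem (hfin t)
  have ht'L := hfin t'
  rw [hL, List.mem_append, List.mem_cons] at ht'L
  rcases ht'L with h1 | h1 | h1
  -- Here t' precedes t in the word, and the two exchange roles.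
  · obtain ⟨P₀, P₂, hP⟩ := List.append_of_mem h1
    have hL' : L = P₀ ++ t' :: (P₂ ++ t :: L') := by rw [hL, hP]; simp
    obtain ⟨g, hg, P, hP, hgP⟩ := h.exists_conj_of_split (i := i) P₀ P₂ L' (hL' ▸ hnd)
      (fun s s' hs hs1 hs' hs1' => h.digon_left_unique htt' hij ht ht' hs1 hs hs1' hs')
      (fun s hs hs1 hsi => (h.commute_digon hij ht ht' hs1 hs hsi).symm) htcomm.symm
    obtain ⟨h2, h3⟩ := perm_mem hL' hP
    refine ⟨g, hg, P, h2, fun s => (h3 s).trans and_comm, ?_⟩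
    rw [hL', hgP, htcomm.eq]
  · exact absurd h1.symm htt'
  · obtain ⟨P₂, P₃, hP⟩ := List.append_of_mem h1
    have hL' : L = P₁ ++ t :: (P₂ ++ t' :: P₃) := by rw [hL, hP]
    obtain ⟨g, hg, P, hP, hgP⟩ := h.exists_conj_of_split (i := i) P₁ P₂ P₃ (hL' ▸ hnd)
      (fun s s' hs hs1 hs' hs1' => h.digon_left_unique htt' hij ht ht' hs hs1 hs' hs1')
      (fun s hs hs1 hsi => (h.commute_digon hij ht ht' hs hs1 hsi)) htcomm
    obtain ⟨h2, h3⟩ := perm_mem hL' hP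
    refine ⟨g, hg, P, h2, h3, ?_⟩
    rw [hL', hgP]

end ObtuseGenerators

/-! ### The cycles of a Coxeter element on the blocks -/

theorem IsSimpleSystem.obtuseGenerators {q : Fin n → ℕ} {U : Set ℕ} {d : Fin n → ℤˣ} {r : ℕ}
    {α : Fin r → E n} (h : IsSimpleSystem (G q U d) α)
    (hU : ∀ i, q i ∈ U → ∃ j, j ≠ i ∧ q j = q i) : ObtuseGenerators q U d α where
  linInd := h.1
  root t := (h.2.1 t).1
  obtuse _ _ hst := h.inner_nonpos hst
  gen := by rw [← h.2.2.2, map_G]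
  two_le := hU

namespace ObtuseGenerators

variable {q : Fin n → ℕ} {U : Set ℕ} {d : Fin n → ℤˣ} {r : ℕ} {α : Fin r → E n}
  (h : ObtuseGenerators q U d α)

include h

theorem prod_fixed {v : E n} (hv : (List.ofFn fun s => refl (α s)).prod v = v) :
    ∀ g ∈ GA q U d, g v = v := by
  apply h.fixed_of_inner_eq_zero
  intro t
  refine inner_eq_zero_of_prod_fixed h.linInd (List.finRange r) (List.nodup_finRange r) ?_ t
    (List.mem_finRange t)
  rwa [List.ofFn_eq_map] at hv

theorem prod_mem_GA : (List.ofFn fun s => refl (α s)).prod ∈ GA q U d := by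
  rw [List.ofFn_eq_map]; exact h.prod_mem _

/-- The vector with entries d_l on the cycle of i and zero elsewhere is fixed by the product of the
generators, hence by the whole group. So its entries, corrected by d, are constant on the block. -/
theorem sameCycle_of_balanced {σ : Equiv.Perm (Fin n)} {s : Fin n → ℤˣ}
    (hc : (List.ofFn fun s => refl (α s)).prod = sp σ s) {i j : Fin n} (hi : q i ∉ U)
    (hij : q i = q j) : σ.SameCycle i j := by
  classical
  have hgood : Good q U d σ s := by
    rw [← sp_mem_GA_iff, ← hc]; exact h.prod_mem_GA
  have hq : ∀ l, q (σ l) = q l := fun l => (hgood.1 l).1.symm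
  have hq' : ∀ l, σ.SameCycle i l → q l = q i := by
    rintro l ⟨m, rfl⟩
    have hn : ∀ (m : ℕ) (l : Fin n), q ((σ ^ m) l) = q l := by
      intro m
      induction m with
      | zero => intro l; rfl
      | succ m ih => intro l; rw [pow_succ, Equiv.Perm.mul_apply, ih, hq]
    cases m with
    | ofNat m => exact hn m i
    | negSucc m =>
      have := hn (m + 1) ((σ ^ Int.negSucc m) i)
      rw [← this, ← Equiv.Perm.mul_apply, zpow_negSucc, mul_inv_cancel]; rfl
  let v : E n := WithLp.toLp 2 fun l => if σ.SameCycle i l then ((d l : ℤ) : ℝ) else 0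
  have hv : ∀ l, v l = if σ.SameCycle i l then ((d l : ℤ) : ℝ) else 0 := fun l => rfl
  have hfix : (List.ofFn fun s => refl (α s)).prod v = v := by
    rw [hc]
    ext l
    obtain ⟨l, rfl⟩ := σ.surjective l
    rw [sp_coord, hv, hv]
    simp only [Equiv.Perm.sameCycle_apply_right]
    split_ifs with hl
    · have h1 := (hgood.1 l).2.resolve_left (by rw [hq' l hl]; exact hi)
      rw [one_mul] at h1
      rw [h1]
      push_cast
      rw [← mul_assoc, units_cast_mul_self, one_mul]
    · rw [mul_zero]
  have h2 := fixed_balanced (h.prod_fixed hfix) hij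
  by_contra hne
  rw [hv, hv, if_pos (Equiv.Perm.SameCycle.refl σ i), if_neg hne, units_cast_mul_self] at h2
  norm_num at h2

variable {t t' : Fin r} {a b : ℤˣ} {i j : Fin n}

/-- Coordinate j is folded onto i. The digon roots then have one-point support, no other generator
involves j, and orthogonality to any other generator makes the two entries of v on its support
vanish together. So nonvanishing propagates through the block. -/
theorem ne_zero_iff_of_digon (hij : i ≠ j)
    (ht : α t = sv a i - sv b j) (ht' : α t' = sv a i - sv (-b) j) {v : E n}
    (hv : ∀ s, s ≠ t → s ≠ t' → inner ℝ (α s) v = (0 : ℝ)) {k l : Fin n} (hk : k ≠ j) (hl : l ≠ j)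
    (hkl : q k = q l) : v k ≠ 0 ↔ v l ≠ 0 := by
  classical
  have key := h.iff_of_block_eq (p := fun m => v (if m = j then i else m) ≠ 0) ?_ hkl
  · simpa only [if_neg hk, if_neg hl] using key
  · intro s m m' hm hm'
    have hdig : ∀ c : ℤˣ, ∀ m, (sv a i - sv c j) m ≠ 0 → (if m = j then i else m) = i := by
      intro c m hm
      by_cases hmj : m = j
      · rw [if_pos hmj]
      · rw [if_neg hmj]
        by_contra hmi
        exact hm (root_apply_of_ne hmi hmj)
    by_cases hst : s = t
    · rw [hst, ht] at hm hm'
      simp only [hdig b m hm, hdig b m' hm']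
    · by_cases hst' : s = t'
      · rw [hst', ht'] at hm hm'
        simp only [hdig _ m hm, hdig _ m' hm']
      · have hsj := h.digon_right hij ht ht' hst hst'
        have hmj : m ≠ j := by rintro rfl; exact hm hsj
        have hmj' : m' ≠ j := by rintro rfl; exact hm' hsj
        simp only [if_neg hmj, if_neg hmj']
        obtain ⟨c, c', k', hmk, hs⟩ := root_form' (h.root s) hm
        by_cases hmm : m' = m
        · rw [hmm]
        · have hmk' : m' = k' := by
            by_contra hne
            rw [hs, root_apply_of_ne hmm hne] at hm'
            exact hm' rfl
          have h1 := hv s hst hst'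
          rw [hs, inner_root, ← hmk'] at h1
          constructor
          · intro h2 h3
            rw [h3, mul_zero, sub_zero] at h1
            exact (mul_ne_zero (units_cast_ne_zero c) h2) h1
          · intro h2 h3
            rw [h3, mul_zero, zero_sub, neg_eq_zero] at h1
            exact (mul_ne_zero (units_cast_ne_zero c') h2) h1

/-- A block of size k carries at most k generators. Omitting coordinate j and the two digon roots
leaves k - 1 unknowns and at most k - 2 equations; a nonzero solution vanishes nowhere on the block
outside j, by `ne_zero_iff_of_digon`. -/
theorem exists_vector_of_digon (htt' : t ≠ t') (hij : i ≠ j)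
    (ht : α t = sv a i - sv b j) (ht' : α t' = sv a i - sv (-b) j) (hqij : q j = q i) :
    ∃ v : E n, (∀ s, s ≠ t → s ≠ t' → inner ℝ (α s) v = (0 : ℝ)) ∧
      ∀ k, q k = q i → k ≠ j → v k ≠ 0 := by
  classical
  have hcard := h.card_le_block (q i)
  have hti : ∃ m, q m = q i ∧ α t m ≠ 0 :=
    ⟨i, rfl, by rw [ht, root_apply_left hij]; exact units_cast_ne_zero a⟩
  have hti' : ∃ m, q m = q i ∧ α t' m ≠ 0 :=
    ⟨i, rfl, by rw [ht', root_apply_left hij]; exact units_cast_ne_zero a⟩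
  have hlt : Nat.card {s : Fin r // (∃ m, q m = q i ∧ α s m ≠ 0) ∧ s ≠ t ∧ s ≠ t'} <
      Nat.card {k // q k = q i ∧ k ≠ j} := by
    rw [Nat.card_eq_fintype_card, Nat.card_eq_fintype_card, Fintype.card_subtype,
      Fintype.card_subtype] at hcard ⊢
    have h1 : ({k | q k = q i ∧ k ≠ j} : Finset (Fin n)) = Finset.erase {k | q k = q i} j := by
      ext k; simp [and_comm]
    have h2 : ({s | (∃ m, q m = q i ∧ α s m ≠ 0) ∧ s ≠ t ∧ s ≠ t'} : Finset (Fin r)) =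
        (Finset.erase {s | ∃ m, q m = q i ∧ α s m ≠ 0} t).erase t' := by
      ext s
      simp only [Finset.mem_filter, Finset.mem_univ, true_and, Finset.mem_erase]
      tauto
    have m1 : t' ∈ Finset.erase ({s | ∃ m, q m = q i ∧ α s m ≠ 0} : Finset (Fin r)) t := by
      rw [Finset.mem_erase]
      exact ⟨htt'.symm, by simpa using hti'⟩
    have m2 : t ∈ ({s | ∃ m, q m = q i ∧ α s m ≠ 0} : Finset (Fin r)) := by simpa using hti
    have m3 : j ∈ ({k | q k = q i} : Finset (Fin n)) := by simpa using hqij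
    have c1 := Finset.card_erase_add_one m1
    have c2 := Finset.card_erase_add_one m2
    have c3 := Finset.card_erase_add_one m3
    rw [h1, h2]
    omega
  obtain ⟨v, hv0, hv1, hv2⟩ := exists_orthogonal (α := α) hlt
  have hv3 : ∀ s, s ≠ t → s ≠ t' → inner ℝ (α s) v = (0 : ℝ) := by
    intro s hs hs'
    by_cases hsi : ∃ m, q m = q i ∧ α s m ≠ 0
    · exact hv2 s ⟨hsi, hs, hs'⟩
    · push Not at hsi
      rw [inner_eq_sum]
      refine Finset.sum_eq_zero fun m _ => ?_
      by_cases hm : q m = q i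
      · rw [hsi m hm, zero_mul]
      · rw [hv1 m (fun hm' => hm hm'.1), mul_zero]
  refine ⟨v, hv3, fun k hk hkj => ?_⟩
  obtain ⟨m, hm⟩ : ∃ m, v m ≠ 0 := by
    by_contra! hcon
    exact hv0 (by ext m; exact hcon m)
  have hm' : q m = q i ∧ m ≠ j := by
    by_contra hne
    exact hm (hv1 m hne)
  exact (h.ne_zero_iff_of_digon hij ht ht' hv3 hm'.2 hkj (hm'.1.trans hk.symm)).1 hm

/-- Up to conjugation the product is u ρ, where ρ is the product of the digon reflections and u that
of the other generators. No factor of u involves j, so u fixes e_j and u ρ negates it. On the rest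
of the block u is transitive up to sign, by the argument for balanced blocks with the vector of
`exists_vector_of_digon` in place of d. Since ρ changes only signs, u ρ has the same underlying
permutation. -/
theorem exists_cycles_of_unbalanced {σ : Equiv.Perm (Fin n)} {s : Fin n → ℤˣ}
    (hc : (List.ofFn fun s => refl (α s)).prod = sp σ s) {i₀ : Fin n} (hU : q i₀ ∈ U) :
    ∃ x, q x = q i₀ ∧ σ x = x ∧ s x = -1 ∧
      ∀ k l, q k = q i₀ → q l = q i₀ → k ≠ x → l ≠ x → σ.SameCycle k l := by
  classical
  obtain ⟨t, t', a, b, i, j, htt', hij, hqi, ht, ht'⟩ := h.exists_digon hU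
  have hqj : q j = q i := by
    apply h.block_eq t
    · rw [ht, root_apply_right hij]; exact neg_ne_zero.2 (units_cast_ne_zero b)
    · rw [ht, root_apply_left hij]; exact units_cast_ne_zero a
  obtain ⟨g, hg, P, hPnd, hP, hgP⟩ := h.exists_conj htt' hij ht ht'
  obtain ⟨τ, w, rfl, hgood⟩ := exists_good_of_mem hg
  have hPgood := h.prod_mem P
  obtain ⟨π, z, hu, -⟩ := exists_good_of_mem hPgood
  have hρ : refl (α t) * refl (α t') = sp 1 (fun m => if m = i ∨ m = j then -1 else 1) := by
    rw [ht, ht', refl_root hij, refl_root hij, sp_mul, Equiv.swap_mul_self]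
    congr 1
    funext m
    simp only [rootSign]
    by_cases hmi : m = i
    · subst hmi
      rw [Equiv.swap_apply_left]
      simp only [true_or, or_true, if_true]
      rw [mul_neg, neg_mul, Int.units_mul_self]
    · by_cases hmj : m = j
      · subst hmj
        rw [Equiv.swap_apply_right]
        simp only [true_or, or_true, if_true]
        rw [mul_neg, neg_mul, Int.units_mul_self]
      · rw [Equiv.swap_apply_of_ne_of_ne hmi hmj]
        simp [hmi, hmj]
  have hinv := sp_inv τ w
  rw [hc, hu, hρ, hinv, sp_mul, sp_mul, sp_mul, mul_one] at hgP
  have hπ : τ * σ * τ⁻¹ = π := (sp_inj hgP).1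
  have hPj : (P.map fun s => refl (α s)).prod (e j) = e j := by
    have : ∀ L : List (Fin r), (∀ s ∈ L, α s j = 0) →
        (L.map fun s => refl (α s)).prod (e j) = e j := by
      intro L hL
      induction L with
      | nil => rfl
      | cons s L ih =>
        rw [List.map_cons, List.prod_cons, mul_apply,
          ih fun s hs => hL s (List.mem_cons_of_mem _ hs),
          refl_apply_eq_self_iff (h.linInd.ne_zero s), real_inner_comm, ← sv_one, inner_sv,
          hL s (List.mem_cons_self ..), mul_zero]
    exact this P fun s hs => h.digon_right hij ht ht' ((hP s).1 hs).1 ((hP s).1 hs).2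
  rw [hu, sp_e, ← sv_one, sv_inj] at hPj
  have hτq : ∀ m, q (τ m) = q m := fun m => (hgood.1 m).1.symm
  have hτq' : ∀ m, q (τ⁻¹ m) = q m := fun m => by
    rw [← hτq (τ⁻¹ m)]; exact congrArg q (τ.apply_symm_apply m)
  have hττ : ∀ m, τ (τ⁻¹ m) = m := τ.apply_symm_apply
  have hστ : σ (τ⁻¹ j) = τ⁻¹ j := by
    apply τ.injective
    have := congrArg (fun f : Equiv.Perm (Fin n) => f j) hπ
    simp only [Equiv.Perm.mul_apply] at this
    rw [this, hPj.2, hττ]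
  -- The fixed axis of the conjugate is that of e_j, so the original element has the axis of index
  -- τ⁻¹ j.
  refine ⟨τ⁻¹ j, ?_, ?_, ?_, ?_⟩
  · rw [hτq', hqj, hqi]
  · exact hστ
  · have := congrFun (sp_inj hgP).2 j
    simp only [hPj.1, or_true, if_true, Equiv.Perm.one_apply, hστ] at this
    rw [mul_one] at this
    rw [← this]
    rw [mul_comm (s _), ← mul_assoc, Int.units_mul_self, one_mul]
  · obtain ⟨v₀, hv₀, hv₀'⟩ := h.exists_vector_of_digon htt' hij ht ht' hqj
    have key : ∀ k l, q k = q i → q l = q i → k ≠ j → l ≠ j → π.SameCycle k l := by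
      intro k l hk hl hkj hlj
      by_contra hne
      -- Restricting a fixed vector of u to one cycle of π gives a fixed vector again, which is then
      -- orthogonal to every factor of u and must be nonzero on all of the block outside j or on
      -- none of it.
      let v : E n := WithLp.toLp 2 fun m => if π.SameCycle k m then v₀ m else 0
      have hv : ∀ m, v m = if π.SameCycle k m then v₀ m else 0 := fun m => rfl
      have hfix0 : (P.map fun s => refl (α s)).prod v₀ = v₀ := by
        have : ∀ L : List (Fin r), (∀ s ∈ L, inner ℝ (α s) v₀ = (0 : ℝ)) →
            (L.map fun s => refl (α s)).prod v₀ = v₀ := by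
          intro L hL
          induction L with
          | nil => rfl
          | cons s L ih =>
            rw [List.map_cons, List.prod_cons, mul_apply,
              ih fun s hs => hL s (List.mem_cons_of_mem _ hs),
              refl_apply_eq_self_iff (h.linInd.ne_zero s)]
            exact hL s (List.mem_cons_self ..)
        exact this P fun s hs => hv₀ s ((hP s).1 hs).1 ((hP s).1 hs).2
      have hfix : (P.map fun s => refl (α s)).prod v = v := by
        rw [hu] at hfix0 ⊢
        ext m
        obtain ⟨m, rfl⟩ := π.surjective m
        have h1 := congrArg (fun x : E n => x (π m)) hfix0
        simp only [sp_coord] at h1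
        rw [sp_coord, hv, hv]
        simp only [Equiv.Perm.sameCycle_apply_right]
        split_ifs
        · exact h1
        · rw [mul_zero]
      have horth := inner_eq_zero_of_prod_fixed h.linInd P hPnd hfix
      have h2 := h.ne_zero_iff_of_digon hij ht ht'
        (fun s hs hs' => horth s ((hP s).2 ⟨hs, hs'⟩)) hkj hlj (hk.trans hl.symm)
      rw [hv, hv, if_pos (Equiv.Perm.SameCycle.refl π k), if_neg hne] at h2
      exact h2.1 (hv₀' k hk hkj) rfl
    intro k l hk hl hkx hlx
    have h3 := key (τ k) (τ l) ((hτq k).trans (hk.trans hqi.symm))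
      ((hτq l).trans (hl.trans hqi.symm)) (fun hh => hkx (by rw [← hh]; simp))
      (fun hh => hlx (by rw [← hh]; simp))
    rw [← hπ, Equiv.Perm.sameCycle_conj] at h3
    simpa using h3

end ObtuseGenerators

/-! ### Bijections obtained from equal multisets of sizes -/

open Classical in
theorem card_fiber_eq_count {A γ : Type*} (S : Finset A) (p : A → Prop) [DecidablePred p]
    (f : A → γ) (c : γ) (P : Prop) :
    Nat.card {x : S // (f x, p x) = (c, P)} =
      if P then ((S.filter p).val.map f).count c
        else ((S.filter fun x => ¬p x).val.map f).count c := by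
  rw [Nat.card_eq_fintype_card, Fintype.card_subtype, Multiset.count_map, Multiset.count_map,
    ← Finset.card_map (Function.Embedding.subtype _)]
  by_cases hP : P
  · rw [if_pos hP]
    change _ = ((S.filter p).filter fun x => c = f x).card
    congr 1
    ext x
    simp only [Finset.mem_map, Finset.mem_filter, Finset.mem_univ, true_and, Prod.mk.injEq,
      Function.Embedding.subtype_apply, Subtype.exists, exists_and_right, exists_eq_right,
      eq_iff_iff, iff_true, hP]
    tauto
  · rw [if_neg hP]
    change _ = ((S.filter fun x => ¬p x).filter fun x => c = f x).card
    congr 1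
    ext x
    simp only [Finset.mem_map, Finset.mem_filter, Finset.mem_univ, true_and, Prod.mk.injEq,
      Function.Embedding.subtype_apply, Subtype.exists, exists_and_right, exists_eq_right,
      eq_iff_iff, iff_false, hP]
    tauto

/-- Equal multiplicities make the fibres over each pair of a size and a truth value equinumerous.
This matches cycles of equal length and sign, and blocks of equal size and kind. -/
theorem exists_equiv_of_map_filter_eq {A B γ : Type*} (S : Finset A) (T : Finset B)
    (p : A → Prop) (p' : B → Prop) [DecidablePred p] [DecidablePred p'] (f : A → γ) (g : B → γ)
    (h1 : (S.filter p).val.map f = (T.filter p').val.map g)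
    (h2 : (S.filter fun x => ¬p x).val.map f = (T.filter fun x => ¬p' x).val.map g) :
    ∃ φ : S ≃ T, ∀ x, g (φ x) = f x ∧ (p' (φ x) ↔ p x) := by
  classical
  have he : ∀ c : γ × Prop, Nonempty ({x : S // (f x, p x) = c} ≃ {x : T // (g x, p' x) = c}) := by
    rintro ⟨c, P⟩
    rw [← Fintype.card_eq, ← Nat.card_eq_fintype_card, ← Nat.card_eq_fintype_card,
      card_fiber_eq_count, card_fiber_eq_count, h1, h2]
  refine ⟨Equiv.ofFiberEquiv (f := fun x : S => (f x, p x)) (g := fun x : T => (g x, p' x))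
    fun c => (he c).some, fun x => ?_⟩
  have := Equiv.ofFiberEquiv_map (f := fun x : S => (f x, p x)) (g := fun x : T => (g x, p' x))
    (fun c => (he c).some) x
  simp only [Prod.mk.injEq, eq_iff_iff] at this
  exact this

/-! ### Cycles -/

open Classical in
/-- The cycle of `σ` through `i`. -/
def cyc (σ : Equiv.Perm (Fin n)) (i : Fin n) : Finset (Fin n) := {j | σ.SameCycle i j}

@[simp] theorem mem_cyc {σ : Equiv.Perm (Fin n)} {i j : Fin n} :
    j ∈ cyc σ i ↔ σ.SameCycle i j := by simp [cyc]

theorem mem_cycles {σ : Equiv.Perm (Fin n)} {C : Finset (Fin n)} :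
    C ∈ cycles σ ↔ ∃ i, cyc σ i = C := by
  simp [cycles, cyc]

theorem self_mem_cyc (σ : Equiv.Perm (Fin n)) (i : Fin n) : i ∈ cyc σ i :=
  mem_cyc.2 (Equiv.Perm.SameCycle.refl σ i)

theorem cyc_eq_iff {σ : Equiv.Perm (Fin n)} {i j : Fin n} :
    cyc σ i = cyc σ j ↔ σ.SameCycle i j := by
  constructor
  · intro h
    rw [← mem_cyc, h]
    exact self_mem_cyc σ j
  · intro h
    ext k
    rw [mem_cyc, mem_cyc]
    exact ⟨h.symm.trans, h.trans⟩

theorem isCycleOn_cyc (σ : Equiv.Perm (Fin n)) (i : Fin n) :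
    σ.IsCycleOn (cyc σ i : Set (Fin n)) := by
  constructor
  · refine ⟨fun j hj => ?_, σ.injective.injOn, fun j hj => ?_⟩
    · rw [Finset.mem_coe, mem_cyc] at hj ⊢
      exact Equiv.Perm.sameCycle_apply_right.2 hj
    · refine ⟨σ⁻¹ j, ?_, σ.apply_symm_apply j⟩
      rw [Finset.mem_coe, mem_cyc] at hj ⊢
      exact hj.trans ⟨-1, by simp⟩
  · intro j hj k hk
    rw [Finset.mem_coe, mem_cyc] at hj hk
    exact hj.symm.trans hk

theorem sp_pow_apply (σ : Equiv.Perm (Fin n)) (s : Fin n → ℤˣ) (m : ℕ) (i : Fin n) :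
    ((sp σ s) ^ m) (e i) = sv (∏ l ∈ Finset.range m, s ((σ ^ l) i)) ((σ ^ m) i) := by
  induction m with
  | zero => simp
  | succ m ih =>
    rw [pow_succ', mul_apply, ih, sp_sv, Finset.prod_range_succ, pow_succ']
    rfl

theorem prod_cyc (σ : Equiv.Perm (Fin n)) (s : Fin n → ℤˣ) (i : Fin n) :
    ∏ l ∈ Finset.range (cyc σ i).card, s ((σ ^ l) i) = ∏ j ∈ cyc σ i, s j := by
  have hc := isCycleOn_cyc σ i
  refine Finset.prod_nbij (fun l => (σ ^ l) i) ?_ ?_ ?_ (fun _ _ => rfl)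
  · intro l _
    rw [mem_cyc]
    exact ⟨l, rfl⟩
  · intro l hl l' hl' h
    simp only [Finset.coe_range, Set.mem_Iio] at hl hl'
    have := (hc.pow_apply_eq_pow_apply (self_mem_cyc σ i)).1 h
    rwa [Nat.ModEq, Nat.mod_eq_of_lt hl, Nat.mod_eq_of_lt hl'] at this
  · intro j hj
    obtain ⟨l, hl, h⟩ := hc.exists_pow_eq (self_mem_cyc σ i) hj
    exact ⟨l, by simpa using hl, h⟩

theorem sp_pow_card (σ : Equiv.Perm (Fin n)) (s : Fin n → ℤˣ) (i : Fin n) :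
    ((sp σ s) ^ (cyc σ i).card) (e i) = sv (∏ j ∈ cyc σ i, s j) i := by
  rw [sp_pow_apply, prod_cyc, (isCycleOn_cyc σ i).pow_card_apply (self_mem_cyc σ i)]

theorem exists_sp_zpow (σ : Equiv.Perm (Fin n)) (s : Fin n → ℤˣ) (m : ℤ) :
    ∃ t, (sp σ s) ^ m = sp (σ ^ m) t := by
  have hn : ∀ m : ℕ, ∃ t, (sp σ s) ^ m = sp (σ ^ m) t := by
    intro m
    induction m with
    | zero => exact ⟨fun _ => 1, by rw [pow_zero, pow_zero, sp_one]⟩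
    | succ m ih =>
      obtain ⟨t, ht⟩ := ih
      exact ⟨_, by rw [pow_succ, ht, sp_mul, pow_succ]⟩
  cases m with
  | ofNat m =>
    obtain ⟨t, ht⟩ := hn m
    exact ⟨t, by simpa using ht⟩
  | negSucc m =>
    obtain ⟨t, ht⟩ := hn (m + 1)
    exact ⟨_, by rw [zpow_negSucc, ht, sp_inv, zpow_negSucc]⟩

theorem sp_zpow_card (σ : Equiv.Perm (Fin n)) (s : Fin n → ℤˣ) (i : Fin n) (k : ℤ) :
    ((sp σ s) ^ ((cyc σ i).card * k : ℤ)) (e i) = sv ((∏ j ∈ cyc σ i, s j) ^ k) i := by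
  rw [zpow_mul, zpow_natCast]
  set g := (sp σ s) ^ (cyc σ i).card
  set c := ∏ j ∈ cyc σ i, s j
  have hg : ∀ a, g (sv a i) = sv (a * c) i := by
    intro a
    rcases Int.units_eq_one_or a with rfl | rfl
    · rw [sv_one, sp_pow_card, one_mul]
    · rw [sv_neg, sv_one, map_neg, sp_pow_card, ← sv_neg, neg_one_mul]
  have hn : ∀ m : ℕ, (g ^ m) (e i) = sv (c ^ m) i := by
    intro m
    induction m with
    | zero => simp
    | succ m ih => rw [pow_succ', mul_apply, ih, hg, pow_succ]
  cases k with
  | ofNat k => simpa using hn k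
  | negSucc k =>
    rw [zpow_negSucc, zpow_negSucc, units_int_inv]
    have h1 := hn (k + 1)
    have h2 := inv_apply_apply (g ^ (k + 1)) (e i)
    rw [h1] at h2
    rcases Int.units_eq_one_or (c ^ (k + 1)) with h3 | h3
    · rw [h3, sv_one] at h2 ⊢; exact h2
    · rw [h3, sv_neg, sv_one] at h2 ⊢
      rw [map_neg] at h2
      rw [← h2, neg_neg, h2]

/-! ### Cycle types -/

open Classical in
/-- The lengths of the positive cycles. -/
def posType (σ : Equiv.Perm (Fin n)) (s : Fin n → ℤˣ) : Multiset ℕ :=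
  ((cycles σ).filter fun C => ∏ i ∈ C, s i = 1).val.map Finset.card

open Classical in
/-- The lengths of the negative cycles. -/
def negType (σ : Equiv.Perm (Fin n)) (s : Fin n → ℤˣ) : Multiset ℕ :=
  ((cycles σ).filter fun C => ¬∏ i ∈ C, s i = 1).val.map Finset.card

theorem prod_eq_one_iff_even (s : Fin n → ℤˣ) (C N : Finset (Fin n))
    (h : ∀ i, i ∈ N ↔ s i = -1) : ∏ i ∈ C, s i = 1 ↔ Even (C ∩ N).card := by
  have h1 : ∏ i ∈ C, s i = ∏ i ∈ C, if i ∈ N then -1 else 1 := by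
    refine Finset.prod_congr rfl fun i _ => ?_
    split_ifs with hi
    · exact (h i).1 hi
    · exact (Int.units_eq_one_or _).resolve_right fun h' => hi ((h i).2 h')
  rw [h1, Finset.prod_ite_mem, Finset.prod_const]
  exact neg_one_pow_eq_one_iff_even (by decide)

theorem hasCycleType_sp_iff {σ : Equiv.Perm (Fin n)} {s : Fin n → ℤˣ} {μ₁ μ₂ : Multiset ℕ} :
    HasCycleType (sp σ s) μ₁ μ₂ ↔ μ₁ = posType σ s ∧ μ₂ = negType σ s := by
  classical
  have key : ∀ N : Finset (Fin n), (∀ i, i ∈ N ↔ s i = -1) →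
      ((cycles σ).filter fun C => Even (C ∩ N).card).val.map Finset.card = posType σ s ∧
      ((cycles σ).filter fun C => ¬Even (C ∩ N).card).val.map Finset.card = negType σ s := by
    intro N hN
    constructor
    · rw [posType]
      congr 2
      exact Finset.filter_congr fun C _ => (prod_eq_one_iff_even s C N hN).symm
    · rw [negType]
      congr 2
      exact Finset.filter_congr fun C _ => not_congr (prod_eq_one_iff_even s C N hN).symm
  constructor
  · rintro ⟨σ', N, h1, rfl, rfl⟩
    have h2 : sp σ s = sp σ' (fun i => if i ∈ N then -1 else 1) := by
      rw [eq_sp_iff]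
      intro i
      rw [h1]
      split_ifs
      · rw [sv_neg, sv_one]
      · rw [sv_one]
    obtain ⟨rfl, rfl⟩ := sp_inj h2
    exact key N fun i => by
      by_cases hi : i ∈ N <;> simp [hi]
  · rintro ⟨rfl, rfl⟩
    refine ⟨σ, Finset.univ.filter fun i => s i = -1, fun i => ?_, ?_, ?_⟩
    · rw [sp_e]
      rcases Int.units_eq_one_or (s i) with h | h
      · rw [h, sv_one, if_neg]
        simp [h]
      · rw [h, sv_neg, sv_one, if_pos]
        simp [h]
    · exact (key _ (by simp)).1.symm
    · exact (key _ (by simp)).2.symm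

theorem intertwine_iff {σ σ' τ : Equiv.Perm (Fin n)} {s s' t : Fin n → ℤˣ} :
    sp τ t * sp σ s = sp σ' s' * sp τ t ↔
      ∀ i, τ (σ i) = σ' (τ i) ∧ s i * t (σ i) = t i * s' (τ i) := by
  rw [sp_mul, sp_mul]
  constructor
  · intro h i
    obtain ⟨h1, h2⟩ := sp_inj h
    exact ⟨congrArg (fun f : Equiv.Perm (Fin n) => f i) h1, congrFun h2 i⟩
  · intro h
    congr 1
    · exact Equiv.ext fun i => (h i).1
    · exact funext fun i => (h i).2

/-- Cycles are carried to cycles by τ, and the signs of the conjugating element enter the product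
over a cycle through t (σ i) t i, which cancels around the cycle. -/
theorem types_eq_of_intertwine {σ σ' τ : Equiv.Perm (Fin n)} {s s' t : Fin n → ℤˣ}
    (h : sp τ t * sp σ s = sp σ' s' * sp τ t) :
    posType σ s = posType σ' s' ∧ negType σ s = negType σ' s' := by
  classical
  rw [intertwine_iff] at h
  have hσ : σ' = τ * σ * τ⁻¹ := by
    rw [eq_mul_inv_iff_mul_eq]
    exact Equiv.ext fun i => (h i).1.symm
  have hcyc : ∀ i, (cyc σ i).map τ.toEmbedding = cyc σ' (τ i) := by
    intro i
    ext j
    obtain ⟨j, rfl⟩ := τ.surjective j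
    rw [mem_cyc, hσ, Equiv.Perm.sameCycle_conj]
    simp
  have hcycles : cycles σ' = (cycles σ).map (Finset.mapEmbedding τ.toEmbedding).toEmbedding := by
    ext C
    rw [mem_cycles, Finset.mem_map]
    constructor
    · rintro ⟨i, rfl⟩
      obtain ⟨i, rfl⟩ := τ.surjective i
      exact ⟨cyc σ i, mem_cycles.2 ⟨i, rfl⟩, hcyc i⟩
    · rintro ⟨C, hC, rfl⟩
      obtain ⟨i, rfl⟩ := mem_cycles.1 hC
      exact ⟨τ i, (hcyc i).symm⟩
  have hprod : ∀ C ∈ cycles σ, ∏ i ∈ C.map τ.toEmbedding, s' i = ∏ i ∈ C, s i := by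
    intro C hC
    obtain ⟨i₀, rfl⟩ := mem_cycles.1 hC
    rw [Finset.prod_map]
    have h1 : ∀ i, s' (τ i) = s i * (t (σ i) * t i) := by
      intro i
      have := (h i).2
      rw [← mul_assoc, this, mul_comm (t i), mul_assoc, Int.units_mul_self, mul_one]
    simp only [Equiv.coe_toEmbedding, h1, Finset.prod_mul_distrib]
    have h2 : ∏ i ∈ cyc σ i₀, t (σ i) = ∏ i ∈ cyc σ i₀, t i := by
      refine Finset.prod_equiv σ (fun i => ?_) (fun i _ => rfl)
      rw [mem_cyc, mem_cyc, Equiv.Perm.sameCycle_apply_right]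
    rw [h2, Int.units_mul_self, mul_one]
  constructor
  · rw [posType, posType, hcycles, Finset.filter_map, Finset.map_val, Multiset.map_map]
    refine (Multiset.map_congr ?_ fun C _ => ?_)
    · congr 1
      exact Finset.filter_congr fun C hC => by
        change _ ↔ ∏ i ∈ C.map τ.toEmbedding, s' i = 1
        rw [hprod C hC]
    · exact (Finset.card_map _).symm
  · rw [negType, negType, hcycles, Finset.filter_map, Finset.map_val, Multiset.map_map]
    refine (Multiset.map_congr ?_ fun C _ => ?_)
    · congr 1
      exact Finset.filter_congr fun C hC => by
        change _ ↔ ¬∏ i ∈ C.map τ.toEmbedding, s' i = 1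
        rw [hprod C hC]
    · exact (Finset.card_map _).symm

/-- Cycles of equal length and sign are matched and given base points b and b'. The intertwiner
sends w^m e_b to w'^m e_b'; length and sign of a cycle decide which powers bring its base vector
back, and with which sign, so this is well defined. -/
theorem exists_intertwine_of_types_eq {σ σ' : Equiv.Perm (Fin n)} {s s' : Fin n → ℤˣ}
    (hpos : posType σ s = posType σ' s') (hneg : negType σ s = negType σ' s') :
    ∃ τ t, sp τ t * sp σ s = sp σ' s' * sp τ t := by
  classical
  obtain ⟨φ, hφ⟩ := exists_equiv_of_map_filter_eq (cycles σ) (cycles σ')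
    (fun C => ∏ i ∈ C, s i = 1) (fun C => ∏ i ∈ C, s' i = 1) Finset.card Finset.card hpos hneg
  have hne : ∀ {σ : Equiv.Perm (Fin n)} (C : cycles σ), ∃ i, cyc σ i = C.1 := fun C =>
    mem_cycles.1 C.2
  let κ : Fin n → cycles σ := fun i => ⟨cyc σ i, mem_cycles.2 ⟨i, rfl⟩⟩
  choose b hb using hne (σ := σ)
  choose b' hb' using hne (σ := σ')
  have hκb : ∀ i, σ.SameCycle (b (κ i)) i := fun i => cyc_eq_iff.1 (hb (κ i))
  have hφcard : ∀ C, (cyc σ' (b' (φ C))).card = (cyc σ (b C)).card := by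
    intro C; rw [hb, hb']; exact (hφ C).1
  have hφsgn : ∀ C, ∏ j ∈ cyc σ' (b' (φ C)), s' j = ∏ j ∈ cyc σ (b C), s j := by
    intro C
    rw [hb, hb']
    have := (hφ C).2
    rcases Int.units_eq_one_or (∏ j ∈ C.1, s j) with h1 | h1
    · rw [h1]; exact this.2 h1
    · rw [h1]
      refine (Int.units_eq_one_or _).resolve_left fun h2 => ?_
      rw [this.1 h2] at h1
      exact absurd h1 (by decide)
  have hdvd : ∀ {σ : Equiv.Perm (Fin n)} (i : Fin n) (m : ℤ),
      (σ ^ m) i = i ↔ ((cyc σ i).card : ℤ) ∣ m :=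
    fun {σ} i m => (isCycleOn_cyc σ i).zpow_apply_eq (self_mem_cyc σ i)
  have claim : ∀ (C : cycles σ) (m : ℤ) (a : ℤˣ), ((sp σ s) ^ m) (e (b C)) = sv a (b C) →
      ((sp σ' s') ^ m) (e (b' (φ C))) = sv a (b' (φ C)) := by
    intro C m a hm
    obtain ⟨t, ht⟩ := exists_sp_zpow σ s m
    have h1 := hm
    rw [ht, sp_e, sv_inj] at h1
    obtain ⟨k, rfl⟩ := (hdvd _ _).1 h1.2
    rw [sp_zpow_card, sv_inj] at hm
    rw [← hφcard, sp_zpow_card, hφsgn, hm.1]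
  choose m hm using hκb
  have hε : ∀ i, ∃ ε, ((sp σ s) ^ (m i)) (e (b (κ i))) = sv ε i := fun i => by
    obtain ⟨t, ht⟩ := exists_sp_zpow σ s (m i)
    exact ⟨_, by rw [ht, sp_e, hm]⟩
  choose ε hε using hε
  have hc : ∀ i, ∃ c, ((sp σ' s') ^ (m i)) (e (b' (φ (κ i)))) = sv c ((σ' ^ m i) (b' (φ (κ i)))) :=
    fun i => by
      obtain ⟨t, ht⟩ := exists_sp_zpow σ' s' (m i)
      exact ⟨_, by rw [ht, sp_e]⟩
  choose c hc using hc
  let T : Fin n → Fin n := fun i => (σ' ^ m i) (b' (φ (κ i)))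
  have sv_smul : ∀ (g : E n ≃ₗᵢ[ℝ] E n) (a x y : ℤˣ) (i j : Fin n), g (sv x i) = sv y j →
      g (sv (a * x) i) = sv (a * y) j := by
    intro g a x y i j hg
    rcases Int.units_eq_one_or a with rfl | rfl
    · simpa using hg
    · rw [neg_one_mul, neg_one_mul, sv_neg, sv_neg, map_neg, hg]
  -- The prescription does not depend on the exponent by which a vector is reached from the base
  -- vector: two exponents differ by one that returns the base vector up to sign, where `claim`
  -- applies.
  have star : ∀ (k : ℤ) (i : Fin n) (a : ℤˣ), ((sp σ s) ^ k) (e (b (κ i))) = sv a i →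
      ((sp σ' s') ^ k) (e (b' (φ (κ i)))) = sv (a * (ε i * c i)) (T i) := by
    intro k i a hk
    have h1 : ((sp σ s) ^ (-m i + k)) (e (b (κ i))) = sv (a * ε i) (b (κ i)) := by
      rw [zpow_add, mul_apply, hk]
      have h2 : ((sp σ s) ^ (-m i)) (sv (ε i) i) = sv 1 (b (κ i)) := by
        rw [← hε, zpow_neg, inv_apply_apply, sv_one]
      have h3 := sv_smul _ (a * ε i) _ _ _ _ h2
      rwa [mul_assoc, Int.units_mul_self, mul_one, mul_one] at h3
    have h2 := claim _ _ _ h1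
    have h3 : k = m i + (-m i + k) := by ring
    rw [h3, zpow_add, mul_apply, h2]
    have h4 := hc i
    rw [← sv_one] at h4
    have h5 := sv_smul _ (a * ε i) _ _ _ _ h4
    rwa [mul_one, mul_assoc] at h5
  have hTinj : Function.Injective T := by
    intro i j hij
    have h1 : ∀ i, cyc σ' (T i) = (φ (κ i)).1 := fun i => by
      rw [← hb' (φ (κ i)), cyc_eq_iff]
      exact Equiv.Perm.SameCycle.symm ⟨m i, rfl⟩
    have h2 : κ i = κ j := by
      apply φ.injective
      apply Subtype.ext
      rw [← h1, ← h1, hij]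
    have hij' : (σ' ^ m i) (b' (φ (κ i))) = (σ' ^ m j) (b' (φ (κ j))) := hij
    rw [h2] at hij'
    have h3 : (σ' ^ (-m j + m i)) (b' (φ (κ j))) = b' (φ (κ j)) := by
      rw [zpow_add, Equiv.Perm.mul_apply, hij', ← Equiv.Perm.mul_apply, ← zpow_add]
      simp
    rw [hdvd, hφcard, ← hdvd] at h3
    rw [zpow_add, Equiv.Perm.mul_apply] at h3
    have h4 := hm i
    rw [h2] at h4
    rw [h4, zpow_neg] at h3
    rw [← hm j, ← h3]
    exact ((σ ^ m j).apply_symm_apply i).symm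
  let τ : Equiv.Perm (Fin n) := Equiv.ofBijective T hTinj.bijective_of_finite
  refine ⟨τ, fun i => ε i * c i, ?_⟩
  rw [intertwine_iff]
  intro i
  have hκσ : κ (σ i) = κ i := by
    apply Subtype.ext
    exact (cyc_eq_iff.2 (Equiv.Perm.sameCycle_apply_right.2 (Equiv.Perm.SameCycle.refl σ i))).symm
  have h1 : ((sp σ s) ^ (1 + m i)) (e (b (κ (σ i)))) = sv (ε i * s i) (σ i) := by
    rw [hκσ, zpow_add, mul_apply, hε, zpow_one, sp_sv]
  have h2 := star _ _ _ h1
  rw [hκσ, zpow_add, mul_apply, hc, zpow_one, sp_sv, sv_inj] at h2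
  refine ⟨h2.2.symm, ?_⟩
  have h3 := congrArg (fun x => ε i * x) h2.1
  rw [mul_assoc (ε i) (s i), ← mul_assoc (ε i) (ε i), Int.units_mul_self, one_mul] at h3
  rw [← h3, ← mul_assoc]
  rfl

/-- Signed permutations of the same cycle type with a cycle of odd length are conjugate under
`W(D_n)`. -/
theorem exists_intertwine_mem_WD {σ σ' : Equiv.Perm (Fin n)} {s s' : Fin n → ℤˣ}
    (hpos : posType σ s = posType σ' s') (hneg : negType σ s = negType σ' s')
    (hodd : ∃ i, Odd (cyc σ i).card) :
    ∃ g ∈ WD n, g * sp σ s = sp σ' s' * g := by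
  classical
  obtain ⟨τ, t, h⟩ := exists_intertwine_of_types_eq hpos hneg
  rcases Int.units_eq_one_or (∏ i, t i) with h1 | h1
  · exact ⟨_, sp_mem_WD_iff.2 h1, h⟩
  · obtain ⟨i, hi⟩ := hodd
    -- Changing all signs on one cycle commutes with the element; on a cycle of odd length it
    -- corrects the parity of the intertwiner.
    have hcomm : sp 1 (fun j => if j ∈ cyc σ i then -1 else 1) * sp σ s =
        sp σ s * sp 1 (fun j => if j ∈ cyc σ i then -1 else 1) := by
      rw [sp_mul, sp_mul, one_mul, mul_one]
      congr 1
      funext j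
      simp only [mem_cyc, Equiv.Perm.sameCycle_apply_right, Equiv.Perm.one_apply]
      exact mul_comm _ _
    refine ⟨sp τ t * sp 1 (fun j => if j ∈ cyc σ i then -1 else 1), ?_, ?_⟩
    · rw [sp_mul, sp_mem_WD_iff, Finset.prod_mul_distrib]
      simp only [Equiv.Perm.one_apply]
      rw [h1, Finset.prod_ite_mem, Finset.univ_inter, Finset.prod_const, hi.neg_one_pow]
      decide
    · rw [mul_assoc, hcomm, ← mul_assoc, h, mul_assoc]

/-- The sign is constant on every cycle and enters with an even exponent. Consequently all
intertwiners in W(B_n) between permutations with only even cycles lie in W(D_n), which keeps the two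
split classes apart. -/
theorem prod_eq_one_of_even_cycles {σ : Equiv.Perm (Fin n)} {t : Fin n → ℤˣ}
    (ht : ∀ i, t (σ i) = t i) (heven : ∀ i, Even (cyc σ i).card) : ∏ i, t i = 1 := by
  classical
  have ht' : ∀ i j, σ.SameCycle i j → t j = t i := by
    rintro i j h
    obtain ⟨k, -, rfl⟩ := (isCycleOn_cyc σ i).exists_pow_eq (self_mem_cyc σ i) (mem_cyc.2 h)
    induction k with
    | zero => rfl
    | succ k ih => rw [pow_succ', Equiv.Perm.mul_apply, ht, ih ⟨k, rfl⟩]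
  rw [← Finset.prod_fiberwise_of_maps_to (t := cycles σ) (g := cyc σ)
    (fun i _ => mem_cycles.2 ⟨i, rfl⟩)]
  refine Finset.prod_eq_one fun C hC => ?_
  obtain ⟨i, rfl⟩ := mem_cycles.1 hC
  have h1 : Finset.univ.filter (fun j => cyc σ j = cyc σ i) = cyc σ i := by
    ext j
    rw [Finset.mem_filter, mem_cyc, cyc_eq_iff, Equiv.Perm.sameCycle_comm]
    simp
  rw [h1, Finset.prod_congr rfl fun j hj => ht' i j (mem_cyc.1 hj), Finset.prod_const]
  rcases Int.units_eq_one_or (t i) with h2 | h2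
  · rw [h2, one_pow]
  · rw [h2, (heven i).neg_one_pow]

/-! ### Blocks -/

/-- The block with label `k`. -/
def blk (q : Fin n → ℕ) (k : ℕ) : Finset (Fin n) := {i | q i = k}

@[simp] theorem mem_blk {q : Fin n → ℕ} {k : ℕ} {i : Fin n} : i ∈ blk q k ↔ q i = k := by
  simp [blk]

open Classical in
/-- The sizes of the unbalanced blocks. -/
def unbSizes (q : Fin n → ℕ) (U : Set ℕ) : Multiset ℕ :=
  ((Finset.univ.image q).filter fun k => k ∈ U).val.map fun k => (blk q k).card

open Classical in
/-- The sizes of the balanced blocks. -/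
def balSizes (q : Fin n → ℕ) (U : Set ℕ) : Multiset ℕ :=
  ((Finset.univ.image q).filter fun k => ¬k ∈ U).val.map fun k => (blk q k).card

variable {q q' : Fin n → ℕ} {U U' : Set ℕ} {d d' : Fin n → ℤˣ}

theorem sum_sizes (q : Fin n → ℕ) (U : Set ℕ) : (balSizes q U).sum + (unbSizes q U).sum = n := by
  classical
  have h1 : (balSizes q U).sum =
      ∑ k ∈ (Finset.univ.image q).filter fun k => ¬k ∈ U, (blk q k).card := rfl
  have h2 : (unbSizes q U).sum =
      ∑ k ∈ (Finset.univ.image q).filter fun k => k ∈ U, (blk q k).card := rfl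
  rw [h1, h2, add_comm, Finset.sum_filter_add_sum_filter_not]
  have := Finset.card_eq_sum_card_image q Finset.univ
  rw [Finset.card_univ, Fintype.card_fin] at this
  exact this.symm

theorem balSizes_pos (q : Fin n → ℕ) (U : Set ℕ) : ∀ k ∈ balSizes q U, 0 < k := by
  classical
  intro k hk
  obtain ⟨l, hl, rfl⟩ := Multiset.mem_map.1 hk
  rw [Finset.mem_val, Finset.mem_filter, Finset.mem_image] at hl
  obtain ⟨⟨i, -, rfl⟩, -⟩ := hl
  exact Finset.card_pos.2 ⟨i, by simp⟩

theorem one_lt_unbSizes (hU : ∀ i, q i ∈ U → ∃ j, j ≠ i ∧ q j = q i) :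
    ∀ k ∈ unbSizes q U, 1 < k := by
  classical
  intro k hk
  obtain ⟨l, hl, rfl⟩ := Multiset.mem_map.1 hk
  rw [Finset.mem_val, Finset.mem_filter, Finset.mem_image] at hl
  obtain ⟨⟨i, -, rfl⟩, hi⟩ := hl
  obtain ⟨j, hji, hj⟩ := hU i hi
  exact Finset.one_lt_card.2 ⟨i, by simp, j, by simpa using hj, hji.symm⟩

theorem unbSizes_eq_zero_iff : unbSizes q U = 0 ↔ ∀ i, q i ∉ U := by
  classical
  rw [unbSizes, Multiset.map_eq_zero, Finset.val_eq_zero, Finset.filter_eq_empty_iff]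
  simp

/-! ### The cycle type of a Coxeter element -/

/-- The cycles of a Coxeter element: the balanced blocks, and two cycles on every unbalanced block,
one of which is a fixed point up to sign. -/
structure CoxeterCycles (q : Fin n → ℕ) (U : Set ℕ) (d : Fin n → ℤˣ) (σ : Equiv.Perm (Fin n))
    (s : Fin n → ℤˣ) : Prop where
  good : Good q U d σ s
  balanced : ∀ i j, q i ∉ U → q i = q j → σ.SameCycle i j
  unbalanced : ∀ i, q i ∈ U → ∃ x, q x = q i ∧ σ x = x ∧ s x = -1 ∧
    ∀ k l, q k = q i → q l = q i → k ≠ x → l ≠ x → σ.SameCycle k l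

theorem IsCoxeterElement.coxeterCycles (hU : ∀ i, q i ∈ U → ∃ j, j ≠ i ∧ q j = q i) {c : WD n}
    (hc : IsCoxeterElement (G q U d) c) :
    ∃ σ s, (c : E n ≃ₗᵢ[ℝ] E n) = sp σ s ∧ CoxeterCycles q U d σ s := by
  obtain ⟨r, α, hα, hc⟩ := hc
  have h := hα.obtuseGenerators hU
  obtain ⟨σ, s, hσ, hgood⟩ := exists_good_of_mem h.prod_mem_GA
  exact ⟨σ, s, hc.trans hσ, hgood, fun i j hi hij => h.sameCycle_of_balanced hσ hi hij,
    fun i hi => h.exists_cycles_of_unbalanced hσ hi⟩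

namespace CoxeterCycles

variable {σ : Equiv.Perm (Fin n)} {s : Fin n → ℤˣ} (h : CoxeterCycles q U d σ s)

include h

theorem block_eq {i j : Fin n} (hij : σ.SameCycle i j) : q j = q i := by
  obtain ⟨k, -, rfl⟩ := (isCycleOn_cyc σ i).exists_pow_eq (self_mem_cyc σ i) (mem_cyc.2 hij)
  induction k with
  | zero => rfl
  | succ k ih =>
    rw [pow_succ', Equiv.Perm.mul_apply, ← (h.good.1 _).1]
    exact ih ⟨k, rfl⟩

theorem cyc_balanced {i : Fin n} (hi : q i ∉ U) : cyc σ i = blk q (q i) := by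
  ext j
  rw [mem_cyc, mem_blk]
  exact ⟨h.block_eq, fun hj => h.balanced i j hi hj.symm⟩

theorem prod_blk (k : ℕ) : ∏ i ∈ blk q k, s i = 1 := h.good.2 k

omit h in
theorem cyc_fixed {x : Fin n} (hx : σ x = x) : cyc σ x = {x} := by
  ext j
  rw [mem_cyc, Finset.mem_singleton]
  constructor
  · rintro ⟨k, rfl⟩
    exact Equiv.Perm.zpow_apply_eq_self_of_apply_eq_self hx k
  · rintro rfl
    exact Equiv.Perm.SameCycle.refl σ j

theorem cyc_unbalanced {i x : Fin n} (hx : q x = q i) (hσx : σ x = x)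
    (hcyc : ∀ k l, q k = q i → q l = q i → k ≠ x → l ≠ x → σ.SameCycle k l) (hix : i ≠ x) :
    cyc σ i = (blk q (q i)).erase x := by
  ext j
  rw [mem_cyc, Finset.mem_erase, mem_blk]
  constructor
  · intro hj
    refine ⟨?_, h.block_eq hj⟩
    rintro rfl
    have := mem_cyc.2 hj.symm
    rw [cyc_fixed hσx, Finset.mem_singleton] at this
    exact hix this
  · rintro ⟨hjx, hj⟩
    exact hcyc i j rfl hj hix hjx

theorem prod_erase {i x : Fin n} (hx : q x = q i) (hsx : s x = -1) :
    ∏ j ∈ (blk q (q i)).erase x, s j = -1 := by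
  have h1 := Finset.mul_prod_erase (blk q (q i)) s (a := x) (by simpa using hx)
  rw [h.prod_blk, hsx] at h1
  have h2 := congrArg (fun y => -1 * y) h1
  simpa using h2

/-- A balanced block is one cycle with sign product 1. In an unbalanced block the fixed axis has
sign -1, and as the block has product 1 its complement has product -1 too. -/
theorem posType_eq : posType σ s = balSizes q U := by
  classical
  have hset : ((cycles σ).filter fun C => ∏ i ∈ C, s i = 1) =
      ((Finset.univ.image q).filter fun k => ¬k ∈ U).image (blk q) := by
    ext C
    simp only [Finset.mem_filter, Finset.mem_image, Finset.mem_univ, true_and]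
    constructor
    · rintro ⟨hC, hprod⟩
      obtain ⟨i, rfl⟩ := mem_cycles.1 hC
      by_cases hi : q i ∈ U
      · exfalso
        obtain ⟨x, hx, hσx, hsx, hcyc⟩ := h.unbalanced i hi
        by_cases hix : i = x
        · rw [hix, cyc_fixed hσx, Finset.prod_singleton, hsx] at hprod
          exact absurd hprod (by decide)
        · rw [h.cyc_unbalanced hx hσx hcyc hix, h.prod_erase hx hsx] at hprod
          exact absurd hprod (by decide)
      · exact ⟨q i, ⟨⟨i, rfl⟩, hi⟩, (h.cyc_balanced hi).symm⟩
    · rintro ⟨k, ⟨⟨i, rfl⟩, hi⟩, rfl⟩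
      exact ⟨mem_cycles.2 ⟨i, h.cyc_balanced hi⟩, h.prod_blk _⟩
  rw [posType, balSizes, hset, Finset.image_val_of_injOn, Multiset.map_map]
  · rfl
  · intro k hk l _ hkl
    simp only [Finset.coe_filter, Finset.mem_image, Finset.mem_univ, true_and,
      Set.mem_ofPred_eq] at hk
    obtain ⟨⟨i, rfl⟩, -⟩ := hk
    have : i ∈ blk q l := by rw [← hkl]; simp
    exact mem_blk.1 this

theorem negType_eq (hU : ∀ i, q i ∈ U → ∃ j, j ≠ i ∧ q j = q i) : negType σ s =
    (unbSizes q U).map (fun k => k - 1) + Multiset.replicate (Multiset.card (unbSizes q U)) 1 := by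
  classical
  set K := (Finset.univ.image q).filter fun k => k ∈ U with hK
  have hmemK : ∀ k : K, ∃ i, q i = k ∧ q i ∈ U := by
    rintro ⟨k, hk⟩
    simp only [hK, Finset.mem_filter, Finset.mem_image, Finset.mem_univ, true_and] at hk
    obtain ⟨⟨i, rfl⟩, hi⟩ := hk
    exact ⟨i, rfl, hi⟩
  have hex : ∀ k : K, ∃ x, q x = k ∧ σ x = x ∧ s x = -1 ∧
      ∀ i j, q i = k → q j = k → i ≠ x → j ≠ x → σ.SameCycle i j := by
    intro k
    obtain ⟨i, hi, hiU⟩ := hmemK k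
    rw [← hi]
    exact h.unbalanced i hiU
  choose x hxq hxσ hxs hxc using hex
  have hxmem : ∀ k : K, x k ∈ blk q k := fun k => mem_blk.2 (hxq k)
  have hset : ((cycles σ).filter fun C => ¬∏ i ∈ C, s i = 1) =
      (K.attach.image fun k : K => (blk q k).erase (x k)) ∪ K.attach.image fun k : K => {x k} := by
    ext C
    simp only [Finset.mem_filter, Finset.mem_union, Finset.mem_image, Finset.mem_attach, true_and,
      Subtype.exists]
    constructor
    · rintro ⟨hC, hprod⟩
      obtain ⟨i, rfl⟩ := mem_cycles.1 hC
      by_cases hi : q i ∈ U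
      · have hk : q i ∈ K := by simp [hK, hi]
        by_cases hix : i = x ⟨q i, hk⟩
        · refine Or.inr ⟨q i, hk, ?_⟩
          rw [← cyc_fixed (hxσ _), ← hix]
        · refine Or.inl ⟨q i, hk, ?_⟩
          exact (h.cyc_unbalanced (hxq ⟨q i, hk⟩) (hxσ _) (hxc ⟨q i, hk⟩) hix).symm
      · rw [h.cyc_balanced hi, h.prod_blk] at hprod
        exact absurd rfl hprod
    · rintro (⟨k, hk, rfl⟩ | ⟨k, hk, rfl⟩)
      · obtain ⟨i, rfl, hi⟩ := hmemK ⟨k, hk⟩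
        obtain ⟨j, hjx, hj⟩ := hU (x ⟨q i, hk⟩) (by rw [hxq]; exact hi)
        rw [hxq] at hj
        rw [h.prod_erase (hxq _) (hxs _)]
        refine ⟨mem_cycles.2 ⟨j, ?_⟩, by decide⟩
        have h1 : q i = q j := hj.symm
        have := h.cyc_unbalanced ((hxq ⟨q i, hk⟩).trans h1) (hxσ _) (by
          rw [← h1]; exact hxc ⟨q i, hk⟩) hjx
        rw [this, ← h1]
      · refine ⟨mem_cycles.2 ⟨_, cyc_fixed (hxσ ⟨k, hk⟩)⟩, ?_⟩
        rw [Finset.prod_singleton, hxs]; decide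
  -- Sizes do not separate the two families, since a block of size 2 yields two negative 1-cycles;
  -- the erased point does.
  have hdisj : Disjoint (K.attach.image fun k : K => (blk q k).erase (x k))
      (K.attach.image fun k : K => {x k}) := by
    rw [Finset.disjoint_left]
    intro C hC hC'
    obtain ⟨k, -, rfl⟩ := Finset.mem_image.1 hC
    obtain ⟨l, -, hl⟩ := Finset.mem_image.1 hC'
    have h1 : x l ∈ (blk q k).erase (x k) := by rw [← hl]; simp
    rw [Finset.mem_erase, mem_blk, hxq] at h1
    exact h1.1 (congrArg x (Subtype.ext h1.2))
  have hinj : ∀ k l : K, x k = x l → k = l := fun k l hkl => by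
    apply Subtype.ext
    rw [← hxq k, hkl, hxq l]
  rw [negType, hset, ← Finset.disjUnion_eq_union _ _ hdisj]
  change Multiset.map Finset.card ((Finset.image _ _).val + (Finset.image _ _).val) = _
  have hKval : K.val = K.attach.val.map Subtype.val := (Multiset.attach_map_val _).symm
  rw [Multiset.map_add, Finset.image_val_of_injOn, Finset.image_val_of_injOn, Multiset.map_map,
    Multiset.map_map]
  · congr 1
    · rw [unbSizes, Multiset.map_map]
      change _ = Multiset.map _ K.val
      rw [hKval, Multiset.map_map]
      refine Multiset.map_congr rfl fun k _ => ?_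
      exact Finset.card_erase_of_mem (hxmem k)
    · rw [unbSizes, Multiset.card_map]
      change _ = Multiset.replicate (Multiset.card K.val) 1
      rw [hKval, Multiset.card_map, ← Multiset.map_const']
      exact Multiset.map_congr rfl fun k _ => Finset.card_singleton _
  · intro k _ l _ hkl
    exact hinj k l (Finset.singleton_injective hkl)
  · intro k _ l _ hkl
    obtain ⟨i, hi, hiU⟩ := hmemK k
    obtain ⟨j, hjx, hj⟩ := hU (x k) (by rw [hxq, ← hi]; exact hiU)
    have h1 : j ∈ (blk q k).erase (x k) := by
      rw [Finset.mem_erase, mem_blk, hj, hxq]; exact ⟨hjx, rfl⟩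
    simp only at hkl
    rw [hkl, Finset.mem_erase, mem_blk, hj, hxq] at h1
    exact Subtype.ext h1.2

end CoxeterCycles

/-! ### Conjugacy of subgroups -/

theorem exists_perm_of_sizes_eq (hb : balSizes q U = balSizes q' U')
    (hu : unbSizes q U = unbSizes q' U') :
    ∃ τ : Equiv.Perm (Fin n), (∀ i, q' (τ i) ∈ U' ↔ q i ∈ U) ∧
      ∀ i j, q i = q j ↔ q' (τ i) = q' (τ j) := by
  classical
  obtain ⟨φ, hφ⟩ := exists_equiv_of_map_filter_eq (Finset.univ.image q) (Finset.univ.image q')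
    (fun k => k ∈ U) (fun k => k ∈ U') (fun k => (blk q k).card) (fun k => (blk q' k).card) hu hb
  let f : Fin n → Finset.univ.image q' := fun i => φ ⟨q i, by simp⟩
  let g : Fin n → Finset.univ.image q' := fun i => ⟨q' i, by simp⟩
  have he : ∀ k, Nonempty ({i // f i = k} ≃ {i // g i = k}) := by
    intro k
    obtain ⟨l, rfl⟩ := φ.surjective k
    rw [← Fintype.card_eq, Fintype.card_subtype, Fintype.card_subtype]
    have h1 : (Finset.univ.filter fun i => f i = φ l) = blk q l := by
      ext i; simp [f, blk, Subtype.ext_iff]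
    have h2 : (Finset.univ.filter fun i => g i = φ l) = blk q' (φ l) := by
      ext i; simp [g, blk, Subtype.ext_iff]
    rw [h1, h2, (hφ l).1]
  have hτ := Equiv.ofFiberEquiv_map (f := f) (g := g) fun k => (he k).some
  refine ⟨Equiv.ofFiberEquiv (f := f) (g := g) fun k => (he k).some, fun i => ?_, fun i j => ?_⟩
  · have := congrArg Subtype.val (hτ i)
    simp only [g, f] at this
    rw [this]
    exact (hφ _).2
  · have h1 := congrArg Subtype.val (hτ i)
    have h2 := congrArg Subtype.val (hτ j)
    simp only [g, f] at h1 h2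
    rw [h1, h2, ← Subtype.ext_iff, φ.injective.eq_iff, Subtype.mk.injEq]

/-- The signs d_i d'_{τ i} translate signs relative to d into signs relative to d'. The factor x is
the remaining freedom: arbitrary on unbalanced blocks, constant on each balanced one. The last
hypothesis puts the conjugating element into W(D_n). -/
theorem subgroupConj_of_perm {τ : Equiv.Perm (Fin n)} (hU : ∀ i, q' (τ i) ∈ U' ↔ q i ∈ U)
    (hq : ∀ i j, q i = q j ↔ q' (τ i) = q' (τ j)) (x : Fin n → ℤˣ)
    (hx : ∀ i j, q i ∉ U → q i = q j → x i = x j)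
    (hprod : (∏ i, x i) * ((∏ i, d i) * ∏ i, d' i) = 1) :
    SubgroupConj (G q U d) (G q' U' d') := by
  have hw : sp τ (fun i => x i * (d i * d' (τ i))) ∈ WD n := by
    rw [sp_mem_WD_iff, Finset.prod_mul_distrib, Finset.prod_mul_distrib,
      Equiv.prod_comp τ d', hprod]
  refine ⟨⟨_, hw⟩, ?_⟩
  apply eq_of_map_eq
  rw [map_map_conj, map_G, map_G, GA, GA, MonoidHom.map_closure]
  congr 1
  have hadm : ∀ a i b j, Adm q U d a i b j ↔ Adm q' U' d' (a * (x i * (d i * d' (τ i)))) (τ i)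
      (b * (x j * (d j * d' (τ j)))) (τ j) := by
    intro a i b j
    have e1 : ∀ (a : ℤˣ) i, a * (x i * (d i * d' (τ i))) * d' (τ i) = x i * (a * d i) := by
      intro a i
      calc a * (x i * (d i * d' (τ i))) * d' (τ i) = x i * (a * d i) * (d' (τ i) * d' (τ i)) := by
            simp only [mul_assoc, mul_left_comm]
        _ = _ := by rw [Int.units_mul_self, mul_one]
    rw [Adm, Adm, hU, e1, e1, ← hq]
    constructor
    · rintro ⟨h1, h2⟩
      refine ⟨h1, ?_⟩
      by_cases hi : q i ∈ U
      · exact Or.inl hi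
      · rw [h2.resolve_left hi, hx i j hi h1]; exact Or.inr rfl
    · rintro ⟨h1, h2⟩
      refine ⟨h1, ?_⟩
      by_cases hi : q i ∈ U
      · exact Or.inl hi
      · have := h2.resolve_left hi
        rw [hx i j hi h1] at this
        exact Or.inr (mul_left_cancel this)
  have hmap : ∀ a i b j, sp τ (fun i => x i * (d i * d' (τ i))) (sv a i - sv b j) =
      sv (a * (x i * (d i * d' (τ i)))) (τ i) - sv (b * (x j * (d j * d' (τ j)))) (τ j) := by
    intro a i b j
    rw [map_sub, sp_sv, sp_sv]
  ext g
  constructor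
  · rintro ⟨a', i', b', j', hij, h, rfl⟩
    obtain ⟨i, rfl⟩ := τ.surjective i'
    obtain ⟨j, rfl⟩ := τ.surjective j'
    refine ⟨_, ⟨a' * (x i * (d i * d' (τ i))), i, b' * (x j * (d j * d' (τ j))), j,
      fun h => hij (congrArg τ h), ?_, rfl⟩, ?_⟩
    · rw [hadm]
      simpa only [mul_assoc _ (x _ * _) (x _ * _), Int.units_mul_self, mul_one] using h
    · refine (refl_map _ _).symm.trans ?_
      rw [hmap]
      simp only [mul_assoc _ (x _ * _) (x _ * _), Int.units_mul_self, mul_one]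
  · rintro ⟨_, ⟨a, i, b, j, hij, h, rfl⟩, rfl⟩
    refine ⟨_, _, _, _, fun h => hij (τ.injective h), (hadm a i b j).1 h, ?_⟩
    rw [← hmap, refl_map]; rfl

/-- A wrong parity is corrected through x, by -1 at one coordinate of an unbalanced block or on all
of a block of odd size. -/
theorem subgroupConj_of_sizes_eq (hb : balSizes q U = balSizes q' U')
    (hu : unbSizes q U = unbSizes q' U') {i : Fin n} (hi : q i ∈ U ∨ Odd (blk q (q i)).card) :
    SubgroupConj (G q U d) (G q' U' d') := by
  classical
  obtain ⟨τ, h1, h2⟩ := exists_perm_of_sizes_eq hb hu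
  rcases Int.units_eq_one_or ((∏ i, d i) * ∏ i, d' i) with h3 | h3
  · exact subgroupConj_of_perm h1 h2 (fun _ => 1) (fun _ _ _ _ => rfl) (by simp [h3])
  · by_cases hi' : q i ∈ U
    · refine subgroupConj_of_perm h1 h2 (fun k => if k = i then -1 else 1) ?_ ?_
      · intro k l hk hkl
        have hki : k ≠ i := by rintro rfl; exact hk hi'
        have hli : l ≠ i := by rintro rfl; exact hk (hkl ▸ hi')
        rw [if_neg hki, if_neg hli]
      · rw [h3, Finset.prod_ite_eq']
        simp
    · have hodd := hi.resolve_left hi'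
      refine subgroupConj_of_perm h1 h2 (fun k => if k ∈ blk q (q i) then -1 else 1) ?_ ?_
      · intro k l hk hkl
        simp only [mem_blk, hkl]
      · rw [h3, Finset.prod_ite_mem, Finset.univ_inter, Finset.prod_const, hodd.neg_one_pow]
        decide

theorem subgroupConj_of_sizes_eq' (hb : balSizes q U = balSizes q' U')
    (hu : unbSizes q U = unbSizes q' U') (hprod : ∏ i, d i = ∏ i, d' i) :
    SubgroupConj (G q U d) (G q' U' d') := by
  obtain ⟨τ, h1, h2⟩ := exists_perm_of_sizes_eq hb hu
  refine subgroupConj_of_perm h1 h2 (fun _ => 1) (fun _ _ _ _ => rfl) ?_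
  rw [hprod, Int.units_mul_self]; simp

/-! ### Block indices -/

theorem blockIndex_cons (a : ℕ) (L : List ℕ) (p : ℕ) :
    blockIndex (a :: L) p = if p < a then 0 else blockIndex L (p - a) + 1 := rfl

theorem blockIndex_append (L M : List ℕ) (p : ℕ) :
    blockIndex (L ++ M) p =
      if p < L.sum then blockIndex L p else L.length + blockIndex M (p - L.sum) := by
  induction L generalizing p with
  | nil => simp
  | cons a L ih =>
    have hs : (a :: L).sum = a + L.sum := List.sum_cons
    rw [List.cons_append, blockIndex_cons, blockIndex_cons]
    by_cases h1 : p < a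
    · rw [if_pos h1, if_pos h1, if_pos (by omega)]
    · rw [if_neg h1, if_neg h1, ih]
      by_cases h2 : p < a + L.sum
      · rw [if_pos (by omega), if_pos (by omega)]
      · rw [if_neg (by omega), if_neg (by omega), hs, Nat.sub_sub, List.length_cons]
        omega

theorem blockIndex_lt {L : List ℕ} {p : ℕ} (h : p < L.sum) : blockIndex L p < L.length := by
  induction L generalizing p with
  | nil => simp at h
  | cons a L ih =>
    rw [List.sum_cons] at h
    rw [blockIndex_cons, List.length_cons]
    split_ifs with h1
    · omega
    · have := ih (p := p - a) (by omega)
      omega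

/-- Positions beyond the last block have index `L.length`, so they are not counted and `N` may
exceed the sum. -/
theorem card_range_blockIndex (L : List ℕ) (N k : ℕ) (hN : L.sum ≤ N) (hk : k < L.length) :
    ((Finset.range N).filter fun p => blockIndex L p = k).card = L.getD k 0 := by
  induction L generalizing N k with
  | nil => simp at hk
  | cons a L ih =>
    rw [List.sum_cons] at hN
    cases k with
    | zero =>
      have : ((Finset.range N).filter fun p => blockIndex (a :: L) p = 0) = Finset.range a := by
        ext p
        rw [Finset.mem_filter, Finset.mem_range, Finset.mem_range, blockIndex_cons]
        split_ifs with h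
        · simp only [and_true, h, iff_true]; omega
        · simp [h]
      rw [this]
      simp
    | succ k =>
      have : ((Finset.range N).filter fun p => blockIndex (a :: L) p = k + 1) =
          ((Finset.range (N - a)).filter fun p => blockIndex L p = k).map
            (addRightEmbedding a) := by
        ext p
        rw [Finset.mem_filter, Finset.mem_range, Finset.mem_map, blockIndex_cons]
        simp only [Finset.mem_filter, Finset.mem_range, addRightEmbedding_apply]
        constructor
        · rintro ⟨h1, h2⟩
          by_cases h : p < a
          · rw [if_pos h] at h2; omega
          · rw [if_neg h] at h2
            exact ⟨p - a, ⟨by omega, by omega⟩, by omega⟩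
        · rintro ⟨r, ⟨h1, h2⟩, rfl⟩
          rw [if_neg (by omega), Nat.add_sub_cancel, h2]
          exact ⟨by omega, rfl⟩
      rw [this, Finset.card_map, ih (N - a) k (by omega) (by simpa using hk)]
      simp

theorem card_blk_blockIndex (L : List ℕ) (hL : L.sum = n) (k : ℕ) (hk : k < L.length) :
    (blk (fun i : Fin n => blockIndex L i) k).card = L.getD k 0 := by
  rw [← card_range_blockIndex L n k hL.le hk, ← Finset.card_map Fin.valEmbedding]
  congr 1
  ext p
  simp only [Finset.mem_map, mem_blk, Fin.valEmbedding_apply, Finset.mem_filter, Finset.mem_range]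
  constructor
  · rintro ⟨i, h, rfl⟩
    exact ⟨i.2, h⟩
  · rintro ⟨h1, h2⟩
    exact ⟨⟨p, h1⟩, h2, rfl⟩

theorem image_blockIndex (L : List ℕ) (hL : L.sum = n) (hpos : ∀ a ∈ L, 0 < a) :
    Finset.univ.image (fun i : Fin n => blockIndex L i) = Finset.range L.length := by
  ext k
  simp only [Finset.mem_image, Finset.mem_univ, true_and, Finset.mem_range]
  constructor
  · rintro ⟨i, rfl⟩
    exact blockIndex_lt (by rw [hL]; exact i.2)
  · intro hk
    have h1 := card_blk_blockIndex L hL k hk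
    have h2 : 0 < L.getD k 0 := by
      rw [List.getD_eq_getElem _ _ hk]
      exact hpos _ (List.getElem_mem hk)
    rw [← h1, Finset.card_pos] at h2
    obtain ⟨i, hi⟩ := h2
    exact ⟨i, mem_blk.1 hi⟩

theorem map_getD_range (L M : List ℕ) :
    (Multiset.range L.length).map (fun k => (L ++ M).getD k 0) = (L : Multiset ℕ) := by
  rw [Multiset.range, Multiset.map_coe]
  congr 1
  apply List.ext_getElem
  · simp
  · intro k h1 h2
    simp [h2, List.getElem?_append_left h2]

theorem balSizes_blockIndex (L M : List ℕ) (hL : (L ++ M).sum = n) (hpos : ∀ a ∈ L ++ M, 0 < a) :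
    balSizes (fun i : Fin n => blockIndex (L ++ M) i) {k | L.length ≤ k} = (L : Multiset ℕ) := by
  classical
  rw [balSizes, image_blockIndex _ hL hpos, ← map_getD_range L M]
  trans (Finset.range L.length).val.map fun k =>
    (blk (fun i : Fin n => blockIndex (L ++ M) i) k).card
  · congr 2
    ext k
    simp only [Finset.mem_filter, Finset.mem_range, Set.mem_ofPred_eq, List.length_append]
    omega
  refine Multiset.map_congr rfl fun k hk => ?_
  apply card_blk_blockIndex _ hL
  have : k < L.length := by simpa using hk
  rw [List.length_append]; omega

theorem balSizes_add_unbSizes (L : List ℕ) (U : Set ℕ) (hL : L.sum = n) (hpos : ∀ a ∈ L, 0 < a) :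
    balSizes (fun i : Fin n => blockIndex L i) U + unbSizes (fun i : Fin n => blockIndex L i) U =
      (L : Multiset ℕ) := by
  classical
  rw [balSizes, unbSizes, ← Multiset.map_add, image_blockIndex _ hL hpos, Finset.filter_val,
    Finset.filter_val, add_comm, Multiset.filter_add_not]
  have h1 := map_getD_range L []
  rw [List.append_nil] at h1
  conv_rhs => rw [← h1]
  refine Multiset.map_congr rfl fun k hk => ?_
  exact card_blk_blockIndex _ hL _ (by simpa using hk)

theorem unbSizes_blockIndex (L M : List ℕ) (hL : (L ++ M).sum = n) (hpos : ∀ a ∈ L ++ M, 0 < a) :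
    unbSizes (fun i : Fin n => blockIndex (L ++ M) i) {k | L.length ≤ k} = (M : Multiset ℕ) := by
  have h1 := balSizes_add_unbSizes (L ++ M) {k | L.length ≤ k} hL hpos
  rw [balSizes_blockIndex L M hL hpos, ← Multiset.coe_add] at h1
  exact add_left_cancel h1

/-! ### The standard subgroups -/

theorem G_eq_closure (q : Fin n → ℕ) (U : Set ℕ) (d : Fin n → ℤˣ) :
    G q U d = Subgroup.closure {t : WD n | ∃ a i b j, i ≠ j ∧ Adm q U d a i b j ∧
      (t : E n ≃ₗᵢ[ℝ] E n) = refl (sv a i - sv b j)} := by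
  apply eq_of_map_eq
  rw [map_G, GA]
  refine (map_closure_preimage ?_).symm
  rintro t ⟨a, i, b, j, hij, _, rfl⟩
  exact refl_mem_WD (root_mem_roots hij)

/-- Up to a sign, an admissible root is e_i - a b e_j in an unbalanced block and d_i e_i - d_j e_j
in a balanced one. In particular d is irrelevant on the unbalanced blocks. -/
theorem iSup_factors_eq_G (L : List ℕ) (hL : L.sum = n) (m m' : ℕ) (hm : m + m' = L.length)
    (d : Fin n → ℤˣ) :
    (⨆ k : Fin m, factorA d (block n L k)) ⊔ (⨆ k : Fin m', factorD (block n L (m + k))) =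
      G (fun i => blockIndex L i) {k | m ≤ k} d := by
  rw [G_eq_closure]
  apply le_antisymm
  · apply sup_le
    · refine iSup_le fun k => ?_
      rw [factorA]
      refine Subgroup.closure_mono ?_
      rintro t ⟨i, hi, j, hj, hij, ht⟩
      have hi' : blockIndex L i = k := hi
      have hj' : blockIndex L j = k := hj
      refine ⟨d i, i, d j, j, hij, ⟨hi'.trans hj'.symm, Or.inr ?_⟩, ht⟩
      rw [Int.units_mul_self, Int.units_mul_self]
    · refine iSup_le fun k => ?_
      rw [factorD]
      refine Subgroup.closure_mono ?_
      rintro t ⟨i, hi, j, hj, hij, ht⟩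
      have hi' : blockIndex L i = m + k := hi
      have hj' : blockIndex L j = m + k := hj
      have hU : blockIndex L i ∈ {k | m ≤ k} := by
        rw [hi']; exact Nat.le_add_right _ _
      rcases ht with ht | ht
      · exact ⟨1, i, 1, j, hij, ⟨hi'.trans hj'.symm, Or.inl hU⟩, by rw [ht, sv_one, sv_one]⟩
      · exact ⟨1, i, -1, j, hij, ⟨hi'.trans hj'.symm, Or.inl hU⟩, by
          rw [ht, sv_neg, sv_one, sv_one, sub_neg_eq_add]⟩
  · rw [Subgroup.closure_le]
    rintro t ⟨a, i, b, j, hij, ⟨hq, hab⟩, ht⟩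
    have hlt : blockIndex L i < L.length := blockIndex_lt (by rw [hL]; exact i.2)
    by_cases hi : m ≤ blockIndex L i
    · have hlt' : blockIndex L i - m < m' := by omega
      have heq : m + (blockIndex L i - m) = blockIndex L i := by omega
      refine SetLike.mem_coe.2 ((le_sup_right.trans' (le_iSup
        (fun k : Fin m' => factorD (n := n) (block n L (m + k))) ⟨_, hlt'⟩) :
          factorD (block n L (m + (blockIndex L i - m))) ≤ _) ?_)
      rw [heq]
      refine Subgroup.subset_closure ⟨i, rfl, j, hq.symm, hij, ?_⟩
      rw [ht]
      have h1 := refl_root_mul a a b i j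
      rw [Int.units_mul_self, sv_one] at h1
      rw [← h1]
      rcases Int.units_eq_one_or (a * b) with h2 | h2
      · left; rw [h2, sv_one]
      · right; rw [h2, sv_neg, sv_one, sub_neg_eq_add]
    · refine SetLike.mem_coe.2 ((le_sup_left.trans' (le_iSup
        (fun k : Fin m => factorA (n := n) d (block n L k)) ⟨_, not_le.1 hi⟩) :
          factorA d (block n L (blockIndex L i)) ≤ _) ?_)
      refine Subgroup.subset_closure ⟨i, rfl, j, hq.symm, hij, ?_⟩
      have h2 : a * d i = b * d j := hab.resolve_left hi
      have h1 := refl_root_mul (a * d i) (d i) (d j) i j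
      rw [mul_assoc, Int.units_mul_self, mul_one] at h1
      rw [ht]
      change _ = refl (sv (d i) i - sv (d j) j)
      rw [← h1, h2, mul_assoc, Int.units_mul_self, mul_one]

theorem coe_sortedParts (s : Multiset ℕ) : ((sortedParts s : List ℕ) : Multiset ℕ) = s :=
  Multiset.sort_eq ..

theorem mem_sortedParts {s : Multiset ℕ} {k : ℕ} : k ∈ sortedParts s ↔ k ∈ s := by
  rw [← Multiset.mem_coe, coe_sortedParts]

theorem sum_sortedParts (s : Multiset ℕ) : (sortedParts s).sum = s.sum := by
  rw [← Multiset.sum_coe, coe_sortedParts]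

/-- The block labels of the standard subgroup with label `l`. -/
def qlam (l : DoublePartition n) (i : Fin n) : ℕ :=
  blockIndex (sortedParts l.fst ++ sortedParts l.snd) i

/-- The unbalanced labels of the standard subgroup with label `l`. -/
def Ulam (l : DoublePartition n) : Set ℕ := {k | (sortedParts l.fst).length ≤ k}

theorem sum_parts (l : DoublePartition n) :
    (sortedParts l.fst ++ sortedParts l.snd).sum = n := by
  rw [List.sum_append, sum_sortedParts, sum_sortedParts, l.sum_eq]

theorem parts_pos (l : DoublePartition n) :
    ∀ a ∈ sortedParts l.fst ++ sortedParts l.snd, 0 < a := by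
  intro a ha
  rw [List.mem_append, mem_sortedParts, mem_sortedParts] at ha
  exact ha.elim (l.fst_pos a) (l.snd_pos a)

theorem Wlam_eq_G (l : DoublePartition n) : Wlam l = G (qlam l) (Ulam l) 1 :=
  iSup_factors_eq_G _ (sum_parts l) _ _ (by rw [List.length_append]) 1

theorem balSizes_lam (l : DoublePartition n) : balSizes (qlam l) (Ulam l) = l.fst := by
  have := balSizes_blockIndex _ _ (sum_parts l) (parts_pos l)
  rw [coe_sortedParts] at this
  exact this

theorem unbSizes_lam (l : DoublePartition n) : unbSizes (qlam l) (Ulam l) = l.snd := by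
  have := unbSizes_blockIndex _ _ (sum_parts l) (parts_pos l)
  rw [coe_sortedParts] at this
  exact this

theorem card_mem_unbSizes {q : Fin n → ℕ} {U : Set ℕ} {i : Fin n} (hi : q i ∈ U) :
    (blk q (q i)).card ∈ unbSizes q U := by
  classical
  exact Multiset.mem_map.2 ⟨q i, by simp [hi], rfl⟩

theorem exists_ne_of_one_lt {q : Fin n → ℕ} {U : Set ℕ} (h : ∀ k ∈ unbSizes q U, 1 < k) :
    ∀ i, q i ∈ U → ∃ j, j ≠ i ∧ q j = q i := by
  intro i hi
  obtain ⟨j, hj, hji⟩ := Finset.exists_mem_ne (h _ (card_mem_unbSizes hi)) i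
  exact ⟨j, hji, mem_blk.1 hj⟩

theorem two_le_lam (l : Labels n) :
    ∀ i, qlam l.1 i ∈ Ulam l.1 → ∃ j, j ≠ i ∧ qlam l.1 j = qlam l.1 i :=
  exists_ne_of_one_lt (by rw [unbSizes_lam]; exact l.2)

/-- The double partition `(λ, ∅)`. -/
def ofPartition (l : n.Partition) : DoublePartition n where
  fst := l.parts
  snd := 0
  fst_pos := fun _ hk => l.parts_pos hk
  snd_pos := by simp
  sum_eq := by rw [l.parts_sum]; simp

/-- The signs of the basis with respect to which `W_λ^ε` is formed. -/
def splitSign (n : ℕ) (ε : ℤˣ) (i : Fin n) : ℤˣ := if (i : ℕ) = 0 then ε else 1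

theorem sortedParts_zero : sortedParts 0 = [] := by simp [sortedParts]

theorem WlamSplit_eq_G (l : n.Partition) (ε : ℤˣ) :
    WlamSplit l ε = G (qlam (ofPartition l)) (Ulam (ofPartition l)) (splitSign n ε) := by
  have h := iSup_factors_eq_G (sortedParts l.parts)
    (by rw [sum_sortedParts, l.parts_sum]) (sortedParts l.parts).length 0 rfl (splitSign n ε)
  have h2 : qlam (ofPartition l) = fun i : Fin n => blockIndex (sortedParts l.parts) i := by
    funext i
    rw [qlam, ofPartition, sortedParts_zero, List.append_nil]
  rw [h2]
  refine Eq.trans ?_ h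
  rw [iSup_of_empty (f := fun k : Fin 0 => factorD (n := n) _), sup_bot_eq]
  rfl

theorem prod_splitSign (hn : 0 < n) (ε : ℤˣ) : ∏ i, splitSign n ε i = ε := by
  have : ∀ i : Fin n, splitSign n ε i = if i = ⟨0, hn⟩ then ε else 1 := fun i => by
    simp [splitSign, Fin.ext_iff]
  simp only [this, Finset.prod_ite_eq', Finset.mem_univ, if_true]

theorem not_mem_U_ofPartition (l : n.Partition) (i : Fin n) :
    qlam (ofPartition l) i ∉ Ulam (ofPartition l) := by
  have := unbSizes_lam (ofPartition l)
  exact unbSizes_eq_zero_iff.1 this i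

/-! ### Parabolic closures -/

theorem apply_eq_of_good {q : Fin n → ℕ} {U : Set ℕ} {d : Fin n → ℤˣ} {σ : Equiv.Perm (Fin n)}
    {s : Fin n → ℤˣ} (h : ∀ i, Adm q U d 1 i (s i) (σ i)) {v : E n}
    (hv : ∀ i, q i ∈ U → v i = 0)
    (hv' : ∀ i j, q i ∉ U → q i = q j → ((d i : ℤ) : ℝ) * v i = ((d j : ℤ) : ℝ) * v j) :
    sp σ s v = v := by
  ext k
  obtain ⟨k, rfl⟩ := σ.surjective k
  rw [sp_coord]
  have h1 := (h k).1
  by_cases hk : q k ∈ U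
  · rw [hv k hk, hv (σ k) (h1 ▸ hk), mul_zero]
  · have h2 := (h k).2.resolve_left hk
    rw [one_mul] at h2
    have h3 := hv' k (σ k) hk h1
    rw [h2] at h3
    push_cast at h3
    have h4 := units_cast_mul_self (d (σ k))
    have h5 := congrArg (fun x => ((d (σ k) : ℤ) : ℝ) * x) h3
    rw [← mul_assoc, ← mul_assoc, ← mul_assoc, h4, one_mul, mul_comm ((d (σ k) : ℤ) : ℝ),
      mul_assoc ((s k : ℤ) : ℝ), h4, mul_one] at h5
    exact h5

/-- The structure q', U' merges all unbalanced blocks into one. Vectors fixed by the subgroup vanish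
on unbalanced blocks and are constant up to d on balanced ones, so the merged group fixes them.
Conversely, one sufficiently generic fixed vector already has its stabilizer in the merged group. -/
theorem parabolicClosure_G {q q' : Fin n → ℕ} {U U' : Set ℕ} {d : Fin n → ℤˣ}
    (hU : ∀ i, q i ∈ U → ∃ j, j ≠ i ∧ q j = q i) (h1 : ∀ i, q' i ∈ U' ↔ q i ∈ U)
    (h2 : ∀ i j, q i ∉ U → q j ∉ U → (q i = q j ↔ q' i = q' j))
    (h3 : ∀ i j, q i ∈ U → q j ∈ U → q' i = q' j) :
    parabolicClosure (G q U d : Set (WD n)) = G q' U' d := by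
  classical
  ext w
  constructor
  · intro hw
    obtain ⟨σ, s, hσ, hprod⟩ := exists_sp_of_mem_WD w.2
    -- The summand 1 keeps the entries nonzero on a balanced block labelled 0, so that the zeros of
    -- v are exactly the unbalanced coordinates.
    let v : E n := WithLp.toLp 2 fun k =>
      if q k ∈ U then 0 else ((d k : ℤ) : ℝ) * ((q k : ℝ) + 1)
    have hv : ∀ k, v k = if q k ∈ U then 0 else ((d k : ℤ) : ℝ) * ((q k : ℝ) + 1) := fun k => rfl
    have hfix : w.1 v = v := by
      apply hw v
      intro x hx
      obtain ⟨τ, t, ht, hgood⟩ := exists_good_of_mem (Subgroup.mem_subgroupOf.1 hx)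
      rw [show x.1 = sp τ t from ht]
      apply apply_eq_of_good hgood.1
      · intro i hi
        rw [hv, if_pos hi]
      · intro i j hi hij
        rw [hv, hv, if_neg hi, if_neg (hij ▸ hi), ← mul_assoc, ← mul_assoc, units_cast_mul_self,
          units_cast_mul_self, hij]
    rw [hσ] at hfix
    have hk : ∀ k, ((s k : ℤ) : ℝ) * v k = v (σ k) := fun k => by
      rw [← sp_coord, hfix]
    have hv0 : ∀ k, v k = 0 ↔ q k ∈ U := fun k => by
      rw [hv]
      split_ifs with h
      · simp [h]
      · simp only [h, iff_false]
        exact mul_ne_zero (units_cast_ne_zero _) (by positivity)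
    have hUσ : ∀ k, q (σ k) ∈ U ↔ q k ∈ U := fun k => by
      rw [← hv0, ← hv0, ← hk k, mul_eq_zero, or_iff_right (units_cast_ne_zero _)]
    have hbal : ∀ k, q k ∉ U → q (σ k) = q k ∧ s k * d k = d (σ k) := by
      intro k hkU
      have h4 := hk k
      rw [hv, hv, if_neg hkU, if_neg (by rwa [hUσ]), ← mul_assoc] at h4
      have h5 : ((q k : ℝ) + 1) = (q (σ k) : ℝ) + 1 := by
        have := congrArg abs h4
        rw [abs_mul, abs_mul, abs_mul] at this
        have habs : ∀ a : ℤˣ, |((a : ℤ) : ℝ)| = 1 := fun a => by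
          rcases Int.units_eq_one_or a with rfl | rfl <;> simp
        rw [habs, habs, habs, one_mul, one_mul, one_mul, abs_of_pos (by positivity),
          abs_of_pos (by positivity)] at this
        exact this
      refine ⟨by exact_mod_cast (add_right_cancel h5).symm, ?_⟩
      rw [← h5] at h4
      have h6 := mul_right_cancel₀ (by positivity) h4
      exact units_cast_injective (by push_cast; exact h6)
    rw [G, Subgroup.mem_subgroupOf, hσ, sp_mem_GA_iff]
    have hq' : ∀ i, q' i = q' (σ i) := fun i => by
      by_cases hi : q i ∈ U
      · exact h3 i (σ i) hi ((hUσ i).2 hi)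
      · exact (h2 i (σ i) hi (by rwa [hUσ])).1 (hbal i hi).1.symm
    have hprodbal : ∀ S : Finset (Fin n), (∀ i ∈ S, q i ∉ U) → (∀ i, i ∈ S ↔ σ i ∈ S) →
        ∏ i ∈ S, s i = 1 := by
      intro S hS hσS
      have h4 : ∀ i ∈ S, s i = d (σ i) * d i := fun i hi => by
        rw [← (hbal i (hS i hi)).2, mul_assoc, Int.units_mul_self, mul_one]
      rw [Finset.prod_congr rfl h4, Finset.prod_mul_distrib,
        Finset.prod_equiv σ (t := S) (g := d) hσS (fun _ _ => rfl), Int.units_mul_self]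
    refine ⟨fun i => ⟨hq' i, ?_⟩, fun k => ?_⟩
    · by_cases hi : q i ∈ U
      · exact Or.inl ((h1 i).2 hi)
      · refine Or.inr ?_
        rw [← (hbal i hi).2, one_mul, ← mul_assoc, Int.units_mul_self, one_mul]
    · by_cases hkU : ∃ i, q' i = k ∧ q i ∈ U
      · obtain ⟨i, rfl, hi⟩ := hkU
        -- The balanced part contributes sign 1, so the parity on the single merged block is the
        -- total parity, which is even in W(D_n).
        have h4 := Finset.prod_filter_mul_prod_filter_not Finset.univ (fun j => q j ∈ U) s
        rw [hprod, hprodbal (Finset.univ.filter fun j => ¬q j ∈ U) (by simp) (by simp [hUσ]),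
          mul_one] at h4
        rw [← h4]
        refine Finset.prod_congr ?_ fun _ _ => rfl
        ext j
        simp only [Finset.mem_filter, Finset.mem_univ, true_and]
        constructor
        · intro hj
          rw [← h1, hj, h1]; exact hi
        · intro hj
          exact h3 j i hj hi
      · push Not at hkU
        apply hprodbal
        · intro i hi
          exact hkU i (by simpa using hi)
        · intro i
          simp [← hq' i]
  · intro hw v hv
    obtain ⟨σ, s, hσ, hgood⟩ := exists_good_of_mem (Subgroup.mem_subgroupOf.1 hw)
    rw [show w.1 = sp σ s from hσ]
    have hfix : ∀ g ∈ GA q U d, g v = v := fun g hg =>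
      hv ⟨g, GA_le_WD q U d hg⟩ (Subgroup.mem_subgroupOf.2 hg)
    refine apply_eq_of_good hgood.1 (fun i hi => ?_) (fun i j hi hij => ?_)
    · rw [h1] at hi
      obtain ⟨j, hji, hj⟩ := hU i hi
      exact fixed_unbalanced hfix hj.symm hji.symm hi
    · have hj : q' j ∉ U' := hij ▸ hi
      rw [h1] at hi hj
      exact fixed_balanced hfix ((h2 i j hi hj).2 hij)

theorem qlam_mem_U_iff (l : DoublePartition n) (i : Fin n) :
    qlam l i ∈ Ulam l ↔ l.fst.sum ≤ i := by
  rw [qlam, Ulam, Set.mem_ofPred_eq, blockIndex_append, sum_sortedParts]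
  split_ifs with h
  · have := blockIndex_lt (L := sortedParts l.fst) (p := i) (by rwa [sum_sortedParts])
    omega
  · simp only [Nat.le_add_right, true_iff]
    omega

theorem qlam_of_lt (l : DoublePartition n) {i : Fin n} (hi : (i : ℕ) < l.fst.sum) :
    qlam l i = blockIndex (sortedParts l.fst) i := by
  rw [qlam, blockIndex_append, sum_sortedParts, if_pos hi]

theorem parabolicClosure_Wlam (l : Labels n) :
    parabolicClosure (Wlam l.1 : Set (WD n)) = Wlam l.1.merge := by
  rw [Wlam_eq_G, Wlam_eq_G]
  have hfst : l.1.merge.fst = l.1.fst := rfl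
  refine parabolicClosure_G (two_le_lam l) (fun i => ?_) (fun i j hi hj => ?_) (fun i j hi hj => ?_)
  · rw [qlam_mem_U_iff, qlam_mem_U_iff, hfst]
  · rw [qlam_mem_U_iff, not_le] at hi hj
    rw [qlam_of_lt _ hi, qlam_of_lt _ hj, qlam_of_lt l.1.merge (by rwa [hfst]),
      qlam_of_lt l.1.merge (by rwa [hfst]), hfst]
  · rw [qlam_mem_U_iff] at hi hj
    have hne : l.1.fst.sum ≠ n := by omega
    have hsnd : sortedParts l.1.merge.snd = [n - l.1.fst.sum] := by
      rw [DoublePartition.merge]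
      simp only [if_neg hne]
      exact Multiset.sort_singleton ..
    have key : ∀ i : Fin n, l.1.fst.sum ≤ i → qlam l.1.merge i = (sortedParts l.1.fst).length := by
      intro i hi
      rw [qlam, blockIndex_append, sum_sortedParts, hfst, if_neg (by omega), hsnd, blockIndex,
        if_pos (by omega), add_zero]
    rw [key i hi, key j hj]

theorem parabolicClosure_WlamSplit (l : n.Partition) (ε : ℤˣ) :
    parabolicClosure (WlamSplit l ε : Set (WD n)) = WlamSplit l ε := by
  rw [WlamSplit_eq_G]
  have h := not_mem_U_ofPartition l
  exact parabolicClosure_G (fun i hi => absurd hi (h i)) (fun _ => Iff.rfl)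
    (fun _ _ _ _ => Iff.rfl) (fun i _ hi _ => absurd hi (h i))

/-! ### Cycle types and conjugacy -/

theorem HasCycleType.unique {w : E n ≃ₗᵢ[ℝ] E n} {μ₁ μ₂ ν₁ ν₂ : Multiset ℕ} (hw : w ∈ WB n)
    (h : HasCycleType w μ₁ μ₂) (h' : HasCycleType w ν₁ ν₂) : μ₁ = ν₁ ∧ μ₂ = ν₂ := by
  obtain ⟨σ, s, rfl⟩ := exists_sp_of_mem_WB hw
  rw [hasCycleType_sp_iff] at h h'
  exact ⟨h.1.trans h'.1.symm, h.2.trans h'.2.symm⟩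

theorem HasCycleType.of_intertwine {g w w' : E n ≃ₗᵢ[ℝ] E n} {μ₁ μ₂ : Multiset ℕ} (hg : g ∈ WB n)
    (hw : w ∈ WB n) (hw' : w' ∈ WB n) (h : HasCycleType w μ₁ μ₂) (hgw : g * w = w' * g) :
    HasCycleType w' μ₁ μ₂ := by
  obtain ⟨σ, s, rfl⟩ := exists_sp_of_mem_WB hw
  obtain ⟨σ', s', rfl⟩ := exists_sp_of_mem_WB hw'
  obtain ⟨τ, t, rfl⟩ := exists_sp_of_mem_WB hg
  obtain ⟨h1, h2⟩ := types_eq_of_intertwine hgw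
  rw [hasCycleType_sp_iff] at h ⊢
  exact ⟨h.1.trans h1, h.2.trans h2⟩

theorem WD_le_WB : WD n ≤ WB n :=
  Subgroup.closure_mono (Set.image_mono Set.subset_union_left)

theorem card_cyc_mem_posType {σ : Equiv.Perm (Fin n)} {s : Fin n → ℤˣ} {i : Fin n}
    (h : ∏ j ∈ cyc σ i, s j = 1) : (cyc σ i).card ∈ posType σ s :=
  Multiset.mem_map.2 ⟨_, Finset.mem_filter.2 ⟨mem_cycles.2 ⟨i, rfl⟩, h⟩, rfl⟩

theorem card_cyc_mem_negType {σ : Equiv.Perm (Fin n)} {s : Fin n → ℤˣ} {i : Fin n}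
    (h : ¬∏ j ∈ cyc σ i, s j = 1) : (cyc σ i).card ∈ negType σ s :=
  Multiset.mem_map.2 ⟨_, Finset.mem_filter.2 ⟨mem_cycles.2 ⟨i, rfl⟩, h⟩, rfl⟩

theorem exists_of_mem_posType {σ : Equiv.Perm (Fin n)} {s : Fin n → ℤˣ} {k : ℕ}
    (h : k ∈ posType σ s) : ∃ i, (cyc σ i).card = k := by
  obtain ⟨C, hC, rfl⟩ := Multiset.mem_map.1 h
  obtain ⟨i, rfl⟩ := mem_cycles.1 (Finset.mem_filter.1 hC).1
  exact ⟨i, rfl⟩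

theorem exists_of_mem_negType {σ : Equiv.Perm (Fin n)} {s : Fin n → ℤˣ} {k : ℕ}
    (h : k ∈ negType σ s) : ∃ i, (cyc σ i).card = k ∧ ¬∏ j ∈ cyc σ i, s j = 1 := by
  obtain ⟨C, hC, rfl⟩ := Multiset.mem_map.1 h
  obtain ⟨h1, h2⟩ := (Finset.mem_filter (s := cycles σ)).1 hC
  obtain ⟨i, rfl⟩ := mem_cycles.1 h1
  exact ⟨i, rfl, h2⟩

theorem HasSplitCycleType.exists_perm {w : E n ≃ₗᵢ[ℝ] E n} {μ : Multiset ℕ} {ε : ℤˣ}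
    (hw : w ∈ WB n) (h : HasSplitCycleType w μ ε) :
    ∃ g ∈ WB n, (g ∈ WD n ↔ ε = 1) ∧ ∃ π : Equiv.Perm (Fin n), g⁻¹ * w * g = sp π 1 ∧
      posType π 1 = μ ∧ negType π 1 = 0 := by
  obtain ⟨h1, g, hg, hε, hperm⟩ := h
  have hmem : g⁻¹ * w * g ∈ WB n := mul_mem (mul_mem (inv_mem hg) hw) hg
  obtain ⟨π, s, hs⟩ := exists_sp_of_mem_WB hmem
  have hs1 : s = 1 := by
    funext i
    obtain ⟨j, hj⟩ := hperm i
    rw [hs, sp_e, ← sv_one, sv_inj] at hj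
    exact hj.1
  subst hs1
  have h2 : HasCycleType (g⁻¹ * w * g) μ 0 :=
    h1.of_intertwine (inv_mem hg) hw hmem (by group)
  rw [hs, hasCycleType_sp_iff] at h2
  exact ⟨g, hg, hε, π, hs, h2.1.symm, h2.2.symm⟩

theorem sp_perm_mem_WD (τ : Equiv.Perm (Fin n)) : sp τ 1 ∈ WD n := by
  rw [sp_mem_WD_iff]; simp

/-- Both elements are conjugate to permutations, and an intertwiner τ of these may be taken without
signs. As g and g' are both inside or both outside W(D_n), the element g' τ g⁻¹ lies in W(D_n). -/
theorem HasSplitCycleType.isConj {w w' : WD n} {μ : Multiset ℕ} {ε : ℤˣ}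
    (h : HasSplitCycleType w.1 μ ε) (h' : HasSplitCycleType w'.1 μ ε) : IsConj w w' := by
  obtain ⟨g, hg, hε, π, hπ, h1, h2⟩ := h.exists_perm (WD_le_WB w.2)
  obtain ⟨g', hg', hε', π', hπ', h1', h2'⟩ := h'.exists_perm (WD_le_WB w'.2)
  obtain ⟨τ, t, hτ⟩ := exists_intertwine_of_types_eq (h1.trans h1'.symm) (h2.trans h2'.symm)
  have hτ1 : sp τ 1 * sp π 1 = sp π' 1 * sp τ 1 := by
    rw [intertwine_iff] at hτ ⊢
    exact fun i => ⟨(hτ i).1, rfl⟩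
  have hk : g' * sp τ 1 * g⁻¹ ∈ WD n := by
    have hτ' := sp_perm_mem_WD (n := n) τ
    obtain ⟨τ₁, t₁, rfl⟩ := exists_sp_of_mem_WB hg
    obtain ⟨τ₂, t₂, rfl⟩ := exists_sp_of_mem_WB hg'
    have hiff : (∏ i, t₂ i = 1 ↔ ∏ i, t₁ i = 1) := by
      rw [← sp_mem_WD_iff (σ := τ₂) (s := t₂), ← sp_mem_WD_iff (σ := τ₁) (s := t₁), hε, hε']
    rw [sp_inv, sp_mul, sp_mul, sp_mem_WD_iff, Finset.prod_mul_distrib]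
    simp only [Pi.one_apply, one_mul]
    rw [Equiv.prod_comp τ₁⁻¹ t₁]
    have h3 : ∏ i, t₂ (τ (τ₁⁻¹ i)) = ∏ i, t₂ (τ i) :=
      Equiv.prod_comp τ₁⁻¹ fun i => t₂ (τ i)
    rw [h3, Equiv.prod_comp τ t₂]
    rcases Int.units_eq_one_or (∏ i, t₁ i) with h4 | h4
    · rw [h4, hiff.2 h4, one_mul]
    · rcases Int.units_eq_one_or (∏ i, t₂ i) with h5 | h5
      · rw [hiff.1 h5] at h4
        exact absurd h4 (by decide)
      · rw [h4, h5]; decide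
  rw [isConj_iff]
  refine ⟨⟨_, hk⟩, Subtype.ext ?_⟩
  change g' * sp τ 1 * g⁻¹ * w.1 * (g' * sp τ 1 * g⁻¹)⁻¹ = w'.1
  rw [mul_inv_eq_iff_eq_mul]
  have h3 : w.1 = g * sp π 1 * g⁻¹ := by rw [← hπ]; group
  have h4 : w'.1 = g' * sp π' 1 * g'⁻¹ := by rw [← hπ']; group
  rw [h3, h4]
  calc g' * sp τ 1 * g⁻¹ * (g * sp π 1 * g⁻¹) = g' * (sp τ 1 * sp π 1) * g⁻¹ := by group
    _ = g' * (sp π' 1 * sp τ 1) * g⁻¹ := by rw [hτ1]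
    _ = _ := by group

/-- The conjugating element yields an intertwiner of two permutations with only even cycles. It lies
in W(D_n) by `prod_eq_one_of_even_cycles`, so g and g' are both inside or both outside. -/
theorem HasSplitCycleType.sign_eq {w w' : WD n} {μ : Multiset ℕ} {ε ε' : ℤˣ}
    (hμ : ∀ k ∈ μ, Even k) (h : HasSplitCycleType w.1 μ ε) (h' : HasSplitCycleType w'.1 μ ε')
    (hconj : IsConj w w') : ε = ε' := by
  obtain ⟨g, hg, hε, π, hπ, h1, h2⟩ := h.exists_perm (WD_le_WB w.2)
  obtain ⟨g', hg', hε', π', hπ', h1', h2'⟩ := h'.exists_perm (WD_le_WB w'.2)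
  obtain ⟨v, hv⟩ := isConj_iff.1 hconj
  have hv' : v.1 * w.1 * v.1⁻¹ = w'.1 := congrArg Subtype.val hv
  have hmem : g'⁻¹ * v.1 * g ∈ WB n := mul_mem (mul_mem (inv_mem hg') (WD_le_WB v.2)) hg
  have hint : (g'⁻¹ * v.1 * g) * sp π 1 = sp π' 1 * (g'⁻¹ * v.1 * g) := by
    rw [← hπ, ← hπ', ← hv']
    group
  have hD : g'⁻¹ * v.1 * g ∈ WD n := by
    obtain ⟨τ, t, hτ⟩ := exists_sp_of_mem_WB hmem
    rw [hτ, intertwine_iff] at hint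
    rw [hτ, sp_mem_WD_iff]
    refine prod_eq_one_of_even_cycles (σ := π) (fun i => ?_) fun i => ?_
    · have := (hint i).2
      simpa using this
    · apply hμ
      rw [← h1]
      exact card_cyc_mem_posType (by simp)
  have hiff : g ∈ WD n ↔ g' ∈ WD n := by
    constructor
    · intro hgD
      have := mul_mem (mul_mem v.2 hgD) (inv_mem hD)
      have h3 : v.1 * g * (g'⁻¹ * v.1 * g)⁻¹ = g' := by group
      rwa [h3] at this
    · intro hgD
      have := mul_mem (mul_mem (inv_mem v.2) hgD) hD
      have h3 : v.1⁻¹ * g' * (g'⁻¹ * v.1 * g) = g := by group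
      rwa [h3] at this
  rw [hε, hε'] at hiff
  rcases Int.units_eq_one_or ε with h3 | h3
  · rw [h3, hiff.1 h3]
  · rcases Int.units_eq_one_or ε' with h4 | h4
    · rw [h4, hiff.2 h4]
    · rw [h3, h4]

/-! ### Coxeter elements of the standard subgroups -/

/-- The negative part of the cycle type of the Coxeter elements of a standard subgroup. -/
def coxeterNeg (μ : Multiset ℕ) : Multiset ℕ :=
  μ.map (fun k => k - 1) + Multiset.replicate (Multiset.card μ) 1

/-- The number of parts has been doubled, so μ and ν have equally many parts. The added parts 1 then
cancel, and raising the others by 1 recovers the partition. -/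
theorem coxeterNeg_injective {μ ν : Multiset ℕ} (hμ : ∀ k ∈ μ, 1 < k) (hν : ∀ k ∈ ν, 1 < k)
    (h : coxeterNeg μ = coxeterNeg ν) : μ = ν := by
  have hcard : Multiset.card μ = Multiset.card ν := by
    have := congrArg Multiset.card h
    simp only [coxeterNeg, Multiset.card_add, Multiset.card_map, Multiset.card_replicate] at this
    omega
  rw [coxeterNeg, coxeterNeg, hcard, add_left_inj] at h
  have key : ∀ μ : Multiset ℕ, (∀ k ∈ μ, 1 < k) →
      (μ.map fun k => k - 1).map (fun k => k + 1) = μ := by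
    intro μ hμ
    rw [Multiset.map_map]
    conv_rhs => rw [← Multiset.map_id μ]
    refine Multiset.map_congr rfl fun k hk => ?_
    have := hμ k hk
    simp only [Function.comp_apply, id]
    omega
  rw [← key μ hμ, h, key ν hν]

theorem coxeterNeg_eq_zero {μ : Multiset ℕ} : coxeterNeg μ = 0 ↔ μ = 0 := by
  constructor
  · intro h
    have := congrArg Multiset.card h
    simp only [coxeterNeg, Multiset.card_add, Multiset.card_map, Multiset.card_replicate,
      Multiset.card_zero] at this
    exact Multiset.card_eq_zero.1 (by omega)
  · rintro rfl; simp [coxeterNeg]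

theorem one_mem_coxeterNeg {μ : Multiset ℕ} (h : μ ≠ 0) : 1 ∈ coxeterNeg μ := by
  rw [coxeterNeg, Multiset.mem_add, Multiset.mem_replicate]
  exact Or.inr ⟨by simpa using h, rfl⟩

theorem hasCycleType_Wlam (l : Labels n) {c : WD n} (hc : IsCoxeterElement (Wlam l.1) c) :
    HasCycleType c.1 l.1.fst (coxeterNeg l.1.snd) := by
  rw [Wlam_eq_G] at hc
  obtain ⟨σ, s, hσ, h⟩ := hc.coxeterCycles (two_le_lam l)
  rw [hσ, hasCycleType_sp_iff, h.posType_eq, h.negType_eq (two_le_lam l), balSizes_lam,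
    unbSizes_lam]
  exact ⟨rfl, rfl⟩

theorem hasSplitCycleType_WlamSplit (hn : 0 < n) (l : n.Partition) (ε : ℤˣ) {c : WD n}
    (hc : IsCoxeterElement (WlamSplit l ε) c) : HasSplitCycleType c.1 l.parts ε := by
  rw [WlamSplit_eq_G] at hc
  have hU := not_mem_U_ofPartition l
  have h2 : ∀ i, qlam (ofPartition l) i ∈ Ulam (ofPartition l) → ∃ j, j ≠ i ∧
      qlam (ofPartition l) j = qlam (ofPartition l) i := fun i hi => absurd hi (hU i)
  obtain ⟨σ, s, hσ, h⟩ := hc.coxeterCycles h2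
  have hσ' : c.1 = sp σ s := hσ
  -- In a balanced block the sign at i is d_i d_{σ i}, so conjugation by the diagonal element with
  -- entries d removes all signs; this element has determinant ε.
  refine ⟨?_, sp 1 (splitSign n ε), sp_mem_WB _ _, ?_, fun i => ⟨σ i, ?_⟩⟩
  · rw [hσ', hasCycleType_sp_iff, h.posType_eq, h.negType_eq h2, balSizes_lam,
      unbSizes_lam]
    exact ⟨rfl, by simp [ofPartition]⟩
  · rw [sp_mem_WD_iff, prod_splitSign hn]
  · have h3 := (h.good.1 i).2.resolve_left (hU i)
    rw [one_mul] at h3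
    rw [hσ', sp_inv, sp_mul, sp_mul, sp_e, ← sv_one, sv_inj]
    refine ⟨?_, by simp⟩
    simp only [inv_one, Equiv.Perm.one_apply]
    rw [h3, mul_assoc, mul_comm (splitSign n ε (σ i)), mul_assoc, ← mul_assoc (s i),
      mul_comm (s i), ← mul_assoc] 
    simp [Int.units_mul_self]

/-- All labels of conjugacy classes of reflection subgroups. -/
abbrev AllLabels (n : ℕ) : Type := NonsplitLabels n ⊕ EvenPartitions n × ℤˣ

/-- The standard subgroup with the given label. -/
def standard : AllLabels n → Subgroup (WD n) :=
  Sum.elim (fun l => Wlam l.1) (fun p => WlamSplit p.1.1 p.2)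

theorem isReflectionSubgroup_Wlam (l : DoublePartition n) : IsReflectionSubgroup (Wlam l) := by
  rw [Wlam_eq_G]; exact isReflectionSubgroup_G _ _ _

theorem isReflectionSubgroup_standard (x : AllLabels n) : IsReflectionSubgroup (standard x) := by
  rcases x with l | ⟨l, ε⟩
  · exact isReflectionSubgroup_Wlam l.1
  · change IsReflectionSubgroup (WlamSplit l.1 ε)
    rw [WlamSplit_eq_G]; exact isReflectionSubgroup_G _ _ _

/-- For a nonsplit label a cycle of odd length is always present: an odd part of λ¹ if λ² is empty,
and otherwise a negative cycle of length 1. -/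
theorem isConj_of_standard (hn : 0 < n) {x : AllLabels n} {c c' : WD n}
    (hc : IsCoxeterElement (standard x) c) (hc' : IsCoxeterElement (standard x) c') :
    IsConj c c' := by
  rcases x with l | ⟨l, ε⟩
  · have h1 := hasCycleType_Wlam ⟨l.1, l.2.1⟩ hc
    have h1' := hasCycleType_Wlam ⟨l.1, l.2.1⟩ hc'
    obtain ⟨σ, s, hσ, -⟩ := exists_sp_of_mem_WD c.2
    obtain ⟨σ', s', hσ', -⟩ := exists_sp_of_mem_WD c'.2
    rw [hσ, hasCycleType_sp_iff] at h1
    rw [hσ', hasCycleType_sp_iff] at h1'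
    simp only at h1 h1'
    obtain ⟨g, hg, h⟩ := exists_intertwine_mem_WD (h1.1.symm.trans h1'.1)
        (h1.2.symm.trans h1'.2) (by
      by_cases hsnd : l.1.snd = 0
      · have h2 := l.2.2 hsnd
        push Not at h2
        obtain ⟨k, hk, hodd⟩ := h2
        rw [h1.1] at hk
        obtain ⟨i, rfl⟩ := exists_of_mem_posType hk
        exact ⟨i, Nat.not_even_iff_odd.1 hodd⟩
      · have h2 := one_mem_coxeterNeg hsnd
        rw [h1.2] at h2
        obtain ⟨i, hi, -⟩ := exists_of_mem_negType h2
        exact ⟨i, by rw [hi]; exact odd_one⟩)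
    rw [isConj_iff]
    refine ⟨⟨g, hg⟩, Subtype.ext ?_⟩
    change g * c.1 * g⁻¹ = c'.1
    rw [mul_inv_eq_iff_eq_mul, hσ, hσ', h]
  · exact (hasSplitCycleType_WlamSplit hn l.1 ε hc).isConj
      (hasSplitCycleType_WlamSplit hn l.1 ε hc')

/-- The cycle type of the Coxeter elements of a standard subgroup. -/
def labelType : AllLabels n → Multiset ℕ × Multiset ℕ :=
  Sum.elim (fun l => (l.1.fst, coxeterNeg l.1.snd)) (fun p => (p.1.1.parts, 0))

theorem hasCycleType_standard (hn : 0 < n) {x : AllLabels n} {c : WD n}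
    (hc : IsCoxeterElement (standard x) c) :
    HasCycleType c.1 (labelType x).1 (labelType x).2 := by
  rcases x with l | ⟨l, ε⟩
  · exact hasCycleType_Wlam ⟨l.1, l.2.1⟩ hc
  · exact (hasSplitCycleType_WlamSplit hn l.1 ε hc).1

theorem hasCycleType_of_isConj {c c' : WD n} {μ₁ μ₂ : Multiset ℕ} (h : HasCycleType c.1 μ₁ μ₂)
    (hconj : IsConj c c') : HasCycleType c'.1 μ₁ μ₂ := by
  obtain ⟨v, hv⟩ := isConj_iff.1 hconj
  refine h.of_intertwine (WD_le_WB v.2) (WD_le_WB c.2) (WD_le_WB c'.2) ?_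
  rw [← mul_inv_eq_iff_eq_mul]
  exact congrArg Subtype.val hv

/-- Cycle types recover the label up to ε, and a nonsplit label cannot share its type with a split
one because its λ¹ is not even when λ² is empty. The sign ε is an invariant by
`HasSplitCycleType.sign_eq`. -/
theorem label_eq_of_isConj (hn : 0 < n) {x y : AllLabels n} {c c' : WD n}
    (hc : IsCoxeterElement (standard x) c) (hc' : IsCoxeterElement (standard y) c')
    (hconj : IsConj c c') : x = y := by
  have h1 := hasCycleType_of_isConj (hasCycleType_standard hn hc) hconj
  obtain ⟨h2, h3⟩ := h1.unique (WD_le_WB c'.2) (hasCycleType_standard hn hc')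
  rcases x with l | ⟨l, ε⟩ <;> rcases y with l' | ⟨l', ε'⟩
  · congr 1
    apply Subtype.ext
    exact DoublePartition.ext h2 (coxeterNeg_injective l.2.1 l'.2.1 h3)
  · exfalso
    have h4 : l.1.snd = 0 := coxeterNeg_eq_zero.1 h3
    have h5 : l.1.fst = l'.1.parts := h2
    exact l.2.2 h4 (by rw [h5]; exact l'.2)
  · exfalso
    have h4 : l'.1.snd = 0 := coxeterNeg_eq_zero.1 h3.symm
    have h5 : l.1.parts = l'.1.fst := h2
    exact l'.2.2 h4 (by rw [← h5]; exact l.2)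
  · have h4 : l = l' := Subtype.ext (Nat.Partition.ext h2)
    subst h4
    have h5 := (hasSplitCycleType_WlamSplit hn l.1 ε hc).sign_eq l.2
      (hasSplitCycleType_WlamSplit hn l.1 ε' hc') hconj
    rw [h5]

/-- The sizes of the blocks give the label. If all blocks are balanced of even size, the product of
the d_i is kept as ε; in the other case some block absorbs it. -/
theorem exists_conj_standard (hn : 0 < n) {R : Subgroup (WD n)} (hR : IsReflectionSubgroup R) :
    ∃ x : AllLabels n, SubgroupConj R (standard x) := by
  obtain ⟨q, U, d, rfl, hU⟩ := hR.exists_eq_G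
  by_cases h : unbSizes q U = 0 ∧ ∀ k ∈ balSizes q U, Even k
  · let l : n.Partition :=
      { parts := balSizes q U
        parts_pos := fun hk => balSizes_pos q U _ hk
        parts_sum := by
          have := sum_sizes q U
          rwa [h.1, Multiset.sum_zero, add_zero] at this }
    refine ⟨Sum.inr (⟨l, h.2⟩, ∏ i, d i), ?_⟩
    change SubgroupConj _ (WlamSplit l _)
    rw [WlamSplit_eq_G]
    apply subgroupConj_of_sizes_eq'
    · rw [balSizes_lam]; rfl
    · rw [unbSizes_lam, h.1]; rfl
    · rw [prod_splitSign hn]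
  · let l : DoublePartition n :=
      { fst := balSizes q U
        snd := unbSizes q U
        fst_pos := balSizes_pos q U
        snd_pos := fun k hk => zero_lt_one.trans (one_lt_unbSizes hU k hk)
        sum_eq := sum_sizes q U }
    refine ⟨Sum.inl ⟨l, one_lt_unbSizes hU, fun h1 h2 => h ⟨h1, h2⟩⟩, ?_⟩
    change SubgroupConj _ (Wlam l)
    rw [Wlam_eq_G]
    have hex : ∃ i, q i ∈ U ∨ Odd (blk q (q i)).card := by
      by_cases h1 : unbSizes q U = 0
      · have h2 : ¬∀ k ∈ balSizes q U, Even k := fun h2 => h ⟨h1, h2⟩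
        push Not at h2
        obtain ⟨k, hk, hodd⟩ := h2
        classical
        obtain ⟨m, hm, rfl⟩ := Multiset.mem_map.1 hk
        rw [Finset.mem_val, Finset.mem_filter, Finset.mem_image] at hm
        obtain ⟨⟨i, -, rfl⟩, -⟩ := hm
        exact ⟨i, Or.inr (Nat.not_even_iff_odd.1 hodd)⟩
      · rw [unbSizes_eq_zero_iff] at h1
        push Not at h1
        obtain ⟨i, hi⟩ := h1
        exact ⟨i, Or.inl hi⟩
    obtain ⟨i, hi⟩ := hex
    refine subgroupConj_of_sizes_eq ?_ ?_ hi
    · rw [balSizes_lam]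
    · rw [unbSizes_lam]

theorem SubgroupConj.symm' {R R' : Subgroup (WD n)} (hR : IsReflectionSubgroup R)
    (hR' : IsReflectionSubgroup R') (h : SubgroupConj R R') : SubgroupConj R' R :=
  (conjSetoid n).symm (a := ⟨R, hR⟩) (b := ⟨R', hR'⟩) h

theorem SubgroupConj.trans' {R R' R'' : Subgroup (WD n)} (hR : IsReflectionSubgroup R)
    (hR' : IsReflectionSubgroup R') (hR'' : IsReflectionSubgroup R'') (h : SubgroupConj R R')
    (h' : SubgroupConj R' R'') : SubgroupConj R R'' :=
  (conjSetoid n).trans (a := ⟨R, hR⟩) (b := ⟨R', hR'⟩) (c := ⟨R'', hR''⟩) h h'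

theorem SubgroupConj.exists_isCoxeterElement {R R' : Subgroup (WD n)} (h : SubgroupConj R R')
    {c : WD n} (hc : IsCoxeterElement R c) : ∃ c', IsConj c c' ∧ IsCoxeterElement R' c' := by
  obtain ⟨w, rfl⟩ := h
  exact ⟨w * c * w⁻¹, isConj_iff.2 ⟨w, rfl⟩, hc.conj w⟩

theorem isConj_of_subgroupConj (hn : 0 < n) {R R' : Subgroup (WD n)}
    (hR' : IsReflectionSubgroup R') (h : SubgroupConj R R') {c c' : WD n}
    (hc : IsCoxeterElement R c) (hc' : IsCoxeterElement R' c') : IsConj c c' := by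
  obtain ⟨x, hx⟩ := exists_conj_standard hn hR'
  obtain ⟨c₁, h1, h2⟩ := h.exists_isCoxeterElement hc
  obtain ⟨c₂, h3, h4⟩ := hx.exists_isCoxeterElement h2
  obtain ⟨c₃, h5, h6⟩ := hx.exists_isCoxeterElement hc'
  exact ((h1.trans h3).trans (isConj_of_standard hn h4 h6)).trans h5.symm

theorem subgroupConj_of_isConj (hn : 0 < n) {R R' : Subgroup (WD n)} (hR : IsReflectionSubgroup R)
    (hR' : IsReflectionSubgroup R') {c c' : WD n} (hc : IsCoxeterElement R c)
    (hc' : IsCoxeterElement R' c') (h : IsConj c c') : SubgroupConj R R' := by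
  obtain ⟨x, hx⟩ := exists_conj_standard hn hR
  obtain ⟨y, hy⟩ := exists_conj_standard hn hR'
  obtain ⟨c₁, h1, h2⟩ := hx.exists_isCoxeterElement hc
  obtain ⟨c₂, h3, h4⟩ := hy.exists_isCoxeterElement hc'
  obtain rfl := label_eq_of_isConj hn h2 h4 ((h1.symm.trans h).trans h3)
  exact hx.trans' hR (isReflectionSubgroup_standard x) hR'
    (hy.symm' hR' (isReflectionSubgroup_standard x))

/-- Uniqueness comes from elements: if two standard subgroups are conjugate to R, a Coxeter element
of R gives conjugate Coxeter elements of both, which determine the label. -/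
theorem representsReflClasses_standard (hn : 0 < n) :
    RepresentsReflClasses (standard (n := n)) := by
  refine ⟨isReflectionSubgroup_standard, fun R hR => ?_⟩
  obtain ⟨x, hx⟩ := exists_conj_standard hn hR
  refine ⟨x, hx, fun y hy => ?_⟩
  obtain ⟨c, hc⟩ := TypeD.exists_isCoxeterElement hR
  obtain ⟨c₁, h1, h2⟩ := hx.exists_isCoxeterElement hc
  obtain ⟨c₂, h3, h4⟩ := hy.exists_isCoxeterElement hc
  exact label_eq_of_isConj hn h4 h2 (h3.symm.trans h1)

theorem representsReflClasses_of_odd (hn : Odd n) :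
    RepresentsReflClasses fun l : Labels n => Wlam l.1 := by
  have hnonsplit : ∀ l : Labels n, l.1.snd = 0 → ¬∀ k ∈ l.1.fst, Even k := by
    intro l h1 h2
    have h3 := l.1.sum_eq
    rw [h1, Multiset.sum_zero, add_zero] at h3
    have h4 : Even l.1.fst.sum := by
      rw [even_iff_two_dvd]
      exact Multiset.dvd_sum fun k hk => even_iff_two_dvd.1 (h2 k hk)
    rw [h3] at h4
    exact Nat.not_even_iff_odd.2 hn h4
  have hnone : IsEmpty (EvenPartitions n) := by
    constructor
    rintro ⟨l, hl⟩
    have h4 : Even l.parts.sum := by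
      rw [even_iff_two_dvd]
      exact Multiset.dvd_sum fun k hk => even_iff_two_dvd.1 (hl k hk)
    rw [l.parts_sum] at h4
    exact Nat.not_even_iff_odd.2 hn h4
  refine ⟨fun l => isReflectionSubgroup_Wlam l.1, fun R hR => ?_⟩
  obtain ⟨x, hx, huniq⟩ := (representsReflClasses_standard hn.pos).2 R hR
  rcases x with l | ⟨l, ε⟩
  · refine ⟨⟨l.1, l.2.1⟩, hx, fun l' hl' => ?_⟩
    have := huniq (Sum.inl ⟨l'.1, l'.2, hnonsplit l'⟩) hl'
    rw [Sum.inl.injEq, Subtype.ext_iff] at this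
    exact Subtype.ext this
  · exact hnone.elim l

/-! ### The map to conjugacy classes of elements -/

theorem cyc_of_two {σ : Equiv.Perm (Fin n)} {a b : Fin n} (hab : σ a = b) (hba : σ b = a) :
    cyc σ a = {a, b} := by
  ext j
  rw [mem_cyc, Finset.mem_insert, Finset.mem_singleton]
  constructor
  · intro h
    obtain ⟨k, -, rfl⟩ := (isCycleOn_cyc σ a).exists_pow_eq (self_mem_cyc σ a) (mem_cyc.2 h)
    clear h
    induction k with
    | zero => exact Or.inl rfl
    | succ k ih =>
      rw [pow_succ', Equiv.Perm.mul_apply]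
      rcases ih with h | h
      · rw [h]; exact Or.inr hab
      · rw [h]; exact Or.inl hba
  · rintro (rfl | rfl)
    · exact Equiv.Perm.SameCycle.refl σ j
    · exact ⟨1, by simpa using hab⟩

/-- The negative part of the type of a label is empty or contains 1. An element with two negative
cycles of length 2 and positive fixed points otherwise has neither property, and it has two sign
changes; this needs four coordinates. -/
theorem exists_no_label_type (hn : 4 ≤ n) :
    ∃ w : WD n, ∀ x : AllLabels n, ¬HasCycleType w.1 (labelType x).1 (labelType x).2 := by
  let a : Fin n := ⟨0, by omega⟩
  let b : Fin n := ⟨1, by omega⟩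
  let a' : Fin n := ⟨2, by omega⟩
  let b' : Fin n := ⟨3, by omega⟩
  have hab : a ≠ b := by simp [a, b]
  have haa' : a ≠ a' := by simp [a, a']
  have hab' : a ≠ b' := by simp [a, b']
  have hba' : b ≠ a' := by simp [b, a']
  have hbb' : b ≠ b' := by simp [b, b']
  have hab2 : a' ≠ b' := by simp [a', b']
  let σ : Equiv.Perm (Fin n) := Equiv.swap a b * Equiv.swap a' b'
  let s : Fin n → ℤˣ := fun i => (if i = a then -1 else 1) * (if i = a' then -1 else 1)
  have hw : sp σ s ∈ WD n := by
    rw [sp_mem_WD_iff, Finset.prod_mul_distrib, Finset.prod_ite_eq', Finset.prod_ite_eq']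
    simp
  have hσa : σ a = b := by
    simp only [σ, Equiv.Perm.mul_apply]
    rw [Equiv.swap_apply_of_ne_of_ne haa' hab', Equiv.swap_apply_left]
  have hσb : σ b = a := by
    simp only [σ, Equiv.Perm.mul_apply]
    rw [Equiv.swap_apply_of_ne_of_ne hba' hbb', Equiv.swap_apply_right]
  have hσa' : σ a' = b' := by
    simp only [σ, Equiv.Perm.mul_apply]
    rw [Equiv.swap_apply_left, Equiv.swap_apply_of_ne_of_ne hab'.symm hbb'.symm]
  have hneg : (cyc σ a).card ∈ negType σ s := by
    apply card_cyc_mem_negType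
    rw [cyc_of_two hσa hσb, Finset.prod_pair hab]
    simp [s, hab.symm, haa', hba']
  refine ⟨⟨_, hw⟩, fun x hx => ?_⟩
  have hx' : HasCycleType (sp σ s) (labelType x).1 (labelType x).2 := hx
  rw [hasCycleType_sp_iff] at hx'
  rcases x with l | ⟨l, ε⟩
  · have h1 : coxeterNeg l.1.snd = negType σ s := hx'.2
    by_cases h2 : l.1.snd = 0
    · rw [← h1, coxeterNeg_eq_zero.2 h2] at hneg
      exact absurd hneg (Multiset.notMem_zero _)
    · have h3 := one_mem_coxeterNeg h2
      rw [h1] at h3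
      obtain ⟨i, hi, hprod⟩ := exists_of_mem_negType h3
      obtain ⟨j, hj⟩ := Finset.card_eq_one.1 hi
      have h4 : i = j := by
        rw [← Finset.mem_singleton, ← hj]; exact self_mem_cyc σ i
      have h5 : σ i = j := by
        rw [← Finset.mem_singleton, ← hj, mem_cyc]
        exact ⟨1, by simp⟩
      rw [hj, Finset.prod_singleton] at hprod
      have h6 : j = a ∨ j = a' := by
        by_contra hne
        rw [not_or] at hne
        exact hprod (by simp [s, hne.1, hne.2])
      rw [h4] at h5
      rcases h6 with rfl | rfl
      · exact hab (h5.symm.trans hσa)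
      · exact hab2 (h5.symm.trans hσa')
  · have h1 : (0 : Multiset ℕ) = negType σ s := hx'.2
    rw [← h1] at hneg
    exact absurd hneg (Multiset.notMem_zero _)

theorem exists_coxeter_map (hn : 4 ≤ n) :
    ∃ γ : ReflClasses n → ConjClasses (WD n),
      (∀ (R : Subgroup (WD n)) (hR : IsReflectionSubgroup R) (c : WD n),
        IsCoxeterElement R c → γ (ReflClasses.mk R hR) = ConjClasses.mk c) ∧
      Function.Injective γ ∧ ¬Function.Surjective γ := by
  have hn0 : 0 < n := by omega
  let cox : {R : Subgroup (WD n) // IsReflectionSubgroup R} → WD n :=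
    fun R => (TypeD.exists_isCoxeterElement R.2).choose
  have hcox : ∀ R, IsCoxeterElement R.1 (cox R) :=
    fun R => (TypeD.exists_isCoxeterElement R.2).choose_spec
  let γ : ReflClasses n → ConjClasses (WD n) :=
    Quotient.lift (fun R => ConjClasses.mk (cox R)) fun R R' h =>
      ConjClasses.mk_eq_mk_iff_isConj.2
        (isConj_of_subgroupConj hn0 R'.2 h (hcox R) (hcox R'))
  have hγ : ∀ (R : Subgroup (WD n)) (hR : IsReflectionSubgroup R) (c : WD n),
      IsCoxeterElement R c → γ (ReflClasses.mk R hR) = ConjClasses.mk c := by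
    intro R hR c hc
    exact ConjClasses.mk_eq_mk_iff_isConj.2 (isConj_of_subgroupConj hn0 hR
      ((conjSetoid n).refl ⟨R, hR⟩) (hcox ⟨R, hR⟩) hc)
  refine ⟨γ, hγ, ?_, ?_⟩
  · intro C C'
    induction C using Quotient.inductionOn with | _ R =>
    induction C' using Quotient.inductionOn with | _ R' =>
    intro h
    apply Quotient.sound
    exact subgroupConj_of_isConj hn0 R.2 R'.2 (hcox R) (hcox R')
      (ConjClasses.mk_eq_mk_iff_isConj.1 h)
  · intro hsurj
    obtain ⟨w, hw⟩ := exists_no_label_type hn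
    obtain ⟨C, hC⟩ := hsurj (ConjClasses.mk w)
    induction C using Quotient.inductionOn with | _ R =>
    obtain ⟨x, hx⟩ := exists_conj_standard hn0 R.2
    obtain ⟨c, h1, h2⟩ := hx.exists_isCoxeterElement (hcox R)
    have h3 : IsConj (cox R) w := ConjClasses.mk_eq_mk_iff_isConj.1 hC
    exact hw x (hasCycleType_of_isConj (hasCycleType_standard hn0 h2) (h1.symm.trans h3))

end TypeD

end

theorem theorem3p3 (n : ℕ) (hn : 4 ≤ n) :
    -- representatives of the conjugacy classes of reflection subgroups
    (Odd n → TypeD.RepresentsReflClasses fun l : TypeD.Labels n => TypeD.Wlam l.1) ∧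
    (Even n → TypeD.RepresentsReflClasses
      (Sum.elim (fun l : TypeD.NonsplitLabels n => TypeD.Wlam l.1)
        (fun p : TypeD.EvenPartitions n × ℤˣ => TypeD.WlamSplit p.1.1 p.2))) ∧
    -- parabolic closures
    (∀ l : TypeD.Labels n,
      TypeD.parabolicClosure (TypeD.Wlam l.1 : Set (TypeD.WD n)) = TypeD.Wlam l.1.merge) ∧
    (∀ (l : TypeD.EvenPartitions n) (ε : ℤˣ),
      TypeD.parabolicClosure (TypeD.WlamSplit l.1 ε : Set (TypeD.WD n)) =
        TypeD.WlamSplit l.1 ε) ∧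
    -- cycle types of Coxeter elements
    (∀ (l : TypeD.Labels n) (c : TypeD.WD n), TypeD.IsCoxeterElement (TypeD.Wlam l.1) c →
      TypeD.HasCycleType c.1 l.1.fst
        (l.1.snd.map (fun k => k - 1) + Multiset.replicate (Multiset.card l.1.snd) 1)) ∧
    (∀ (l : TypeD.EvenPartitions n) (ε : ℤˣ) (c : TypeD.WD n),
      TypeD.IsCoxeterElement (TypeD.WlamSplit l.1 ε) c →
        TypeD.HasSplitCycleType c.1 l.1.parts ε) ∧
    -- every reflection subgroup has Coxeter elements, and their class defines the map `γ`
    (∀ R : Subgroup (TypeD.WD n), TypeD.IsReflectionSubgroup R →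
      ∃ c, TypeD.IsCoxeterElement R c) ∧
    ∃ γ : TypeD.ReflClasses n → ConjClasses (TypeD.WD n),
      (∀ (R : Subgroup (TypeD.WD n)) (hR : TypeD.IsReflectionSubgroup R) (c : TypeD.WD n),
        TypeD.IsCoxeterElement R c → γ (TypeD.ReflClasses.mk R hR) = ConjClasses.mk c) ∧
      Function.Injective γ ∧ ¬ Function.Surjective γ := by
  have hn0 : 0 < n := by omega
  exact ⟨TypeD.representsReflClasses_of_odd,
    fun _ => TypeD.representsReflClasses_standard hn0,
    TypeD.parabolicClosure_Wlam,
    fun l ε => TypeD.parabolicClosure_WlamSplit l.1 ε,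
    fun l _ hc => TypeD.hasCycleType_Wlam l hc,
    fun l ε _ hc => TypeD.hasSplitCycleType_WlamSplit hn0 l.1 ε hc,
    fun _ hR => TypeD.exists_isCoxeterElement hR,
    TypeD.exists_coxeter_map hn⟩
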